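/- Let $S=\{\infty\}\cup S_f$ with $S_f$ a finite (possibly empty) set of primes, $\mathbb Q_\infty=\mathbb R$, and $\mathbb Q_S=\prod_{p\in S}\mathbb Q_p$. Equip $\mathbb Q_S$ with the product $\mu$ of Lebesgue measure on $\mathbb R$ and the Haar measures on $\mathbb Q_p$ ($p\in S_f$) with $\mu_p(\mathbb Z_p)=1$, and $(\mathbb Q_S^d)^r$ with the product measure $d\mathbf v_1\cdots d\mathbf v_r$. Let $\mathbb Z_S$ be the set of $z\in\mathbb Q$ with $|z|_p\le 1$ for all primes $p\notin S$, embedded diagonally in $\mathbb Q_S$. Put $$\mathrm{UL}_d(\mathbb Q_S)=\{(g_p)_{p\in S}\in \mathrm{GL}_d(\mathbb Q_S):\det g_\infty=1,\ |\det g_p|_p=1\ (p\in S_f)\},\qquad \mathrm{SL}_d(\mathbb Q_S)=\prod_{p\in S}\mathrm{SL}_d(\mathbb Q_p),$$ and let $\mathrm{UL}_d(\mathbb Z_S)$, $\mathrm{SL}_d(\mathbb Z_S)$ be their subgroups of matrices with entries in $\mathbb Z_S$. Let $\mathbb N_S$ be the set of positive integers coprime to all primes in $S_f$. A matrix $D\in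 M_{r,k}(\mathbb Z_S)$ is called reduced if for some positive integer $t$ the matrix $tD$ has integer entries with greatest common divisor $1$. For $q\in\mathbb N_S$ and $1\le r\le k$ let $\mathfrak D_{r,q}$ be the set of reduced $D\in M_{r,k}(\mathbb Z_S)$ for which there are $1\le j_1<\dots<j_r\le k$ such that the columns $j_1,\dots,j_r$ of $D$ form $q\,\mathrm{Id}_r$ and $D_{ij}=0$ whenever $1\le i\le r$ and $j<j_i$. Let $N(D,q)$ be the number of $\mathbf x\in\{0,1,\dots,q-1\}^r$ with $\frac1q\mathbf xD\in\mathbb Z_S^k$. **Theorem.** Let $d\ge2$ and $1\le k\le d-1$, let $(G,\Gamma)$ be $(\mathrm{UL}_d(\mathbb Q_S),\mathrm{UL}_d(\mathbb Z_S))$ or $(\mathrm{SL}_d(\mathbb Q_S),\mathrm{SL}_d(\mathbb Z_S))$, and let $dg$ be the $G$-invariant Borel probability measure on $G/\Gamma$. Let $f:(\mathbb Q_S^d)^k\to\mathbb R_{\ge0}$ be a continuous (hence bounded) function of compact support, and for $\Lambda=g\mathbb Z_S^d$, $g\Gamma\in G/\Gamma$, put $$\mathcal S_kf(\Lambda)=\sum_{\mathbf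 v_1,\dots,\mathbf v_k\in\Lambda}f(\mathbf v_1,\dots,\mathbf v_k).$$ This sum has only finitely many nonzero terms for each $\Lambda$, the function $\mathcal S_kf$ is integrable on $G/\Gamma$, all integrals and sums below converge, and $$\int_{G/\Gamma}\mathcal S_kf\,dg=f(0,\dots,0)+\int_{(\mathbb Q_S^d)^k}f\,d\mathbf v_1\cdots d\mathbf v_k+\sum_{r=1}^{k-1}\sum_{q\in\mathbb N_S}\sum_{D\in\mathfrak D_{r,q}}\frac{N(D,q)^d}{q^{dr}}\int_{(\mathbb Q_S^d)^r}f\Big(\frac1q(\mathbf v_1,\dots,\mathbf v_r)D\Big)d\mathbf v_1\cdots d\mathbf v_r,$$ where $(\mathbf v_1,\dots,\mathbf v_r)$ is regarded as a $d\times r$ matrix. -/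

import Mathlib

open MeasureTheory Matrix

noncomputable section

namespace SArith

/-! ### The ring `ℚ_S` and its Haar measure

A finite set `S_f` of primes is a `Finset PrimeNum`; the infinite place always belongs to `S`. -/

/-- The type of prime numbers. -/
abbrev PrimeNum : Type := {p : ℕ // p.Prime}

instance factPrime (p : PrimeNum) : Fact (p : ℕ).Prime := ⟨p.2⟩

instance padicMeasurableSpace (p : ℕ) [Fact p.Prime] : MeasurableSpace ℚ_[p] := borel _

instance padicBorelSpace (p : ℕ) [Fact p.Prime] : BorelSpace ℚ_[p] := ⟨rfl⟩

/-- `ℚ_S = ℝ × ∏_{p ∈ S_f} ℚ_p`. -/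
abbrev QS (S : Finset PrimeNum) : Type := ℝ × (∀ p : S, ℚ_[p.1.1])

/-- `ℤ_p = {x ∈ ℚ_p : |x|_p ≤ 1}`, as a compact set with non-empty interior. -/
def padicUnitBall (p : ℕ) [Fact p.Prime] : TopologicalSpace.PositiveCompacts ℚ_[p] where
  carrier := Metric.closedBall 0 1
  isCompact' := isCompact_closedBall 0 1
  interior_nonempty' :=
    ⟨0, interior_mono Metric.ball_subset_closedBall
      (by rw [Metric.isOpen_ball.interior_eq]; exact Metric.mem_ball_self one_pos)⟩

/-- The Haar measure on `ℚ_p` with `μ_p(ℤ_p) = 1`. -/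
def padicHaar (p : ℕ) [Fact p.Prime] : Measure ℚ_[p] := Measure.addHaarMeasure (padicUnitBall p)

/-- The measure `μ` on `ℚ_S`: Lebesgue measure times the normalized `p`-adic Haar measures. -/
def muQS (S : Finset PrimeNum) : Measure (QS S) :=
  (volume : Measure ℝ).prod (Measure.pi fun p : S => padicHaar p.1.1)

/-- The product measure `μ^{dr}` on `(ℚ_S^d)^r`. -/
def muVec (S : Finset PrimeNum) (d r : ℕ) : Measure (Fin r → Fin d → QS S) :=
  Measure.pi fun _ => Measure.pi fun _ => muQS S

/-! ### The ring of `S`-integers -/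

/-- The diagonal embedding `ℚ → ℚ_S`, `z ↦ (z, …, z)`. -/
def diagQ (S : Finset PrimeNum) : ℚ →+* QS S :=
  (Rat.castHom ℝ).prod (RingHom.pi fun p : S => Rat.castHom ℚ_[p.1.1])

/-- The ring of `S`-integers inside `ℚ`: all `z` with `|z|_p ≤ 1` for every prime `p ∉ S`. -/
def SInt (S : Finset PrimeNum) : Subring ℚ where
  carrier := {z | ∀ p : PrimeNum, p ∉ S → padicNorm p z ≤ 1}
  mul_mem' {a b} ha hb p hp := by
    rw [padicNorm.mul]
    exact mul_le_one₀ (ha p hp) (padicNorm.nonneg _) (hb p hp)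
  one_mem' p _ := by simp
  add_mem' {a b} ha hb p hp := padicNorm.nonarchimedean.trans (max_le (ha p hp) (hb p hp))
  zero_mem' p _ := by simp
  neg_mem' {a} ha p hp := by
    rw [padicNorm.neg]
    exact ha p hp

/-- `ℤ_S = {(z, …, z) ∈ ℚ_S : z an S-integer}`. -/
def ZS (S : Finset PrimeNum) : Subring (QS S) := (SInt S).map (diagQ S)

/-! ### The groups and their arithmetic subgroups -/

/-- `UL_d(ℚ_S)`: all `g = (g_p)_{p ∈ S}` with `det g_∞ = 1` and `|det g_p|_p = 1`, `p ∈ S_f`. -/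
def ULQ (d : ℕ) (S : Finset PrimeNum) : Subgroup (GL (Fin d) (QS S)) where
  carrier := {g | (g.1.det).1 = 1 ∧ ∀ p : S, ‖(g.1.det).2 p‖ = 1}
  mul_mem' {a b} ha hb := by
    refine ⟨?_, fun p => ?_⟩
    · simp [Matrix.det_mul, ha.1, hb.1]
    · simp [Matrix.det_mul, ha.2 p, hb.2 p]
  one_mem' := by simp
  inv_mem' {a} ha := by
    have h : a.1.det * (a⁻¹).1.det = 1 := by
      rw [← Matrix.det_mul, Units.mul_inv, Matrix.det_one]
    refine ⟨?_, fun p => ?_⟩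
    · have h1 := congrArg Prod.fst h
      simpa [ha.1] using h1
    · have h1 := congrArg (fun x : QS S => ‖x.2 p‖) h
      simpa [ha.2 p] using h1

/-- `SL_d(ℚ_S) = ∏_{p ∈ S} SL_d(ℚ_p)`. -/
def SLQ (d : ℕ) (S : Finset PrimeNum) : Subgroup (GL (Fin d) (QS S)) where
  carrier := {g | g.1.det = 1}
  mul_mem' {a b} ha hb := by
    have ha' : a.1.det = 1 := ha
    have hb' : b.1.det = 1 := hb
    simp [Matrix.det_mul, ha', hb']
  one_mem' := by simp
  inv_mem' {a} ha := by
    have ha' : a.1.det = 1 := ha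
    have h : a.1.det * (a⁻¹).1.det = 1 := by
      rw [← Matrix.det_mul, Units.mul_inv, Matrix.det_one]
    rw [ha', one_mul] at h
    exact h

theorem SLQ_le_ULQ (d : ℕ) (S : Finset PrimeNum) : SLQ d S ≤ ULQ d S := by
  intro g hg
  have hg' : g.1.det = 1 := hg
  exact ⟨by simp [hg'], fun p => by simp [hg']⟩

/-- The arithmetic subgroup `Γ = G ∩ GL_d(ℤ_S)` of `G`. For `G ≤ UL_d(ℚ_S)` it is
`G ∩ M_d(ℤ_S)`, see `mem_arith_iff`; so it is `UL_d(ℤ_S)` and `SL_d(ℤ_S)` for the two groups. -/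
def arith {d : ℕ} {S : Finset PrimeNum} (G : Subgroup (GL (Fin d) (QS S))) : Subgroup G where
  carrier := {g | (∀ i j, (g : GL (Fin d) (QS S)).1 i j ∈ ZS S) ∧
    ∀ i j, ((g : GL (Fin d) (QS S))⁻¹).1 i j ∈ ZS S}
  mul_mem' {a b} ha hb := by
    refine ⟨fun i j => ?_, fun i j => ?_⟩
    · simp only [Subgroup.coe_mul, Units.val_mul, Matrix.mul_apply]
      exact sum_mem fun l _ => mul_mem (ha.1 i l) (hb.1 l j)
    · rw [Subgroup.coe_mul, _root_.mul_inv_rev, Units.val_mul, Matrix.mul_apply]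
      exact sum_mem fun l _ => mul_mem (hb.2 i l) (ha.2 l j)
  one_mem' := by
    refine ⟨fun i j => ?_, fun i j => ?_⟩ <;>
    · simp only [Subgroup.coe_one, inv_one, Units.val_one, Matrix.one_apply]
      split_ifs
      exacts [one_mem _, zero_mem _]
  inv_mem' {a} ha := ⟨by simpa using ha.2, by simpa using ha.1⟩

theorem mem_arith_iff {d : ℕ} {S : Finset PrimeNum} {G : Subgroup (GL (Fin d) (QS S))}
    (hG : G ≤ ULQ d S) (g : G) :
    g ∈ arith G ↔ ∀ i j, (g : GL (Fin d) (QS S)).1 i j ∈ ZS S := by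
  refine ⟨fun h => h.1, fun h => ⟨h, ?_⟩⟩
  obtain ⟨g, hg⟩ := g
  obtain ⟨M, hM⟩ : ∃ M : Matrix (Fin d) (Fin d) (ZS S), (ZS S).subtype.mapMatrix M = g.1 :=
    ⟨fun i j => ⟨g.1 i j, h i j⟩, by ext <;> rfl⟩
  have hdet : g.1.det = (M.det : ZS S) := by
    rw [← hM, ← RingHom.map_det]; rfl
  obtain ⟨z, -, hz⟩ := (M.det).2
  have hz1 : z = 1 := by
    have h1 := (hG hg).1
    rw [hdet, ← hz] at h1
    have h2 : ((z : ℚ) : ℝ) = 1 := h1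
    exact_mod_cast h2
  have hd1 : g.1.det = 1 := by rw [hdet, ← hz, hz1, map_one]
  have hinv : (g⁻¹).1 = (ZS S).subtype.mapMatrix M.adjugate := by
    rw [RingHom.map_adjugate, hM, Matrix.coe_units_inv, Matrix.inv_def, hd1, Ring.inverse_one,
      one_smul]
  intro i j
  change (g⁻¹).1 i j ∈ ZS S
  rw [hinv]
  exact (M.adjugate i j).2

/-- The homogeneous space `G/Γ`. -/
abbrev Space {d : ℕ} {S : Finset PrimeNum} (G : Subgroup (GL (Fin d) (QS S))) : Type :=
  G ⧸ arith G

/-- The action of `G` on `G/Γ` by left translation, `g • (hΓ) = (gh)Γ`. -/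
instance spaceAction {d : ℕ} {S : Finset PrimeNum} (G : Subgroup (GL (Fin d) (QS S))) :
    MulAction G (Space G) := MulAction.quotient G (arith G)

/-- The `S`-lattice `g ℤ_S^d` in `ℚ_S^d`. -/
def gLattice {d : ℕ} {S : Finset PrimeNum} (g : GL (Fin d) (QS S)) : Set (Fin d → QS S) :=
  {w | ∃ v : Fin d → QS S, (∀ i, v i ∈ ZS S) ∧ w = g.1 *ᵥ v}

theorem gLattice_mul_subset {d : ℕ} {S : Finset PrimeNum} (g h : GL (Fin d) (QS S))
    (hh : ∀ i j, h.1 i j ∈ ZS S) : gLattice (g * h) ⊆ gLattice g := by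
  rintro _ ⟨v, hv, rfl⟩
  refine ⟨h.1 *ᵥ v, fun i => ?_, ?_⟩
  · rw [Matrix.mulVec, dotProduct]
    exact sum_mem fun l _ => mul_mem (hh i l) (hv l)
  · rw [Matrix.mulVec_mulVec]; rfl

/-- The `S`-lattice `Λ = g ℤ_S^d` that corresponds to the point `gΓ` of `G/Γ`. -/
def lattice {d : ℕ} {S : Finset PrimeNum} {G : Subgroup (GL (Fin d) (QS S))} (x : Space G) :
    Set (Fin d → QS S) :=
  Quotient.liftOn' x (fun g : G => gLattice (g : GL (Fin d) (QS S))) fun a b hab => by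
    have hm : a⁻¹ * b ∈ arith G := QuotientGroup.leftRel_apply.mp hab
    have e1 : (b : GL (Fin d) (QS S)) = a * ((a⁻¹ * b : G) : GL (Fin d) (QS S)) := by simp
    have e2 : (a : GL (Fin d) (QS S)) = b * ((a⁻¹ * b : G) : GL (Fin d) (QS S))⁻¹ := by simp
    apply Set.Subset.antisymm
    · conv_lhs => rw [e2]
      exact gLattice_mul_subset _ _ hm.2
    · conv_lhs => rw [e1]
      exact gLattice_mul_subset _ _ hm.1

/-- The transform `Λ ↦ ∑_{v_1, …, v_k ∈ Λ} f(v_1, …, v_k)` on `G/Γ`. -/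
def siegel {d : ℕ} {S : Finset PrimeNum} {G : Subgroup (GL (Fin d) (QS S))} {k : ℕ}
    (f : (Fin k → Fin d → QS S) → ℝ) (x : Space G) : ℝ :=
  ∑' v : Fin k → lattice x, f fun i => (v i : Fin d → QS S)

/-! ### The index set of the formula -/

/-- `ℕ_S`: the positive integers coprime to every prime in `S_f`. -/
def NS (S : Finset PrimeNum) : Set ℕ := {q | 0 < q ∧ Nat.Coprime q (∏ p ∈ S, (p : ℕ))}

/-- A matrix over the `S`-integers is reduced if some positive integer multiple of it is an
integral matrix whose entries have greatest common divisor `1`. -/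
def IsReduced {S : Finset PrimeNum} {r k : ℕ} (D : Matrix (Fin r) (Fin k) (SInt S)) : Prop :=
  ∃ (t : ℕ) (M : Matrix (Fin r) (Fin k) ℤ), 0 < t ∧ (∀ i j, (t : ℚ) * (D i j : ℚ) = M i j) ∧
    (Finset.univ : Finset (Fin r × Fin k)).gcd (fun ij => M ij.1 ij.2) = 1

/-- The set `𝔇_{r,q}` of reduced `r × k` matrices in echelon form with pivot columns
`q e_1, …, q e_r`. -/
def DSet (S : Finset PrimeNum) (k r q : ℕ) : Set (Matrix (Fin r) (Fin k) (SInt S)) :=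
  {D | IsReduced D ∧ ∃ j : Fin r → Fin k, StrictMono j ∧
    (∀ i l, (D i (j l) : ℚ) = if i = l then (q : ℚ) else 0) ∧
    ∀ i c, c < j i → D i c = 0}

/-- `N(D,q)`: the number of `x ∈ {0, …, q-1}^r` with `(1/q) x D ∈ ℤ_S^k`. -/
def NDq {S : Finset PrimeNum} {r k : ℕ} (D : Matrix (Fin r) (Fin k) (SInt S)) (q : ℕ) : ℕ :=
  Nat.card {x : Fin r → Fin q //
    ∀ c, (1 / (q : ℚ)) * ∑ i, ((x i : ℕ) : ℚ) * (D i c : ℚ) ∈ SInt S}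

/-- `(1/q) (v_1, …, v_r) D ∈ (ℚ_S^d)^k`, where the `v_i` are the columns of a `d × r` matrix. -/
def applyD {d : ℕ} {S : Finset PrimeNum} {r k : ℕ} (D : Matrix (Fin r) (Fin k) (SInt S)) (q : ℕ)
    (v : Fin r → Fin d → QS S) : Fin k → Fin d → QS S :=
  fun c => ∑ i, diagQ S (1 / (q : ℚ) * (D i c : ℚ)) • v i

/-- The term `N(D,q)^d / q^{dr} ∫_{(ℚ_S^d)^r} f((1/q) (v_1, …, v_r) D) dv_1 ⋯ dv_r`. -/
def rogersTerm {d : ℕ} {S : Finset PrimeNum} {r k : ℕ} (f : (Fin k → Fin d → QS S) → ℝ)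
    (q : ℕ) (D : Matrix (Fin r) (Fin k) (SInt S)) : ℝ :=
  (NDq D q : ℝ) ^ d / (q : ℝ) ^ (d * r) * ∫ v, f (applyD D q v) ∂(muVec S d r)

end SArith

end

/-!
The `k`-th moment is computed by sorting the tuples of lattice vectors by their rank and by their
linear relations, and by showing that each family is equidistributed with an explicit density.

*Decomposition.* A tuple `X` of `k` vectors of rank `r` has an echelon form: the vectors that are
not in the span of their predecessors are the columns of some `Y`, and all other vectors are
rational combinations of them. Clearing denominators in the coordinates gives `X = (1/q) Y D` for
a unique triple of `q ∈ ℕ_S`, `D ∈ 𝔇_{r,q}` and a tuple `Y` of independent vectors for which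
`(1/q) Y D` is integral (`bijective_combine`). The factor of the denominator that consists of
primes in `S_f` is a unit of `ℤ_S`; this is where reducedness of `D` replaces integrality.

*Invariance.* Let `𝒴` be a set of integral `r`-tuples of full rank that is stable under
`SL_d(ℤ_S)`. Then `A ↦ ∫ #{Y ∈ 𝒴 : g Y ∈ A} dg` is an `SL_d(ℚ_S)`-invariant measure on
`(ℚ_S^d)^r` (`tupleMeasure`). For `r < d`, such a measure is a multiple of Haar measure as soon as
it is finite on some nonempty open set (`exists_eq_smul_muVec`). To see this, note that almost all
tuples have invertible `r × r` minors. A shear adds to one row a combination of `r` other rows, and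
the coefficients that produce a given translation of the row depend on the tuple; adding the
coefficients as a variable with Haar measure, the translation becomes a commutator of two measure
preserving maps. Hence the measure is invariant under translations.

*Finiteness.* For primitive tuples, which consist of the first `r` columns of matrices in
`SL_d(ℤ_S)`, this is shown by downward induction on `r`: a primitive tuple close to the standard
one extends by a vector of bounded length to a longer primitive tuple (`exists_completion`), and
the number of bases of a unimodular lattice in a bounded set is bounded (`exists_encard_bases_le`).
The short vector is supplied by reduction theory for `SL_n(ℤ_S)` (`exists_isSiegel`). So the
measures counting primitive tuples are multiples of Haar measure
(`exists_tupleMeasure_primitiveTuples`). The number of lattice vectors in a box is at most a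
constant times the product of the inverse lengths of the short vectors of a reduced basis; these
vectors form a primitive tuple of fewer than `d` vectors. Since `|x|^{-k}` is integrable near the
origin of `ℝ^d` for `k < d`, the number of lattice vectors in a box has a finite `k`-th moment
(`lintegral_latticeCount_pow_ne_top`), and this yields both the finiteness for the tuples `Y` above
and the integrability of the transform.

*The constant.* For a fixed lattice the number of tuples `Y` in the dilates of a region is
asymptotic to the volume times the density of the sublattice, which is `(N(D,q) / q^r)^d`. After
division by the volume these numbers are dominated by the `r`-th power of the number of lattice
vectors in a box, so the limit may be taken under the integral over `G/Γ`
(`tupleMeasure_independentTuples`). Summation over all ranks, with `X = 0` for `r = 0` and all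
independent tuples for `r = k`, gives the formula for nonnegative measurable functions
(`lintegral_orbitSum_univ`).
-/

namespace SArith

variable {S : Finset PrimeNum}

/-! ### `S`-integers inside `ℚ_S` -/

/-- The embedding of the ring `ℤ_S` of `S`-integers, viewed inside `ℚ`, into `ℚ_S`. -/
noncomputable def toQS (S : Finset PrimeNum) : SInt S →+* QS S := (diagQ S).comp (SInt S).subtype

/-- The open subring `ℝ × ∏_{p ∈ S_f} ℤ_p` of `ℚ_S`. -/
def OS (S : Finset PrimeNum) : Subring (QS S) where
  carrier := {x | ∀ p : S, ‖x.2 p‖ ≤ 1}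
  mul_mem' {a b} ha hb p := by
    change ‖a.2 p * b.2 p‖ ≤ 1
    rw [norm_mul]
    exact mul_le_one₀ (ha p) (norm_nonneg _) (hb p)
  one_mem' p := by
    change ‖(1 : ℚ_[p.1.1])‖ ≤ 1
    simp
  add_mem' {a b} ha hb p :=
    (Padic.nonarchimedean (a.2 p) (b.2 p)).trans (max_le (ha p) (hb p))
  zero_mem' p := by
    change ‖(0 : ℚ_[p.1.1])‖ ≤ 1
    simp
  neg_mem' {a} ha p := by
    change ‖-(a.2 p)‖ ≤ 1
    rw [norm_neg]
    exact ha p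

theorem mem_OS {x : QS S} : x ∈ OS S ↔ ∀ p : S, ‖x.2 p‖ ≤ 1 := Iff.rfl

@[simp] theorem diagQ_fst (z : ℚ) : (diagQ S z).1 = z := rfl

@[simp] theorem diagQ_snd (z : ℚ) (p : S) : (diagQ S z).2 p = (z : ℚ_[p.1.1]) := rfl

@[simp] theorem toQS_fst (z : SInt S) : (toQS S z).1 = (z : ℚ) := rfl

@[simp] theorem toQS_snd (z : SInt S) (p : S) : (toQS S z).2 p = ((z : ℚ) : ℚ_[p.1.1]) := rfl

theorem toQS_eq (z : SInt S) : toQS S z = diagQ S (z : ℚ) := rfl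

theorem diagQ_injective : Function.Injective (diagQ S) := fun _ _ h => by
  have h1 := congrArg Prod.fst h
  simpa using h1

theorem toQS_injective : Function.Injective (toQS S) := fun _ _ h =>
  Subtype.ext (diagQ_injective h)

theorem toQS_mem_ZS (z : SInt S) : toQS S z ∈ ZS S := ⟨z, z.2, rfl⟩

theorem mem_ZS_iff {x : QS S} : x ∈ ZS S ↔ ∃ z : SInt S, toQS S z = x :=
  ⟨fun ⟨z, hz, h⟩ => ⟨⟨z, hz⟩, h⟩, fun ⟨z, h⟩ => h ▸ toQS_mem_ZS z⟩

theorem exists_int_of_padicNorm_le_one {z : ℚ} (h : ∀ p : PrimeNum, padicNorm p z ≤ 1) :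
    ∃ n : ℤ, z = n := by
  have hden : z.den = 1 := by
    by_contra hne
    obtain ⟨p, hp, hpd⟩ := Nat.exists_prime_and_dvd hne
    have : Fact p.Prime := ⟨hp⟩
    have h1 : ‖(z : ℚ_[p])‖ ≤ 1 := by
      rw [Padic.eq_padicNorm]
      exact_mod_cast h ⟨p, hp⟩
    have h2 := PadicInt.isUnit_den z h1
    rw [PadicInt.isUnit_iff] at h2
    have h3 : ‖((z.den : ℤ) : ℤ_[p])‖ < 1 :=
      (PadicInt.norm_int_lt_one_iff_dvd _).2 (by exact_mod_cast hpd)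
    rw [Int.cast_natCast] at h3
    exact h3.ne h2
  exact ⟨z.num, (Rat.coe_int_num_of_den_eq_one hden).symm⟩

/-- An `S`-integer that is integral at the places of `S_f` is an integer. -/
theorem exists_int_of_mem_OS {z : SInt S} (h : toQS S z ∈ OS S) : ∃ n : ℤ, z = n := by
  obtain ⟨n, hn⟩ := exists_int_of_padicNorm_le_one (z := z) fun p => by
    by_cases hp : p ∈ S
    · have h1 := h ⟨p, hp⟩
      rw [toQS_snd, Padic.eq_padicNorm] at h1
      exact_mod_cast h1
    · exact z.2 p hp
  exact ⟨n, Subtype.ext (by rw [hn]; simp)⟩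

theorem int_mem_OS (n : ℤ) : ((n : ℤ) : QS S) ∈ OS S := intCast_mem _ n

theorem prod_primes_pos (S : Finset PrimeNum) : 0 < ∏ p ∈ S, (p : ℕ) :=
  Finset.prod_pos fun p _ => p.2.pos

theorem padicNorm_natCast_eq_one_of_not_dvd {p : PrimeNum} {n : ℕ} (h : ¬ (p : ℕ) ∣ n) :
    padicNorm p (n : ℚ) = 1 := by
  have := (padicNorm.nat_eq_one_iff (p := p) n).2 h
  exact_mod_cast this

theorem not_dvd_prod_primes {p : PrimeNum} (hp : p ∉ S) : ¬ (p : ℕ) ∣ ∏ q ∈ S, (q : ℕ) := by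
  intro h
  obtain ⟨q, hq, hd⟩ := (Prime.dvd_finsetProd_iff p.2.prime _).1 h
  exact hp (by rwa [Subtype.ext ((Nat.prime_dvd_prime_iff_eq p.2 q.2).1 hd)])

theorem prod_primes_inv_mem (S : Finset PrimeNum) : ((∏ p ∈ S, (p : ℕ) : ℕ) : ℚ)⁻¹ ∈ SInt S := by
  intro p hp
  rw [← one_div, padicNorm.div, padicNorm_natCast_eq_one_of_not_dvd (not_dvd_prod_primes hp)]
  simp

/-- The product of the primes in `S_f`, as a unit of `ℤ_S`. -/
noncomputable def primesUnit (S : Finset PrimeNum) : (SInt S)ˣ where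
  val := ((∏ p ∈ S, (p : ℕ) : ℕ) : SInt S)
  inv := ⟨_, prod_primes_inv_mem S⟩
  val_inv := Subtype.ext (by
    have := (prod_primes_pos S).ne'
    push_cast
    exact mul_inv_cancel₀ (by exact_mod_cast this))
  inv_val := Subtype.ext (by
    have := (prod_primes_pos S).ne'
    push_cast
    exact inv_mul_cancel₀ (by exact_mod_cast this))

theorem norm_primesUnit_lt_one (p : S) : ‖(toQS S (primesUnit S)).2 p‖ < 1 := by
  rw [toQS_snd]
  have : (((primesUnit S : (SInt S)ˣ) : SInt S) : ℚ) = ((∏ p ∈ S, (p : ℕ) : ℕ) : ℤ) := by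
    simp [primesUnit]
  rw [this, Rat.cast_intCast]
  exact (Padic.norm_intCast_lt_one_iff).2 (by exact_mod_cast Finset.dvd_prod_of_mem _ p.2)

theorem eventually_pow_mul_mem_OS (x : QS S) :
    ∀ᶠ m : ℕ in Filter.atTop, toQS S ((primesUnit S : SInt S) ^ m) * x ∈ OS S := by
  simp only [mem_OS, Filter.eventually_all]
  intro p
  have h1 := (tendsto_pow_atTop_nhds_zero_of_lt_one (norm_nonneg _)
    (norm_primesUnit_lt_one p)).mul_const ‖x.2 p‖
  rw [zero_mul] at h1
  filter_upwards [h1.eventually (ge_mem_nhds one_pos)] with m hm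
  rw [map_pow]
  change ‖(toQS S (primesUnit S)).2 p ^ m * x.2 p‖ ≤ 1
  rwa [norm_mul, norm_pow]

/-- Up to `ℤ_p`, a `p`-adic number is a rational number with a power of `p` as denominator; such a
number is integral at all other finite places. -/
theorem exists_padic_frac (p : S) (x : ℚ_[p.1.1]) :
    ∃ z : SInt S, ‖x - ((z : ℚ) : ℚ_[p.1.1])‖ ≤ 1 ∧
      ∀ q : S, q ≠ p → ‖((z : ℚ) : ℚ_[q.1.1])‖ ≤ 1 := by
  have hp0 : ((p.1.1 : ℕ) : ℚ) ≠ 0 := by exact_mod_cast p.1.2.ne_zero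
  have hp0' : ((p.1.1 : ℕ) : ℚ_[p.1.1]) ≠ 0 := by exact_mod_cast p.1.2.ne_zero
  obtain ⟨m, hm⟩ : ∃ m : ℕ, ‖((p.1.1 : ℕ) : ℚ_[p.1.1]) ^ m * x‖ ≤ 1 := by
    have h1 := (tendsto_pow_atTop_nhds_zero_of_lt_one (norm_nonneg _)
      (Padic.norm_p_lt_one (p := p.1.1))).mul_const ‖x‖
    rw [zero_mul] at h1
    obtain ⟨m, hm⟩ := (h1.eventually (ge_mem_nhds one_pos)).exists
    exact ⟨m, by rwa [norm_mul, norm_pow]⟩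
  let y : ℤ_[p.1.1] := ⟨_, hm⟩
  let n := y.appr m
  have hn := PadicInt.appr_spec m y
  rw [← PadicInt.norm_le_pow_iff_mem_span_pow] at hn
  have key : ∀ q : PrimeNum, q ≠ p.1 → padicNorm q ((n : ℚ) / (p.1.1 : ℚ) ^ m) ≤ 1 := by
    intro q hq
    rw [padicNorm.div, ← Nat.cast_pow, padicNorm_natCast_eq_one_of_not_dvd (n := p.1.1 ^ m)
      (fun h => hq (Subtype.ext ((Nat.prime_dvd_prime_iff_eq q.2 p.1.2).1
        (q.2.dvd_of_dvd_pow h)))), div_one]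
    exact padicNorm.of_nat n
  refine ⟨⟨(n : ℚ) / (p.1.1 : ℚ) ^ m, fun q hq => key q fun h => hq (h ▸ p.2)⟩, ?_, fun q hq => ?_⟩
  · have h2 : x - (((n : ℚ) / (p.1.1 : ℚ) ^ m : ℚ) : ℚ_[p.1.1]) =
        ((y - (n : ℤ_[p.1.1]) : ℤ_[p.1.1]) : ℚ_[p.1.1]) / (p.1.1 : ℚ_[p.1.1]) ^ m := by
      push_cast
      field_simp
      rw [mul_comm]
    rw [h2, norm_div, div_le_one (norm_pos_iff.2 (pow_ne_zero _ hp0')), PadicInt.padic_norm_e_of_padicInt]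
    refine hn.trans (le_of_eq ?_)
    rw [norm_pow, Padic.norm_p, _root_.zpow_neg, zpow_natCast, inv_pow]
  · rw [Padic.eq_padicNorm]
    exact_mod_cast key q.1 fun h => hq (Subtype.ext h)

/-- Strong approximation for the additive group: `[-1/2, 1/2] × ∏ ℤ_p` meets every coset of
`ℤ_S` in `ℚ_S`. -/
theorem exists_sub_toQS_mem (x : QS S) :
    ∃ z : SInt S, |(x - toQS S z).1| ≤ 1 / 2 ∧ x - toQS S z ∈ OS S := by
  choose w hw1 hw2 using fun p : S => exists_padic_frac p (x.2 p)
  set z := ∑ p, w p with hz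
  have hzO : x - toQS S z ∈ OS S := by
    intro p
    have h3 : (x - toQS S z).2 p = (x.2 p - ((w p : ℚ) : ℚ_[p.1.1])) -
        ∑ q ∈ Finset.univ.erase p, ((w q : ℚ) : ℚ_[p.1.1]) := by
      change x.2 p - ((z : ℚ) : ℚ_[p.1.1]) = _
      rw [hz, ← Finset.add_sum_erase _ _ (Finset.mem_univ p)]
      push_cast
      ring
    have hmem : (x.2 p - ((w p : ℚ) : ℚ_[p.1.1])) -
        ∑ q ∈ Finset.univ.erase p, ((w q : ℚ) : ℚ_[p.1.1]) ∈ PadicInt.subring p.1.1 :=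
      sub_mem (hw1 p) (sum_mem fun q hq => hw2 q p (Finset.ne_of_mem_erase hq).symm)
    rw [h3]
    exact hmem
  refine ⟨z + (round (x - toQS S z).1 : ℤ), ?_, ?_⟩
  · have : (x - toQS S (z + (round (x - toQS S z).1 : ℤ))).1 =
        (x - toQS S z).1 - round (x - toQS S z).1 := by
      rw [map_add, map_intCast, ← sub_sub]; rfl
    rw [this]
    exact abs_sub_round _
  · rw [map_add, map_intCast, ← sub_sub]
    exact sub_mem hzO (int_mem_OS _)

/-! ### Reduction theory -/

/-- The projection of `ℚ_S` to the real place. -/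
noncomputable abbrev atReal (S : Finset PrimeNum) : QS S →+* ℝ := RingHom.fst _ _

/-- The projection of `ℚ_S` to the place `p ∈ S_f`. -/
noncomputable abbrev atPadic (p : S) : QS S →+* ℚ_[p.1.1] := (Pi.evalRingHom _ p).comp (RingHom.snd _ _)

/-- The square of the Euclidean norm of the real component of a vector over `ℚ_S`. -/
noncomputable def realNormSq {n : ℕ} (x : Fin n → QS S) : ℝ := ∑ i, (x i).1 ^ 2

/-- A matrix over `ℚ_S` that is orthogonal at the real place and lies in `GL_n(ℤ_p)` at every
finite place: it preserves the standard norm at each place. -/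
structure IsPlaceIsometry {n : ℕ} (k : Matrix (Fin n) (Fin n) (QS S)) : Prop where
  orthogonal : (k.map (atReal S))ᵀ * k.map (atReal S) = 1
  mem_OS : ∀ i j, k i j ∈ OS S
  norm_det : ∀ p : S, ‖(k.det).2 p‖ = 1

theorem det_fst {n : ℕ} (A : Matrix (Fin n) (Fin n) (QS S)) :
    (A.det).1 = (A.map (atReal S)).det := RingHom.map_det (atReal S) A

theorem det_snd {n : ℕ} (A : Matrix (Fin n) (Fin n) (QS S)) (p : S) :
    (A.det).2 p = (A.map (atPadic p)).det := RingHom.map_det (atPadic p) A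

theorem det_toQS {n : ℕ} (γ : Matrix (Fin n) (Fin n) (SInt S)) :
    (γ.map (toQS S)).det = toQS S γ.det := (RingHom.map_det (toQS S) γ).symm

theorem mulVec_mem_OS {m n : ℕ} {A : Matrix (Fin m) (Fin n) (QS S)} (hA : ∀ i j, A i j ∈ OS S)
    {x : Fin n → QS S} (hx : ∀ i, x i ∈ OS S) (i : Fin m) : (A *ᵥ x) i ∈ OS S :=
  sum_mem fun j _ => mul_mem (hA i j) (hx j)

theorem det_mem_OS {n : ℕ} {A : Matrix (Fin n) (Fin n) (QS S)} (hA : ∀ i j, A i j ∈ OS S) :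
    A.det ∈ OS S := by
  rw [Matrix.det_apply']
  exact sum_mem fun σ _ => mul_mem (intCast_mem _ _) (prod_mem fun i _ => hA _ _)

theorem adjugate_mem_OS {n : ℕ} {A : Matrix (Fin n) (Fin n) (QS S)} (hA : ∀ i j, A i j ∈ OS S)
    (i j : Fin n) : A.adjugate i j ∈ OS S := by
  rw [Matrix.adjugate_apply]
  refine det_mem_OS fun a b => ?_
  rw [Matrix.updateRow_apply]
  split_ifs
  · rw [Pi.single_apply]
    split_ifs
    exacts [one_mem _, zero_mem _]
  · exact hA _ _

theorem mem_OS_of_mul_mem {a x : QS S} (ha : ∀ p, ‖a.2 p‖ = 1) (h : a * x ∈ OS S) : x ∈ OS S := by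
  intro p
  have h1 : ‖a.2 p * x.2 p‖ ≤ 1 := h p
  rwa [norm_mul, ha p, one_mul] at h1

/-- A matrix in `GL_n(ℤ_p)` at every finite place detects integrality of vectors. -/
theorem mem_OS_of_mulVec_mem {n : ℕ} {A : Matrix (Fin n) (Fin n) (QS S)}
    (hA : ∀ i j, A i j ∈ OS S) (hd : ∀ p, ‖(A.det).2 p‖ = 1) {x : Fin n → QS S}
    (hx : ∀ i, (A *ᵥ x) i ∈ OS S) (i : Fin n) : x i ∈ OS S := by
  refine mem_OS_of_mul_mem hd ?_
  have h := mulVec_mem_OS (adjugate_mem_OS hA) hx i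
  rwa [Matrix.mulVec_mulVec, Matrix.adjugate_mul, Matrix.smul_mulVec, Matrix.one_mulVec] at h

namespace IsPlaceIsometry

variable {n : ℕ} {k l : Matrix (Fin n) (Fin n) (QS S)}

theorem one : IsPlaceIsometry (1 : Matrix (Fin n) (Fin n) (QS S)) where
  orthogonal := by simp
  mem_OS i j := by
    rw [Matrix.one_apply]
    split_ifs
    exacts [one_mem _, zero_mem _]
  norm_det p := by simp

theorem mul (hk : IsPlaceIsometry k) (hl : IsPlaceIsometry l) : IsPlaceIsometry (k * l) where
  orthogonal := by
    rw [Matrix.map_mul, Matrix.transpose_mul, Matrix.mul_assoc, ← Matrix.mul_assoc _ (k.map _),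
      hk.orthogonal, Matrix.one_mul, hl.orthogonal]
  mem_OS i j := sum_mem fun a _ => mul_mem (hk.mem_OS i a) (hl.mem_OS a j)
  norm_det p := by simp [Matrix.det_mul, hk.norm_det p, hl.norm_det p]

theorem abs_det (hk : IsPlaceIsometry k) : |(k.det).1| = 1 := by
  have h := congrArg Matrix.det hk.orthogonal
  rw [Matrix.det_mul, Matrix.det_transpose, Matrix.det_one, ← det_fst] at h
  rcases mul_self_eq_one_iff.1 h with h | h <;> simp [h]

theorem realNormSq_mulVec (hk : IsPlaceIsometry k) (x : Fin n → QS S) :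
    realNormSq (k *ᵥ x) = realNormSq x := by
  have h1 : ∀ y : Fin n → QS S, realNormSq y = (fun i => (y i).1) ⬝ᵥ fun i => (y i).1 := by
    intro y
    simp [realNormSq, dotProduct, sq]
  have h2 : (fun i => ((k *ᵥ x) i).1) = k.map (atReal S) *ᵥ fun i => (x i).1 := by
    ext i
    exact map_sum (atReal S) _ _
  rw [h1, h1, h2, Matrix.dotProduct_mulVec, Matrix.vecMul_mulVec, hk.orthogonal, Matrix.vecMul_one]

theorem mulVec_mem_iff (hk : IsPlaceIsometry k) {x : Fin n → QS S} :
    (∀ i, (k *ᵥ x) i ∈ OS S) ↔ ∀ i, x i ∈ OS S :=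
  ⟨mem_OS_of_mulVec_mem hk.mem_OS hk.norm_det, mulVec_mem_OS hk.mem_OS⟩

end IsPlaceIsometry

/-- The Householder reflection that moves a nonzero real vector to the first coordinate axis. -/
theorem exists_orthogonal_mulVec_eq {n : ℕ} {u : Fin (n + 1) → ℝ} (hu : u ≠ 0) :
    ∃ (k : Matrix (Fin (n + 1)) (Fin (n + 1)) ℝ) (a : ℝ), kᵀ * k = 1 ∧ 0 < a ∧
      k *ᵥ u = Pi.single 0 a := by
  have huu : 0 < u ⬝ᵥ u := by
    refine lt_of_le_of_ne (Finset.sum_nonneg fun i _ => mul_self_nonneg _) fun h => hu ?_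
    exact dotProduct_self_eq_zero.1 h.symm
  set a := √(u ⬝ᵥ u) with ha
  have ha2 : a * a = u ⬝ᵥ u := Real.mul_self_sqrt huu.le
  have ha0 : 0 < a := Real.sqrt_pos.2 huu
  set w := u - Pi.single 0 a with hw
  by_cases hw0 : w = 0
  · exact ⟨1, a, by simp, ha0, by rw [one_mulVec]; exact sub_eq_zero.1 hw0⟩
  have hww : w ⬝ᵥ w ≠ 0 := fun h => hw0 (dotProduct_self_eq_zero.1 h)
  have h1 : w ⬝ᵥ w = 2 * (w ⬝ᵥ u) := by
    simp only [hw, sub_dotProduct, dotProduct_sub, dotProduct_single, single_dotProduct,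
      Pi.sub_apply, Pi.single_eq_same]
    linarith [mul_comm a (u 0)]
  refine ⟨1 - (2 / (w ⬝ᵥ w)) • vecMulVec w w, a, ?_, ha0, ?_⟩
  · have hT : (1 - (2 / (w ⬝ᵥ w)) • vecMulVec w w)ᵀ = 1 - (2 / (w ⬝ᵥ w)) • vecMulVec w w := by
      simp [Matrix.transpose_sub, Matrix.transpose_vecMulVec]
    have hsq : vecMulVec w w * vecMulVec w w = (w ⬝ᵥ w) • vecMulVec w w := by
      ext i j
      simp only [Matrix.mul_apply, vecMulVec_apply, Matrix.smul_apply, smul_eq_mul, dotProduct,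
        Finset.sum_mul]
      exact Finset.sum_congr rfl fun l _ => by ring
    rw [hT, sub_mul, mul_sub, mul_sub, one_mul, one_mul, mul_one, smul_mul_smul_comm, hsq, smul_smul]
    have : 2 / (w ⬝ᵥ w) * (2 / (w ⬝ᵥ w)) * (w ⬝ᵥ w) = 2 / (w ⬝ᵥ w) + 2 / (w ⬝ᵥ w) := by
      field_simp; ring
    rw [this, add_smul]
    abel
  · rw [sub_mulVec, one_mulVec, smul_mulVec, vecMulVec_mulVec]
    have : (2 / (w ⬝ᵥ w)) * (w ⬝ᵥ u) = 1 := by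
      have hwu : w ⬝ᵥ u ≠ 0 := fun h => hww (by rw [h1, h, mul_zero])
      rw [h1, div_mul_eq_mul_div, div_self (mul_ne_zero two_ne_zero hwu)]
    ext i
    have h3 : (u - (2 / w ⬝ᵥ w) • MulOpposite.op (w ⬝ᵥ u) • w) i
        = u i - ((2 / (w ⬝ᵥ w)) * (w ⬝ᵥ u)) * w i := by
      simp only [Pi.sub_apply, Pi.smul_apply, smul_eq_mul, MulOpposite.smul_eq_mul_unop,
        MulOpposite.unop_op]
      ring
    rw [h3, this, hw]
    simp

/-- `GL_n(ℤ_p)` moves a primitive vector to the first coordinate axis: clear the other entries by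
means of the entry of norm one, then swap it to the first place. -/
theorem exists_integral_mulVec_eq {p : ℕ} [Fact p.Prime] {n : ℕ} {u : Fin (n + 1) → ℚ_[p]}
    (hu : ∀ i, ‖u i‖ ≤ 1) {j : Fin (n + 1)} (hj : ‖u j‖ = 1) :
    ∃ (k : Matrix (Fin (n + 1)) (Fin (n + 1)) ℚ_[p]) (a : ℚ_[p]), (∀ i l, ‖k i l‖ ≤ 1) ∧
      ‖k.det‖ = 1 ∧ ‖a‖ = 1 ∧ k *ᵥ u = Pi.single 0 a := by
  have hj0 : u j ≠ 0 := fun h => by simp [h] at hj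
  set w : Fin (n + 1) → ℚ_[p] := fun i => if i = j then 0 else u i / u j with hw
  refine ⟨(1 - vecMulVec w (Pi.single j 1)).submatrix (Equiv.swap 0 j) id, u j, ?_, ?_, hj, ?_⟩
  · intro i l
    have h1 : ∀ i l, ‖(vecMulVec w (Pi.single j 1) : Matrix _ _ ℚ_[p]) i l‖ ≤ 1 := by
      intro i l
      rw [vecMulVec_apply, norm_mul]
      refine mul_le_one₀ ?_ (norm_nonneg _) ?_
      · simp only [hw]
        split_ifs
        · simp
        · rw [norm_div, hj, div_one]
          exact hu i
      · rw [Pi.single_apply]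
        split_ifs <;> simp
    have h2 : ∀ i l, ‖(1 : Matrix (Fin (n + 1)) (Fin (n + 1)) ℚ_[p]) i l‖ ≤ 1 := by
      intro i l
      rw [Matrix.one_apply]
      split_ifs <;> simp
    rw [submatrix_apply, Matrix.sub_apply, sub_eq_add_neg]
    exact (Padic.nonarchimedean _ _).trans (max_le (h2 _ _) (by rw [norm_neg]; exact h1 _ _))
  · rw [Matrix.det_permute]
    have h1 : (1 - vecMulVec w (Pi.single j 1) : Matrix _ _ ℚ_[p]).det = 1 := by
      rw [sub_eq_add_neg, ← neg_vecMulVec, vecMulVec_eq Unit,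
        det_one_add_replicateCol_mul_replicateRow]
      simp [hw]
    rw [h1, mul_one]
    rcases Int.units_eq_one_or (Equiv.Perm.sign (Equiv.swap 0 j)) with h | h <;> simp [h]
  · have h1 : (1 - vecMulVec w (Pi.single j 1) : Matrix _ _ ℚ_[p]) *ᵥ u = Pi.single j (u j) := by
      rw [sub_mulVec, one_mulVec, vecMulVec_mulVec]
      ext i
      by_cases hij : i = j
      · subst hij
        simp [hw]
      · simp [hw, hij, mul_div_cancel₀ (u i) hj0]
    ext i
    have h2 : ((1 - vecMulVec w (Pi.single j 1) : Matrix _ _ ℚ_[p]).submatrix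
        (Equiv.swap 0 j) id *ᵥ u) i =
        ((1 - vecMulVec w (Pi.single j 1) : Matrix _ _ ℚ_[p]) *ᵥ u) (Equiv.swap 0 j i) := rfl
    rw [h2, h1]
    by_cases hi : i = 0
    · subst hi
      simp
    · rw [Pi.single_eq_of_ne hi, Pi.single_eq_of_ne]
      rwa [Ne, Equiv.swap_apply_eq_iff, Equiv.swap_apply_right]

/-- The combination of the Householder reflection with the `p`-adic column operations. -/
theorem exists_isPlaceIsometry_mulVec_eq {n : ℕ} {u : Fin (n + 1) → QS S}
    (hr : realNormSq u ≠ 0) (hO : ∀ i, u i ∈ OS S) (hp : ∀ p : S, ∃ j, ‖(u j).2 p‖ = 1) :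
    ∃ (k : Matrix (Fin (n + 1)) (Fin (n + 1)) (QS S)) (a : QS S), IsPlaceIsometry k ∧
      0 < a.1 ∧ (∀ p, ‖a.2 p‖ = 1) ∧ k *ᵥ u = Pi.single 0 a := by
  have hu : (fun i => (u i).1) ≠ 0 := by
    intro h
    refine hr (Finset.sum_eq_zero fun i _ => ?_)
    have : (u i).1 = 0 := congrFun h i
    rw [this, sq, zero_mul]
  obtain ⟨k₀, a₀, hk₀, ha₀, hu₀⟩ := exists_orthogonal_mulVec_eq hu
  choose j hj using hp
  choose k a hk hd ha hku using fun p : S =>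
    exists_integral_mulVec_eq (u := fun i => (u i).2 p) (fun i => hO i p) (hj p)
  let K : Matrix (Fin (n + 1)) (Fin (n + 1)) (QS S) := fun i l => (k₀ i l, fun p => k p i l)
  refine ⟨K, (a₀, a), ⟨hk₀, fun i l p => hk p i l, fun p => ?_⟩, ha₀, ha, ?_⟩
  · rw [det_snd]
    exact hd p
  · ext i
    · have h1 : ((K *ᵥ u) i).1 = (k₀ *ᵥ fun i => (u i).1) i := map_sum (atReal S) _ _
      rw [h1, hu₀]
      by_cases hi : i = 0
      · subst hi; simp
      · simp [hi]
    · rename_i p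
      have h1 : ((K *ᵥ u) i).2 p = (k p *ᵥ fun i => (u i).2 p) i := map_sum (atPadic p) _ _
      rw [h1, hku]
      by_cases hi : i = 0
      · subst hi; simp
      · simp [hi]

/-- The block matrix `diag(1, B)`. -/
def liftBlock {R : Type*} [Zero R] [One R] {n : ℕ} (B : Matrix (Fin n) (Fin n) R) :
    Matrix (Fin (n + 1)) (Fin (n + 1)) R :=
  Matrix.of (Fin.cons (Fin.cons 1 fun _ => 0) fun i => Fin.cons 0 (B i))

section LiftBlock

variable {R : Type*} [CommRing R] {n : ℕ} (B : Matrix (Fin n) (Fin n) R)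

@[simp] theorem liftBlock_zero_zero : liftBlock B 0 0 = 1 := rfl
@[simp] theorem liftBlock_zero_succ (j : Fin n) : liftBlock B 0 j.succ = 0 := rfl
@[simp] theorem liftBlock_succ_zero (i : Fin n) : liftBlock B i.succ 0 = 0 := rfl
@[simp] theorem liftBlock_succ_succ (i j : Fin n) : liftBlock B i.succ j.succ = B i j := rfl

theorem det_liftBlock : (liftBlock B).det = B.det := by
  rw [Matrix.det_succ_row_zero, Fin.sum_univ_succ]
  simp only [liftBlock_zero_zero, liftBlock_zero_succ]
  simp
  rfl

theorem liftBlock_map {R' : Type*} [CommRing R'] (f : R →+* R') :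
    (liftBlock B).map f = liftBlock (B.map f) := by
  ext i j
  refine Fin.cases ?_ (fun i => ?_) i <;> refine Fin.cases ?_ (fun j => ?_) j <;> simp

theorem liftBlock_transpose_mul (C : Matrix (Fin n) (Fin n) R) (h : Cᵀ * C = 1) :
    (liftBlock C)ᵀ * liftBlock C = 1 := by
  have h' : ∀ i j, ∑ l, C l i * C l j = if i = j then 1 else 0 := fun i j => by
    have := congrFun (congrFun h i) j
    rwa [Matrix.one_apply] at this
  ext i j
  refine Fin.cases ?_ (fun i => ?_) i <;> refine Fin.cases ?_ (fun j => ?_) j <;>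
    simp [Matrix.mul_apply, Fin.sum_univ_succ, Matrix.one_apply, h', (Fin.succ_ne_zero _).symm]

end LiftBlock

theorem IsPlaceIsometry.liftBlock {n : ℕ} {k : Matrix (Fin n) (Fin n) (QS S)}
    (hk : IsPlaceIsometry k) : IsPlaceIsometry (liftBlock k) where
  orthogonal := by
    rw [liftBlock_map]
    exact liftBlock_transpose_mul _ hk.orthogonal
  mem_OS i j := by
    refine Fin.cases ?_ (fun i => ?_) i <;> refine Fin.cases ?_ (fun j => ?_) j
    exacts [one_mem _, zero_mem _, zero_mem _, hk.mem_OS i j]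
  norm_det p := by rw [det_liftBlock]; exact hk.norm_det p

/-- The Siegel condition for an upper triangular matrix over `ℚ_S`: it is integral with unit diagonal
at the finite places; at the real place the diagonal is positive, it dominates the entries of its
row, and no entry of it exceeds a later one by more than the factor `2^n`. The columns are then a reduced basis. -/
structure IsSiegel {n : ℕ} (T : Matrix (Fin n) (Fin n) (QS S)) : Prop where
  lower : ∀ i j, j < i → T i j = 0
  pos : ∀ i, 0 < (T i i).1
  norm_diag : ∀ i p, ‖(T i i).2 p‖ = 1
  abs_le : ∀ i j, |(T i j).1| ≤ (T i i).1
  mem_OS : ∀ i j, T i j ∈ OS S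
  diag_le : ∀ i j, i ≤ j → (T i i).1 ≤ 2 ^ n * (T j j).1

/-- Only finitely many vectors over `ℤ_S` are bounded at the real place and integral at the places of
`S_f`, since such vectors have integer entries. -/
theorem finite_setOf_int_bounded (n : ℕ) (C : ℝ) :
    {z : Fin n → SInt S | ∀ i, |(toQS S (z i)).1| ≤ C ∧ toQS S (z i) ∈ OS S}.Finite := by
  have h : (Set.pi Set.univ fun _ : Fin n => ((fun m : ℤ => (m : SInt S)) ''
      Set.Icc (-⌊C⌋) ⌊C⌋)).Finite := Set.Finite.pi fun _ => (Set.finite_Icc _ _).image _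
  refine h.subset fun z hz i _ => ?_
  obtain ⟨m, hm⟩ := exists_int_of_mem_OS (hz i).2
  refine ⟨m, ?_, hm.symm⟩
  have h1 := (hz i).1
  have h2 : (toQS S (z i)).1 = m := by rw [hm, map_intCast]; rfl
  rw [h2, abs_le] at h1
  exact ⟨by have := Int.le_floor.2 (show ((-m : ℤ) : ℝ) ≤ C by push_cast; linarith); linarith,
    Int.le_floor.2 h1.2⟩

theorem abs_le_of_realNormSq_le {n : ℕ} {x : Fin n → QS S} {R : ℝ} (hR : 0 ≤ R)
    (h : realNormSq x ≤ R ^ 2) (i : Fin n) : |(x i).1| ≤ R := by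
  refine abs_le_of_sq_le_sq ?_ hR
  exact (Finset.single_le_sum (f := fun i => (x i).1 ^ 2) (fun i _ => sq_nonneg _)
    (Finset.mem_univ i)).trans h

theorem abs_mulVec_fst_le {m n : ℕ} {A : Matrix (Fin m) (Fin n) (QS S)} {x : Fin n → QS S}
    {B C : ℝ} (hA : ∀ i j, |(A i j).1| ≤ B) (hx : ∀ j, |(x j).1| ≤ C) (i : Fin m) :
    |((A *ᵥ x) i).1| ≤ n * (B * C) := by
  have h1 : ((A *ᵥ x) i).1 = ∑ j, (A i j).1 * (x j).1 := map_sum (atReal S) _ _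
  rw [h1]
  refine (Finset.abs_sum_le_sum_abs _ _).trans ((Finset.sum_le_card_nsmul _ _ (B * C) fun j _ => ?_).trans
    (le_of_eq (by simp)))
  rw [abs_mul]
  exact mul_le_mul (hA i j) (hx j) (abs_nonneg _) ((abs_nonneg _).trans (hA i j))

theorem exists_forall_abs_fst_le {m n : ℕ} (A : Matrix (Fin m) (Fin n) (QS S)) :
    ∃ B : ℝ, 0 ≤ B ∧ ∀ i j, |(A i j).1| ≤ B := by
  refine ⟨∑ i, ∑ j, |(A i j).1|, by positivity, fun i j => ?_⟩
  exact (Finset.single_le_sum (f := fun j => |(A i j).1|) (fun _ _ => abs_nonneg _)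
    (Finset.mem_univ j)).trans (Finset.single_le_sum (f := fun i => ∑ j, |(A i j).1|)
    (fun _ _ => by positivity) (Finset.mem_univ i))

theorem exists_pow_mul_mem_OS {m n : ℕ} (A : Matrix (Fin m) (Fin n) (QS S)) :
    ∃ N : ℕ, ∀ i j, toQS S ((primesUnit S : SInt S) ^ N) * A i j ∈ OS S := by
  have h : ∀ᶠ N : ℕ in Filter.atTop, ∀ i j,
      toQS S ((primesUnit S : SInt S) ^ N) * A i j ∈ OS S := by
    simp only [Filter.eventually_all]
    exact fun i j => eventually_pow_mul_mem_OS _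
  exact h.exists

/-- An `S`-lattice is discrete. -/
theorem finite_setOf_lattice_bounded {n : ℕ} {g : Matrix (Fin n) (Fin n) (QS S)}
    (hg : IsUnit g.det) (R : ℝ) :
    {z : Fin n → SInt S | ∀ i, |((g *ᵥ fun l => toQS S (z l)) i).1| ≤ R ∧
      (g *ᵥ fun l => toQS S (z l)) i ∈ OS S}.Finite := by
  obtain ⟨B, hB0, hB⟩ := exists_forall_abs_fst_le g⁻¹
  obtain ⟨N, hN⟩ := exists_pow_mul_mem_OS g⁻¹
  set P : (SInt S)ˣ := primesUnit S ^ N with hP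
  set P' : ℝ := |(toQS S (P : SInt S)).1| with hP'
  refine ((finite_setOf_int_bounded (S := S) n (P' * (n * (B * R)))).preimage
    (f := fun z : Fin n → SInt S => fun i => (P : SInt S) * z i) ?_).subset ?_
  · intro a _ b _ h
    ext1 i
    exact P.mul_right_inj.1 (congrFun h i)
  · intro z hz i
    set x := g *ᵥ fun l => toQS S (z l) with hx
    have hz' : (fun l => toQS S (z l)) = g⁻¹ *ᵥ x := by
      rw [hx, Matrix.mulVec_mulVec, Matrix.nonsing_inv_mul _ hg, Matrix.one_mulVec]
    have hzi : toQS S (z i) = (g⁻¹ *ᵥ x) i := congrFun hz' i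
    constructor
    · rw [map_mul, Prod.fst_mul, abs_mul, hzi]
      exact mul_le_mul_of_nonneg_left (abs_mulVec_fst_le hB (fun j => (hz j).1) i) (abs_nonneg _)
    · rw [map_mul, hzi, Matrix.mulVec, dotProduct, Finset.mul_sum]
      refine sum_mem fun j _ => ?_
      rw [← mul_assoc, hP, Units.val_pow_eq_pow_val]
      exact mul_mem (hN i j) (hz j).2

/-- Multiplying the first column by a unit and the second one by its inverse. -/
theorem exists_det_one_smul_col {n : ℕ} {γ : Matrix (Fin (n + 2)) (Fin (n + 2)) (SInt S)}
    (hγ : γ.det = 1) (ε : (SInt S)ˣ) :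
    ∃ γ' : Matrix (Fin (n + 2)) (Fin (n + 2)) (SInt S), γ'.det = 1 ∧
      ∀ i, γ' i 0 = ε * γ i 0 := by
  refine ⟨γ * Matrix.diagonal (Fin.cons (ε : SInt S) (Fin.cons ((ε⁻¹ : (SInt S)ˣ) : SInt S)
    fun _ => 1)), ?_, fun i => ?_⟩
  · rw [Matrix.det_mul, hγ, Matrix.det_diagonal, Fin.prod_univ_succ, Fin.prod_univ_succ]
    simp
  · rw [Matrix.mul_diagonal, Fin.cons_zero, mul_comm]

/-- The second column of a matrix in `SL_n` is the first column of another one. -/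
theorem exists_det_one_swap_col {n : ℕ} {γ : Matrix (Fin (n + 2)) (Fin (n + 2)) (SInt S)}
    (hγ : γ.det = 1) :
    ∃ γ' : Matrix (Fin (n + 2)) (Fin (n + 2)) (SInt S), γ'.det = 1 ∧ ∀ i, γ' i 0 = γ i 1 := by
  refine ⟨γ.submatrix id (Equiv.swap 0 1) * Matrix.diagonal (Fin.cons 1 (Fin.cons (-1)
    fun _ => 1)), ?_, fun i => ?_⟩
  · rw [Matrix.det_mul, Matrix.det_permute', hγ, Matrix.det_diagonal, Fin.prod_univ_succ,
      Fin.prod_univ_succ, Equiv.Perm.sign_swap (by simp)]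
    simp
  · rw [Matrix.mul_diagonal, Fin.cons_zero, mul_one, submatrix_apply, Equiv.swap_apply_left]
    rfl

/-- The first column of `g γ`. -/
noncomputable abbrev firstCol {n : ℕ} (g : Matrix (Fin (n + 1)) (Fin (n + 1)) (QS S))
    (γ : Matrix (Fin (n + 1)) (Fin (n + 1)) (SInt S)) : Fin (n + 1) → QS S :=
  g *ᵥ fun l => toQS S (γ l 0)

theorem isUnit_of_places {x : QS S} (h0 : x.1 ≠ 0) (hp : ∀ p, x.2 p ≠ 0) : IsUnit x :=
  IsUnit.of_mul_eq_one (x.1⁻¹, fun p => (x.2 p)⁻¹)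
    (Prod.ext (mul_inv_cancel₀ h0) (funext fun p => mul_inv_cancel₀ (hp p)))

theorem isUnit_det_of_norm {n : ℕ} {g : Matrix (Fin n) (Fin n) (QS S)} (h0 : (g.det).1 ≠ 0)
    (hp : ∀ p, ‖(g.det).2 p‖ = 1) : IsUnit g.det :=
  isUnit_of_places h0 fun p h => by simpa [h] using hp p

/-- Some `γ ∈ SL_n(ℤ_S)` makes the first column of `g γ` integral at the finite places and as
short as possible at the real place. -/
theorem exists_minimal_firstCol {n : ℕ} {g : Matrix (Fin (n + 1)) (Fin (n + 1)) (QS S)}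
    (h0 : (g.det).1 ≠ 0) (hp : ∀ p, ‖(g.det).2 p‖ = 1) :
    ∃ γ : Matrix (Fin (n + 1)) (Fin (n + 1)) (SInt S), γ.det = 1 ∧
      (∀ i, firstCol g γ i ∈ OS S) ∧
      ∀ γ' : Matrix (Fin (n + 1)) (Fin (n + 1)) (SInt S), γ'.det = 1 →
        (∀ i, firstCol g γ' i ∈ OS S) → realNormSq (firstCol g γ) ≤ realNormSq (firstCol g γ') := by
  have hne : ∃ γ₀ : Matrix (Fin (n + 1)) (Fin (n + 1)) (SInt S), γ₀.det = 1 ∧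
      ∀ i, firstCol g γ₀ i ∈ OS S := by
    cases n with
    | zero =>
      refine ⟨1, Matrix.det_one, fun i p => ?_⟩
      have h1 : firstCol g 1 i = g.det := by
        obtain rfl : i = 0 := Fin.eq_zero i
        simp [Matrix.mulVec, dotProduct]
      rw [h1]
      exact (hp p).le
    | succ n =>
      obtain ⟨N, hN⟩ := exists_pow_mul_mem_OS g
      obtain ⟨γ', hγ', h1⟩ := exists_det_one_smul_col (γ := (1 : Matrix (Fin (n + 2)) (Fin (n + 2))
        (SInt S))) Matrix.det_one (primesUnit S ^ N)
      refine ⟨γ', hγ', fun i => ?_⟩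
      rw [firstCol, Matrix.mulVec, dotProduct]
      refine sum_mem fun j _ => ?_
      rw [h1 j, map_mul, mul_left_comm, ← mul_assoc, Units.val_pow_eq_pow_val]
      refine mul_mem (hN i j) ?_
      rw [Matrix.one_apply]
      split_ifs
      · rw [map_one]; exact one_mem _
      · rw [map_zero]; exact zero_mem _
  obtain ⟨γ₀, hγ₀, hγ₀O⟩ := hne
  set R := √(realNormSq (firstCol g γ₀)) with hR
  have hR2 : realNormSq (firstCol g γ₀) = R ^ 2 := (Real.sq_sqrt (Finset.sum_nonneg fun i _ =>
    sq_nonneg _)).symm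
  -- only finitely many vectors compete with the first column of `γ₀`
  let V : Set (Fin (n + 1) → SInt S) := {z | ∃ γ : Matrix (Fin (n + 1)) (Fin (n + 1)) (SInt S),
    γ.det = 1 ∧ (fun l => γ l 0) = z ∧ (∀ i, firstCol g γ i ∈ OS S) ∧
      realNormSq (firstCol g γ) ≤ R ^ 2}
  have hV : V.Finite := by
    refine (finite_setOf_lattice_bounded (isUnit_det_of_norm h0 hp) R).subset ?_
    rintro _ ⟨γ, -, rfl, hO, hb⟩ i
    exact ⟨abs_le_of_realNormSq_le (Real.sqrt_nonneg _) hb i, hO i⟩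
  obtain ⟨_, ⟨γ, hγ, rfl, hO, hb⟩, hmin⟩ := Set.exists_min_image V
    (fun z => realNormSq (g *ᵥ fun l => toQS S (z l))) hV ⟨_, γ₀, hγ₀, rfl, hγ₀O, hR2.le⟩
  refine ⟨γ, hγ, hO, fun γ' hγ' hO' => ?_⟩
  by_cases hb' : realNormSq (firstCol g γ') ≤ R ^ 2
  · exact hmin _ ⟨γ', hγ', rfl, hO', hb'⟩
  · exact hb.trans (not_le.1 hb').le

theorem realNormSq_pos_of_firstCol {n : ℕ} {g : Matrix (Fin (n + 1)) (Fin (n + 1)) (QS S)}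
    (h0 : (g.det).1 ≠ 0) {γ : Matrix (Fin (n + 1)) (Fin (n + 1)) (SInt S)} (hγ : γ.det = 1) :
    0 < realNormSq (firstCol g γ) := by
  refine lt_of_le_of_ne (Finset.sum_nonneg fun i _ => sq_nonneg _) fun h => ?_
  have h1 : ∀ i, (firstCol g γ i).1 = 0 := fun i => by
    have := (Finset.sum_eq_zero_iff_of_nonneg fun i _ => sq_nonneg _).1 h.symm i (Finset.mem_univ i)
    exact pow_eq_zero_iff two_ne_zero |>.1 this
  have h2 : ((g * γ.map (toQS S)).det).1 = 0 := by
    rw [det_fst]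
    exact Matrix.det_eq_zero_of_column_eq_zero 0 h1
  rw [Matrix.det_mul, det_toQS, hγ, map_one, mul_one] at h2
  exact h0 h2

/-- The prime `p ∈ S_f` as a unit of `ℤ_S`. -/
noncomputable def primeUnit (p : S) : (SInt S)ˣ where
  val := ((p.1.1 : ℕ) : SInt S)
  inv := ⟨((p.1.1 : ℕ) : ℚ)⁻¹, fun q hq => by
    rw [← one_div, padicNorm.div, padicNorm_natCast_eq_one_of_not_dvd fun h => hq
      ((Subtype.ext ((Nat.prime_dvd_prime_iff_eq q.2 p.1.2).1 h)) ▸ p.2)]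
    simp⟩
  val_inv := Subtype.ext (mul_inv_cancel₀ (Nat.cast_ne_zero.2 p.1.2.ne_zero))
  inv_val := Subtype.ext (inv_mul_cancel₀ (Nat.cast_ne_zero.2 p.1.2.ne_zero))

theorem toQS_primeUnit_inv (p : S) :
    toQS S ((primeUnit p)⁻¹ : (SInt S)ˣ) = diagQ S (((p.1.1 : ℕ) : ℚ)⁻¹) := rfl

/-- A shortest column is a unit vector at each finite place: otherwise it could be divided by
the prime. -/
theorem exists_norm_firstCol_eq_one {n : ℕ} {g : Matrix (Fin (n + 1)) (Fin (n + 1)) (QS S)}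
    (h0 : (g.det).1 ≠ 0) (hp : ∀ p, ‖(g.det).2 p‖ = 1)
    {γ : Matrix (Fin (n + 1)) (Fin (n + 1)) (SInt S)} (hγ : γ.det = 1)
    (hO : ∀ i, firstCol g γ i ∈ OS S)
    (hmin : ∀ γ' : Matrix (Fin (n + 1)) (Fin (n + 1)) (SInt S), γ'.det = 1 →
        (∀ i, firstCol g γ' i ∈ OS S) → realNormSq (firstCol g γ) ≤ realNormSq (firstCol g γ'))
    (p : S) : ∃ j, ‖(firstCol g γ j).2 p‖ = 1 := by
  by_contra! hne
  have hlt : ∀ j, ‖(firstCol g γ j).2 p‖ < 1 := fun j => lt_of_le_of_ne (hO j p) (hne j)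
  cases n with
  | zero =>
    have h1 : firstCol g γ 0 = g.det := by
      rw [Matrix.det_fin_one] at hγ
      simp [Matrix.mulVec, dotProduct, hγ]
    have := hlt 0
    rw [h1, hp p] at this
    exact lt_irrefl _ this
  | succ n =>
    obtain ⟨γ', hγ', hcol⟩ := exists_det_one_smul_col hγ (primeUnit p)⁻¹
    have hp1 : (1 : ℝ) < p.1.1 := by exact_mod_cast p.1.2.one_lt
    have hcol' : ∀ i, firstCol g γ' i = diagQ S (((p.1.1 : ℕ) : ℚ)⁻¹) * firstCol g γ i := by
      intro i
      simp only [firstCol, Matrix.mulVec, dotProduct, Finset.mul_sum]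
      refine Finset.sum_congr rfl fun j _ => ?_
      rw [hcol j, map_mul, toQS_primeUnit_inv]
      ring
    have h2 := hmin γ' hγ' fun i q => by
      rw [hcol' i, Prod.snd_mul, Pi.mul_apply, norm_mul, diagQ_snd]
      by_cases hq : q = p
      · subst hq
        have h3 := (Padic.norm_lt_pow_iff_norm_le_pow_sub_one _ 0).1
          (by simpa using hlt i : ‖(firstCol g γ i).2 q‖ < (q.1.1 : ℝ) ^ (0 : ℤ))
        rw [zero_sub, _root_.zpow_neg_one] at h3
        rw [Rat.cast_inv, Rat.cast_natCast, norm_inv, Padic.norm_p, inv_inv]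
        calc (q.1.1 : ℝ) * ‖(firstCol g γ i).2 q‖ ≤ q.1.1 * (q.1.1 : ℝ)⁻¹ := by gcongr
          _ = 1 := mul_inv_cancel₀ (by positivity)
      · have h3 : ‖((((p.1.1 : ℕ) : ℚ)⁻¹ : ℚ) : ℚ_[q.1.1])‖ = 1 := by
          rw [Padic.eq_padicNorm, ← one_div, padicNorm.div,
            padicNorm_natCast_eq_one_of_not_dvd (p := q.1) fun h => hq (Subtype.ext (Subtype.ext
              ((Nat.prime_dvd_prime_iff_eq q.1.2 p.1.2).1 h)))]
          simp
        rw [h3, one_mul]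
        exact hO i q
    have h4 : realNormSq (firstCol g γ') = ((p.1.1 : ℝ)⁻¹) ^ 2 * realNormSq (firstCol g γ) := by
      rw [realNormSq, realNormSq, Finset.mul_sum]
      refine Finset.sum_congr rfl fun i _ => ?_
      rw [hcol' i, Prod.fst_mul, diagQ_fst, mul_pow]
      push_cast
      rfl
    have h5 := realNormSq_pos_of_firstCol h0 hγ
    have h6 : ((p.1.1 : ℝ)⁻¹) ^ 2 < 1 :=
      pow_lt_one₀ (by positivity) (inv_lt_one_of_one_lt₀ hp1) two_ne_zero
    rw [h4] at h2
    nlinarith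

/-- **Reduction theory.** Up to an isometry at each place on the left and `SL_n(ℤ_S)` on the right,
a matrix with unit determinant at the finite places is an upper triangular matrix that satisfies
the Siegel condition. -/
theorem exists_isSiegel (n : ℕ) (g : Matrix (Fin n) (Fin n) (QS S)) (h0 : (g.det).1 ≠ 0)
    (hp : ∀ p, ‖(g.det).2 p‖ = 1) :
    ∃ (k : Matrix (Fin n) (Fin n) (QS S)) (γ : Matrix (Fin n) (Fin n) (SInt S)),
      IsPlaceIsometry k ∧ γ.det = 1 ∧ IsSiegel (k * g * γ.map (toQS S)) := by
  induction n with
  | zero =>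
    exact ⟨1, 1, .one, Matrix.det_one, ⟨fun i => i.elim0, fun i => i.elim0, fun i => i.elim0,
      fun i => i.elim0, fun i => i.elim0, fun i => i.elim0⟩⟩
  | succ n ih =>
    obtain ⟨γ, hγ, hO, hmin⟩ := exists_minimal_firstCol h0 hp
    obtain ⟨k, a, hk, ha0, hap, hka⟩ := exists_isPlaceIsometry_mulVec_eq
      (realNormSq_pos_of_firstCol h0 hγ).ne' hO
      (exists_norm_firstCol_eq_one h0 hp hγ hO hmin)
    have ha2 : realNormSq (firstCol g γ) = a.1 ^ 2 := by
      rw [← hk.realNormSq_mulVec, hka, realNormSq, Fin.sum_univ_succ]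
      simp
    set M := k * g * γ.map (toQS S) with hM
    have hMcol : ∀ i, M i 0 = (Pi.single 0 a : Fin (n + 1) → QS S) i := by
      intro i
      rw [← hka, firstCol, Matrix.mulVec_mulVec]
      rfl
    have hM00 : M 0 0 = a := by simp [hMcol]
    have hMs0 : ∀ i : Fin n, M i.succ 0 = 0 := fun i => by simp [hMcol]
    have hMdet : M.det = a * (M.submatrix Fin.succ Fin.succ).det := by
      rw [Matrix.det_succ_column_zero, Fin.sum_univ_succ, hM00]
      simp [hMs0]
    have hMdet' : M.det = k.det * g.det := by
      rw [hM, Matrix.det_mul, Matrix.det_mul, det_toQS, hγ, map_one, mul_one]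
    obtain ⟨k', γ', hk', hγ', hT⟩ := ih (M.submatrix Fin.succ Fin.succ)
      (fun h => by
        have h1 : (M.det).1 = 0 := by rw [hMdet, Prod.fst_mul, h, mul_zero]
        rw [hMdet', Prod.fst_mul] at h1
        refine (mul_ne_zero (fun h2 => ?_) h0) h1
        simpa [h2] using hk.abs_det)
      (fun p => by
        have h1 : ‖(M.det).2 p‖ = 1 := by
          rw [hMdet', Prod.snd_mul, Pi.mul_apply, norm_mul, hk.norm_det, hp, one_mul]
        rwa [hMdet, Prod.snd_mul, Pi.mul_apply, norm_mul, hap, one_mul] at h1)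
    set T := k' * M.submatrix Fin.succ Fin.succ * γ'.map (toQS S) with hTdef
    set M1 := liftBlock k' * M * (liftBlock γ').map (toQS S) with hM1
    have hM1s0 : ∀ i : Fin n, M1 i.succ 0 = 0 := by
      intro i
      simp [hM1, liftBlock_map, Matrix.mul_apply, Fin.sum_univ_succ, hMs0]
    have hM100 : M1 0 0 = a := by
      simp [hM1, liftBlock_map, Matrix.mul_apply, Fin.sum_univ_succ, hM00]
    have hM1ss : ∀ i j : Fin n, M1 i.succ j.succ = T i j := by
      intro i j
      simp [hM1, hTdef, liftBlock_map, Matrix.mul_apply, Fin.sum_univ_succ]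
    -- reduce the first row modulo `ℤ_S`
    let ainv : QS S := (a.1⁻¹, fun p => (a.2 p)⁻¹)
    have hainv : a * ainv = 1 := Prod.ext (mul_inv_cancel₀ ha0.ne')
      (funext fun p => mul_inv_cancel₀ fun h => by simpa [h] using hap p)
    choose m hm1 hm2 using fun j : Fin n => exists_sub_toQS_mem (ainv * M1 0 j.succ)
    have haO : a ∈ OS S := fun p => (hap p).le
    have hrow : ∀ j : Fin n, M1 0 j.succ - a * toQS S (m j) =
        a * (ainv * M1 0 j.succ - toQS S (m j)) := fun j => by
      rw [mul_sub, ← mul_assoc, hainv, one_mul]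
    let U : Matrix (Fin (n + 1)) (Fin (n + 1)) (SInt S) :=
      Matrix.of (Fin.cons (Fin.cons 1 fun j => -m j) fun i => (1 : Matrix _ _ (SInt S)) i.succ)
    have hU00 : U 0 0 = 1 := rfl
    have hU0s : ∀ j : Fin n, U 0 j.succ = -m j := fun j => rfl
    have hUs : ∀ (i : Fin n) j, U i.succ j = (1 : Matrix _ _ (SInt S)) i.succ j := fun i j => rfl
    have hUdet : U.det = 1 := by
      rw [Matrix.det_of_isUpperTriangular]
      · rw [Fin.prod_univ_succ, hU00, one_mul]
        exact Finset.prod_eq_one fun i _ => by rw [hUs, Matrix.one_apply_eq]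
      · intro i j hij
        induction i using Fin.cases with
        | zero => exact absurd hij (Fin.not_lt_zero j)
        | succ i => exact (hUs i j).trans (Matrix.one_apply_ne (ne_of_gt hij))
    set M2 := M1 * U.map (toQS S) with hM2
    have hM20 : ∀ i, M2 i 0 = M1 i 0 := by
      intro i
      simp [hM2, Matrix.mul_apply, Fin.sum_univ_succ, hU00, hUs]
    have hM2s : ∀ i (j : Fin n), M2 i j.succ = M1 i j.succ - M1 i 0 * toQS S (m j) := by
      intro i j
      simp only [hM2, Matrix.mul_apply, Fin.sum_univ_succ, Matrix.map_apply, hU0s, hUs, map_neg,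
        Matrix.one_apply, Fin.succ_inj, apply_ite (toQS S), map_one, map_zero, mul_ite, mul_one,
        mul_zero, Finset.sum_ite_eq', Finset.mem_univ, if_true]
      ring
    have hM2ss : ∀ i j : Fin n, M2 i.succ j.succ = T i j := fun i j => by
      rw [hM2s, hM1s0, zero_mul, sub_zero, hM1ss]
    have hM20s : ∀ j : Fin n, M2 0 j.succ = a * (ainv * M1 0 j.succ - toQS S (m j)) := fun j => by
      rw [hM2s, hM100, hrow]
    have hM200 : M2 0 0 = a := by rw [hM20, hM100]
    have hM2s0 : ∀ i : Fin n, M2 i.succ 0 = 0 := fun i => by rw [hM20, hM1s0]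
    have hfin : M2 = (liftBlock k' * k) * g * (γ * liftBlock γ' * U).map (toQS S) := by
      rw [hM2, hM1, hM, Matrix.map_mul, Matrix.map_mul]
      simp only [Matrix.mul_assoc]
    have hdetfin : (γ * liftBlock γ' * U).det = 1 := by
      rw [Matrix.det_mul, Matrix.det_mul, hγ, det_liftBlock, hγ', hUdet, one_mul, one_mul]
    have hiso : IsPlaceIsometry (liftBlock k' * k) := hk'.liftBlock.mul hk
    have habs0 : ∀ j : Fin n, |(M2 0 j.succ).1| ≤ a.1 / 2 := fun j => by
      rw [hM20s, Prod.fst_mul, abs_mul, abs_of_pos ha0, div_eq_mul_one_div]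
      exact mul_le_mul_of_nonneg_left (hm1 j) ha0.le
    have hint : ∀ i j, M2 i j ∈ OS S := by
      intro i j
      refine Fin.cases ?_ (fun i => ?_) i <;> refine Fin.cases ?_ (fun j => ?_) j
      · rwa [hM200]
      · rw [hM20s]; exact mul_mem haO (hm2 j)
      · rw [hM2s0]; exact zero_mem _
      · rw [hM2ss]; exact hT.mem_OS i j
    refine ⟨liftBlock k' * k, γ * liftBlock γ' * U, hiso, hdetfin, ?_⟩
    rw [← hfin]
    refine ⟨fun i j hij => ?_, fun i => ?_, fun i p => ?_, fun i j => ?_, hint, fun i j hij => ?_⟩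
    · induction i using Fin.cases with
      | zero => exact absurd hij (Fin.not_lt_zero j)
      | succ i =>
        induction j using Fin.cases with
        | zero => exact hM2s0 i
        | succ j => rw [hM2ss]; exact hT.lower i j (Fin.succ_lt_succ_iff.1 hij)
    · refine Fin.cases ?_ (fun i => ?_) i
      · rwa [hM200]
      · rw [hM2ss]; exact hT.pos i
    · refine Fin.cases ?_ (fun i => ?_) i
      · rw [hM200]; exact hap p
      · rw [hM2ss]; exact hT.norm_diag i p
    · refine Fin.cases ?_ (fun i => ?_) i <;> refine Fin.cases ?_ (fun j => ?_) j
      · rw [hM200, abs_of_pos ha0]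
      · rw [hM200]; exact (habs0 j).trans (by linarith)
      · rw [hM2s0, hM2ss]; simpa using (hT.pos i).le
      · rw [hM2ss, hM2ss]; exact hT.abs_le i j
    · induction i using Fin.cases with
      | succ i =>
        induction j using Fin.cases with
        | zero => exact absurd hij (by simp)
        | succ j =>
          rw [hM2ss, hM2ss]
          refine (hT.diag_le i j (Fin.succ_le_succ_iff.1 hij)).trans ?_
          exact mul_le_mul_of_nonneg_right (pow_le_pow_right₀ one_le_two (Nat.le_succ n))
            (hT.pos j).le
      | zero =>
        rw [hM200]
        induction j using Fin.cases with
        | zero =>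
          rw [hM200]
          exact le_mul_of_one_le_left ha0.le (one_le_pow₀ one_le_two)
        | succ j =>
          rw [hM2ss]
          cases n with
          | zero => exact j.elim0
          | succ n =>
            -- the second column competes with the first one
            obtain ⟨γ₂, hγ₂, hcol⟩ := exists_det_one_swap_col hdetfin
            have hvec : (liftBlock k' * k) *ᵥ firstCol g γ₂ = fun i => M2 i 1 := by
              rw [hfin, firstCol, Matrix.mulVec_mulVec]
              ext1 i
              simp only [Matrix.mulVec, dotProduct, Matrix.mul_apply (M := liftBlock k' * k * g),
                hcol, Matrix.map_apply]
            have h1 := hmin γ₂ hγ₂ (hiso.mulVec_mem_iff.1 (by rw [hvec]; exact fun i => hint i 1))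
            rw [ha2, ← hiso.realNormSq_mulVec, hvec, realNormSq, Fin.sum_univ_succ,
              Fin.sum_univ_succ, Finset.sum_eq_zero, add_zero] at h1
            · have h2 := habs0 0
              have h3 : (M2 (Fin.succ 0) 1) = T 0 0 := hM2ss 0 0
              rw [h3] at h1
              have h4 : (M2 0 1).1 ^ 2 ≤ (a.1 / 2) ^ 2 := by
                rw [← sq_abs]
                exact pow_le_pow_left₀ (abs_nonneg _) h2 2
              have h5 : a.1 ≤ 2 * (T 0 0).1 := by
                refine le_of_sq_le_sq ?_ (by linarith [hT.pos 0])
                nlinarith [sq_nonneg a.1]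
              calc a.1 ≤ 2 * (T 0 0).1 := h5
                _ ≤ 2 * (2 ^ (n + 1) * (T j j).1) :=
                  mul_le_mul_of_nonneg_left (hT.diag_le 0 j (Fin.zero_le j)) two_pos.le
                _ = 2 ^ (n + 1 + 1) * (T j j).1 := by ring
            · intro i _
              have h3 : M2 i.succ.succ 1 = T i.succ 0 := hM2ss i.succ 0
              rw [h3, hT.lower _ _ (Fin.succ_pos i)]
              simp

/-! ### Invariant measures on tuples of vectors -/

instance isAddHaarMeasure_padicHaar (p : ℕ) [Fact p.Prime] : (padicHaar p).IsAddHaarMeasure := by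
  unfold padicHaar; infer_instance

/-- The instances from here to `isAddHaarMeasure_pi_muQS` are shortcuts; without them
instance search on iterated products of `ℚ_S` fails. -/
instance secondCountableTopology_padic (p : ℕ) [Fact p.Prime] : SecondCountableTopology ℚ_[p] :=
  inferInstance

instance secondCountableTopology_QS : SecondCountableTopology (QS S) := inferInstance

instance borelSpace_QS : BorelSpace (QS S) := inferInstance

instance isAddHaarMeasure_muQS : (muQS S).IsAddHaarMeasure := by
  unfold muQS; infer_instance

instance sigmaFinite_muQS : SigmaFinite (muQS S) := inferInstance

instance isAddHaarMeasure_pi_muQS (d : ℕ) :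
    (Measure.pi fun _ : Fin d => muQS S).IsAddHaarMeasure := inferInstance

instance isAddHaarMeasure_muVec (d r : ℕ) : (muVec S d r).IsAddHaarMeasure :=
  Measure.pi.isAddHaarMeasure _

/-- The zero set of a nonzero polynomial is a null set. -/
theorem pi_setOf_eval_eq_zero {K : Type*} [Field K] [MeasurableSpace K] [TopologicalSpace K]
    [IsTopologicalRing K] [T1Space K] [SecondCountableTopology K] [BorelSpace K] (μ : Measure K)
    [SigmaFinite μ] [NullSingletonClass μ] {n : ℕ} (p : MvPolynomial (Fin n) K) (hp : p ≠ 0) :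
    (Measure.pi fun _ : Fin n => μ) {x | MvPolynomial.eval x p = 0} = 0 := by
  induction n with
  | zero =>
    convert! measure_empty (μ := Measure.pi fun _ : Fin 0 => μ)
    rw [Set.eq_empty_iff_forall_notMem]
    intro x hx
    rw [MvPolynomial.eq_C_of_isEmpty p, Set.mem_ofPred_eq, MvPolynomial.eval_C] at hx
    rw [MvPolynomial.eq_C_of_isEmpty p, hx, MvPolynomial.C_0] at hp
    exact hp rfl
  | succ n ih =>
    have hmeas : ∀ {m : ℕ} (q : MvPolynomial (Fin m) K),
        MeasurableSet {x : Fin m → K | MvPolynomial.eval x q = 0} := fun q =>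
      (isClosed_singleton (x := (0 : K))).preimage (MvPolynomial.continuous_eval q) |>.measurableSet
    set q := MvPolynomial.finSuccEquiv K n p with hq
    have hq0 : q ≠ 0 := by simpa [hq] using hp
    have hmp := (measurePreserving_piFinSuccAbove (fun _ : Fin (n + 1) => μ) 0)
    have hpre : {x : Fin (n + 1) → K | MvPolynomial.eval x p = 0} =
        (MeasurableEquiv.piFinSuccAbove (fun _ => K) 0) ⁻¹' {y : K × (Fin n → K) |
          MvPolynomial.eval (Fin.cons y.1 y.2 : Fin (n + 1) → K) p = 0} := by
      ext x
      simp only [Set.mem_ofPred_eq, Set.mem_preimage, MeasurableEquiv.piFinSuccAbove_apply]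
      have : (Fin.cons (x 0) (Fin.removeNth 0 x) : Fin (n + 1) → K) = x := Fin.cons_self_tail x
      rw [show (Fin.insertNthEquiv (fun _ => K) 0).symm x = (x 0, Fin.removeNth 0 x) from rfl, this]
    have hcont : Continuous fun y : K × (Fin n → K) => (Fin.cons y.1 y.2 : Fin (n + 1) → K) := by
      refine continuous_pi fun i => ?_
      refine Fin.cases ?_ (fun i => ?_) i
      · exact continuous_fst
      · exact (continuous_apply i).comp continuous_snd
    have hE : MeasurableSet {y : K × (Fin n → K) |
        MvPolynomial.eval (Fin.cons y.1 y.2 : Fin (n + 1) → K) p = 0} :=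
      hcont.measurable (hmeas p)
    rw [hpre, hmp.measure_preimage hE.nullMeasurableSet, ← Measure.prod_swap,
      Measure.map_apply measurable_swap hE, Measure.measure_prod_null (measurable_swap hE)]
    have hae : ∀ᵐ s ∂(Measure.pi fun _ : Fin n => μ), MvPolynomial.eval s q.leadingCoeff ≠ 0 := by
      rw [ae_iff]
      simpa only [not_not] using ih _ (Polynomial.leadingCoeff_ne_zero.2 hq0)
    filter_upwards [hae] with s hs
    classical
    have hne : q.map (MvPolynomial.eval s) ≠ 0 := by
      intro h
      apply hs
      have := congrArg (fun f => Polynomial.coeff f q.natDegree) h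
      simpa using this
    refine measure_mono_null ?_ (Set.Finite.measure_zero
      ((q.map (MvPolynomial.eval s)).roots.toFinset.finite_toSet) μ)
    intro y hy
    have hy' : MvPolynomial.eval (Fin.cons y s : Fin (n + 1) → K) p = 0 := hy
    rw [MvPolynomial.eval_eq_eval_mv_eval'] at hy'
    simpa [hne] using hy'

/-- A generic matrix maps `r` linearly independent vectors to vectors with a nonzero given
`r × r` minor. -/
theorem pi_setOf_minor_eq_zero {K : Type*} [Field K] [MeasurableSpace K] [TopologicalSpace K]
    [IsTopologicalRing K] [T1Space K] [SecondCountableTopology K] [BorelSpace K] (μ : Measure K)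
    [SigmaFinite μ] [NullSingletonClass μ] {d r : ℕ} (w : Matrix (Fin d) (Fin r) K)
    (hw : ∃ σ : Matrix (Fin r) (Fin d) K, σ * w = 1) {e : Fin r → Fin d}
    (he : Function.Injective e) :
    (Measure.pi fun _ : Fin (d * d) => μ) {x |
      ((Matrix.of fun i j => x (finProdFinEquiv (i, j)) : Matrix (Fin d) (Fin d) K).submatrix e id
        * w).det = 0} = 0 := by
  let X : Matrix (Fin d) (Fin d) (MvPolynomial (Fin (d * d)) K) :=
    Matrix.of fun i j => MvPolynomial.X (finProdFinEquiv (i, j))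
  let w' : Matrix (Fin d) (Fin r) (MvPolynomial (Fin (d * d)) K) := w.map MvPolynomial.C
  let p : MvPolynomial (Fin (d * d)) K := Matrix.det (X.submatrix e id * w')
  have heval : ∀ x, MvPolynomial.eval x p =
      ((Matrix.of fun i j => x (finProdFinEquiv (i, j)) : Matrix (Fin d) (Fin d) K).submatrix e id
        * w).det := by
    intro x
    rw [show p = Matrix.det (X.submatrix e id * w') from rfl, RingHom.map_det, RingHom.mapMatrix_apply, Matrix.map_mul]
    congr 2
    · ext i j
      simp [X]
    · ext i j
      simp [w']
  have hp : p ≠ 0 := by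
    intro h
    obtain ⟨σ, hσ⟩ := hw
    have h1 := heval fun m => Function.extend e σ 0 (finProdFinEquiv.symm m).1
      (finProdFinEquiv.symm m).2
    have h2 : ((Matrix.of fun i j => (fun m => Function.extend e σ 0 (finProdFinEquiv.symm m).1
      (finProdFinEquiv.symm m).2) (finProdFinEquiv (i, j)) : Matrix (Fin d) (Fin d) K).submatrix e id)
        = σ := by
      ext i j
      simpa using congrFun (he.extend_apply σ 0 i) j
    rw [h2, hσ, h, map_zero, Matrix.det_one] at h1
    exact zero_ne_one h1
  have := pi_setOf_eval_eq_zero μ p hp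
  simpa only [heval] using this

/-- The diagonal action of matrices on tuples of column vectors. -/
noncomputable def tupleMul {d r : ℕ} (h : Matrix (Fin d) (Fin d) (QS S)) (w : Fin r → Fin d → QS S) :
    Fin r → Fin d → QS S := fun i => h *ᵥ w i

theorem continuous_tupleMul {d r : ℕ} (h : Matrix (Fin d) (Fin d) (QS S)) :
    Continuous (tupleMul (r := r) h) :=
  continuous_pi fun i => continuous_const.matrix_mulVec (continuous_apply i)

/-- The minor of a tuple of column vectors in the rows `e`. -/
noncomputable def minor {d r : ℕ} (e : Fin r → Fin d) (w : Fin r → Fin d → QS S) : QS S :=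
  (Matrix.of fun l i => w i (e l)).det

theorem continuous_minor {d r : ℕ} (e : Fin r → Fin d) :
    Continuous (minor (S := S) e) := by
  refine Continuous.matrix_det ?_
  refine continuous_matrix fun l i => ?_
  exact (continuous_apply (e l)).comp (continuous_apply i)

theorem isUnit_iff_places {x : QS S} : IsUnit x ↔ x.1 ≠ 0 ∧ ∀ p, x.2 p ≠ 0 :=
  ⟨fun h => ⟨(h.map (atReal S)).ne_zero, fun p => (h.map (atPadic p)).ne_zero⟩,
    fun h => isUnit_of_places h.1 h.2⟩

theorem isClosed_setOf_not_isUnit : IsClosed {x : QS S | ¬ IsUnit x} := by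
  have : {x : QS S | ¬ IsUnit x} = {x | x.1 = 0} ∪ ⋃ p, {x | x.2 p = 0} := by
    ext x
    simp only [isUnit_iff_places, not_and_or, not_forall, not_not, Set.mem_ofPred_eq, Set.mem_union,
      Set.mem_iUnion]
  rw [this]
  refine (isClosed_eq continuous_fst continuous_const).union (isClosed_iUnion_of_finite fun p => ?_)
  exact isClosed_eq ((continuous_apply p).comp continuous_snd) continuous_const

/-- The parameter space for matrices over `ℚ_S`, place by place. -/
abbrev MatParam (S : Finset PrimeNum) (d : ℕ) : Type :=
  (Fin (d * d) → ℝ) × (∀ p : S, Fin (d * d) → ℚ_[p.1.1])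

/-- The matrix over `ℚ_S` with given entries at each place. -/
noncomputable def matOfParam {d : ℕ} (x : MatParam S d) : Matrix (Fin d) (Fin d) (QS S) :=
  Matrix.of fun i j => (x.1 (finProdFinEquiv (i, j)), fun p => x.2 p (finProdFinEquiv (i, j)))

theorem continuous_matOfParam {d : ℕ} : Continuous (matOfParam (S := S) (d := d)) := by
  refine continuous_matrix fun i j => ?_
  refine ((continuous_apply _).comp continuous_fst).prodMk (continuous_pi fun p => ?_)
  exact (continuous_apply _).comp ((continuous_apply p).comp continuous_snd)

/-- Lebesgue measure times Haar measures on matrices. -/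
noncomputable def paramMeasure (S : Finset PrimeNum) (d : ℕ) : Measure (MatParam S d) :=
  (Measure.pi fun _ => volume).prod (Measure.pi fun p : S => Measure.pi fun _ => padicHaar p.1.1)

instance (S : Finset PrimeNum) (d : ℕ) : BorelSpace (MatParam S d) := by
  have h : ∀ p : S, BorelSpace (Fin (d * d) → ℚ_[p.1.1]) := fun p => inferInstance
  infer_instance

instance (S : Finset PrimeNum) (d : ℕ) : SecondCountableTopology (MatParam S d) := by
  have h : ∀ p : S, SecondCountableTopology (Fin (d * d) → ℚ_[p.1.1]) := fun p => inferInstance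
  infer_instance

instance (S : Finset PrimeNum) (d : ℕ) : SigmaFinite (paramMeasure S d) := by
  unfold paramMeasure; infer_instance

instance (S : Finset PrimeNum) (d : ℕ) : NeZero (paramMeasure S d) := by
  have h : ∀ p : S, (Measure.pi fun _ : Fin (d * d) => padicHaar p.1.1).IsAddHaarMeasure :=
    fun p => inferInstance
  have h2 : (Measure.pi fun p : S => Measure.pi fun _ : Fin (d * d) =>
    padicHaar p.1.1).IsAddHaarMeasure := Measure.pi.isAddHaarMeasure _
  have h3 : (paramMeasure S d).IsAddHaarMeasure := Measure.prod.instIsAddHaarMeasure _ _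
  infer_instance

/-- For a given tuple `w` of full rank, almost every matrix makes a given minor of `w` invertible
at all places. -/
theorem ae_isUnit_minor_matOfParam {d r : ℕ} {w : Fin r → Fin d → QS S}
    (hw : ∃ σ : Matrix (Fin r) (Fin d) (QS S), σ * (Matrix.of w)ᵀ = 1) {e : Fin r → Fin d}
    (he : Function.Injective e) :
    ∀ᵐ x ∂paramMeasure S d, IsUnit (minor e (tupleMul (matOfParam x) w)) := by
  obtain ⟨σ, hσ⟩ := hw
  have hm : ∀ x : MatParam S d, minor e (tupleMul (matOfParam x) w) =
      ((matOfParam x).submatrix e id * (Matrix.of w)ᵀ).det := fun x => by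
    refine congrArg Matrix.det ?_
    ext1 l i
    rfl
  simp only [isUnit_iff_places, Filter.eventually_and, ae_all_iff]
  constructor
  · have h1 := pi_setOf_minor_eq_zero (volume : Measure ℝ) ((Matrix.of w)ᵀ.map (atReal S))
      ⟨σ.map (atReal S), by rw [← Matrix.map_mul, hσ]; simp⟩ he
    have h2 := Measure.quasiMeasurePreserving_fst (μ := Measure.pi fun _ : Fin (d * d) =>
      (volume : Measure ℝ)) (ν := Measure.pi fun p : S => Measure.pi fun _ : Fin (d * d) =>
        padicHaar p.1.1) |>.preimage_null h1
    refine measure_mono_null ?_ h2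
    intro x hx
    have hx' : (minor e (tupleMul (matOfParam x) w)).1 = 0 := not_not.1 hx
    rw [hm, det_fst, Matrix.map_mul] at hx'
    exact hx'
  · intro p
    have h1 := pi_setOf_minor_eq_zero (padicHaar p.1.1) ((Matrix.of w)ᵀ.map (atPadic p))
      ⟨σ.map (atPadic p), by rw [← Matrix.map_mul, hσ]; simp⟩ he
    have h2 := (Measure.quasiMeasurePreserving_eval (fun p : S => Measure.pi fun _ : Fin (d * d) =>
        padicHaar p.1.1) p).comp (Measure.quasiMeasurePreserving_snd (μ := Measure.pi
          fun _ : Fin (d * d) => (volume : Measure ℝ))) |>.preimage_null h1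
    refine measure_mono_null ?_ h2
    intro x hx
    have hx' : (minor e (tupleMul (matOfParam x) w)).2 p = 0 := not_not.1 hx
    rw [hm, det_snd, Matrix.map_mul] at hx'
    exact hx'

theorem minor_mul_diagonal {d r : ℕ} (e : Fin r → Fin d) (c : Fin d → QS S)
    (w : Fin r → Fin d → QS S) :
    minor e (tupleMul (Matrix.diagonal c) w) = (∏ l, c (e l)) * minor e w := by
  rw [minor, minor, ← Matrix.det_mul_column]
  congr 1
  ext1 l i
  simp [tupleMul, Matrix.mulVec_diagonal]

/-- For an `SL_d`-invariant measure on tuples of full rank, almost no tuple has a vanishing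
`r × r` minor in given rows: average over all matrices with unit determinant. -/
theorem ae_isUnit_minor {d r : ℕ} (hd : 0 < d) (ν : Measure (Fin r → Fin d → QS S)) [SFinite ν]
    (hinv : ∀ h : Matrix (Fin d) (Fin d) (QS S), h.det = 1 → ν.map (tupleMul h) = ν)
    (hfull : ∀ᵐ w ∂ν, ∃ σ : Matrix (Fin r) (Fin d) (QS S), σ * (Matrix.of w)ᵀ = 1)
    {e : Fin r → Fin d} (he : Function.Injective e) : ∀ᵐ w ∂ν, IsUnit (minor e w) := by
  set Z : Set (Fin r → Fin d → QS S) := {w | ¬ IsUnit (minor e w)} with hZ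
  have hZc : IsClosed Z := isClosed_setOf_not_isUnit.preimage (continuous_minor e)
  have hact : Continuous fun y : (Fin r → Fin d → QS S) × MatParam S d =>
      tupleMul (matOfParam y.2) y.1 :=
    continuous_pi fun i => (continuous_matOfParam.comp continuous_snd).matrix_mulVec
      ((continuous_apply i).comp continuous_fst)
  have hE : MeasurableSet {y : (Fin r → Fin d → QS S) × MatParam S d |
      tupleMul (matOfParam y.2) y.1 ∈ Z} := (hZc.preimage hact).measurableSet
  have h1 : (ν.prod (paramMeasure S d)) {y | tupleMul (matOfParam y.2) y.1 ∈ Z} = 0 := by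
    rw [Measure.measure_prod_null hE]
    filter_upwards [hfull] with w hw
    exact ae_isUnit_minor_matOfParam hw he
  rw [← Measure.prod_swap, Measure.map_apply measurable_swap hE,
    Measure.measure_prod_null (measurable_swap hE)] at h1
  -- the determinant is the minor of the standard basis
  have h2 : ∀ᵐ x ∂paramMeasure S d, IsUnit (matOfParam x).det := by
    have h3 := ae_isUnit_minor_matOfParam (S := S) (w := (1 : Matrix (Fin d) (Fin d) (QS S)))
      ⟨1, by rw [one_mul]; exact Matrix.transpose_one⟩ Function.injective_id
    filter_upwards [h3] with x hx
    have : minor id (tupleMul (matOfParam x) (1 : Matrix (Fin d) (Fin d) (QS S))) =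
        (matOfParam x).det := by
      refine congrArg Matrix.det ?_
      ext1 l i
      have : (1 : Matrix (Fin d) (Fin d) (QS S)) i = Pi.single i 1 := by
        ext1 j
        simp [Matrix.one_apply, Pi.single_apply, eq_comm]
      simp [tupleMul, this]
    rwa [this] at hx
  obtain ⟨x, hx1, hx2⟩ := (h1.and h2).exists
  -- rescale one row of the matrix to get determinant one
  set τ := matOfParam x
  obtain ⟨δ, hδ⟩ := hx2
  set c : Fin d → QS S := Function.update 1 ⟨0, hd⟩ ((δ⁻¹ : (QS S)ˣ) : QS S) with hc
  have hcu : ∀ l, IsUnit (c l) := by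
    intro l
    rw [hc, Function.update_apply]
    split_ifs
    · exact (δ⁻¹).isUnit
    · exact isUnit_one
  have hdet : (Matrix.diagonal c * τ).det = 1 := by
    rw [Matrix.det_mul, Matrix.det_diagonal, hc, Finset.prod_update_of_mem (Finset.mem_univ _),
      ← hδ]
    simp
  have hpre : tupleMul (Matrix.diagonal c * τ) ⁻¹' Z = {w | tupleMul τ w ∈ Z} := by
    ext w
    have : tupleMul (Matrix.diagonal c * τ) w = tupleMul (Matrix.diagonal c) (tupleMul τ w) := by
      ext1 i
      exact (Matrix.mulVec_mulVec _ _ _).symm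
    simp only [hZ, Set.mem_preimage, Set.mem_ofPred_eq, this, minor_mul_diagonal, IsUnit.mul_iff,
      (IsUnit.prod_univ_iff (f := fun l => c (e l))).2 fun l => hcu _, true_and]
  have h4 : ν Z = ν {w | tupleMul τ w ∈ Z} := by
    conv_lhs => rw [← hinv _ hdet]
    rw [Measure.map_apply (continuous_tupleMul _).measurable hZc.measurableSet, hpre]
  change ν Z = 0
  rw [h4]
  exact hx1

/-- The tuple of vectors whose only nonzero row is the row `a`, with entries `z`. -/
noncomputable def rowTuple {d r : ℕ} (a : Fin d) (z : Fin r → QS S) : Fin r → Fin d → QS S :=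
  fun i => Pi.single a (z i)

/-- The rows `e` of a tuple of column vectors, as a square matrix. -/
def rowsMat {d r : ℕ} (e : Fin r → Fin d) (w : Fin r → Fin d → QS S) :
    Matrix (Fin r) (Fin r) (QS S) := Matrix.of fun l i => w i (e l)

theorem det_rowsMat {d r : ℕ} (e : Fin r → Fin d) (w : Fin r → Fin d → QS S) :
    (rowsMat e w).det = minor e w := rfl

theorem rowsMat_add_rowTuple {d r : ℕ} {e : Fin r → Fin d} {a : Fin d} (ha : ∀ l, e l ≠ a)
    (w : Fin r → Fin d → QS S) (z : Fin r → QS S) : rowsMat e (w + rowTuple a z) = rowsMat e w := by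
  ext1 l i
  simp [rowsMat, rowTuple, ha l]

theorem rowTuple_add {d r : ℕ} (a : Fin d) (z z' : Fin r → QS S) :
    rowTuple a (z + z') = rowTuple a z + rowTuple a z' := by
  funext i
  exact Pi.single_add _ _ _

/-- Adding to the row `a` a combination of the rows `e` is the action of a matrix in `SL_d`. -/
theorem exists_det_one_tupleMul_eq {d r : ℕ} {e : Fin r → Fin d} {a : Fin d} (ha : ∀ l, e l ≠ a)
    (t : Fin r → QS S) : ∃ h : Matrix (Fin d) (Fin d) (QS S), h.det = 1 ∧
      ∀ w, tupleMul h w = w + rowTuple a (t ᵥ* rowsMat e w) := by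
  set v : Fin d → QS S := ∑ l, t l • Pi.single (e l) 1 with hv
  refine ⟨1 + vecMulVec (Pi.single a 1) v, ?_, fun w => ?_⟩
  · rw [vecMulVec_eq Unit, det_one_add_replicateCol_mul_replicateRow]
    have : v a = 0 := by
      simp [hv, Finset.sum_apply, (ha _).symm]
    simp [this]
  · funext i
    have h1 : v ⬝ᵥ w i = (t ᵥ* rowsMat e w) i := by
      rw [hv, sum_dotProduct]
      refine Finset.sum_congr rfl fun l _ => ?_
      rw [smul_dotProduct, single_one_dotProduct]
      rfl
    change (1 + vecMulVec (Pi.single a 1) v) *ᵥ w i = w i + Pi.single a ((t ᵥ* rowsMat e w) i)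
    rw [add_mulVec, one_mulVec, vecMulVec_mulVec, h1]
    congr 1
    ext1 b
    by_cases hb : b = a
    · subst hb; simp
    · simp [hb]

/-- The inverse in `ℚ_S` taken at each place, with value `0` at the places where the component
vanishes. -/
noncomputable def placeInv (x : QS S) : QS S := (x.1⁻¹, fun p => (x.2 p)⁻¹)

theorem measurable_placeInv : Measurable (placeInv (S := S)) := by
  refine measurable_fst.inv.prodMk (measurable_pi_lambda _ fun p => ?_)
  exact ((measurable_pi_apply p).comp measurable_snd).inv

theorem mul_placeInv {x : QS S} (hx : IsUnit x) : x * placeInv x = 1 := by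
  rw [isUnit_iff_places] at hx
  exact Prod.ext (mul_inv_cancel₀ hx.1) (funext fun p => mul_inv_cancel₀ (hx.2 p))

theorem continuous_rowsMat {d r : ℕ} (e : Fin r → Fin d) : Continuous (rowsMat (S := S) e) :=
  continuous_matrix fun l i => (continuous_apply (e l)).comp (continuous_apply i)

theorem continuous_rowTuple {d r : ℕ} (a : Fin d) : Continuous (rowTuple (S := S) (r := r) a) :=
  continuous_pi fun i => (continuous_single a).comp (continuous_apply i)

/-- The coefficients that express `z` in the rows `e` of a tuple of column vectors. -/
noncomputable def rowCoeff {d r : ℕ} (e : Fin r → Fin d) (z : Fin r → QS S)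
    (w : Fin r → Fin d → QS S) : Fin r → QS S :=
  placeInv (minor e w) • (z ᵥ* (rowsMat e w).adjugate)

theorem rowCoeff_vecMul {d r : ℕ} {e : Fin r → Fin d} {z : Fin r → QS S}
    {w : Fin r → Fin d → QS S} (hw : IsUnit (minor e w)) :
    rowCoeff e z w ᵥ* rowsMat e w = z := by
  rw [rowCoeff, Matrix.smul_vecMul, Matrix.vecMul_vecMul, Matrix.adjugate_mul, Matrix.vecMul_smul,
    Matrix.vecMul_one, smul_smul, mul_comm, det_rowsMat, mul_placeInv hw, one_smul]

theorem measurable_rowCoeff {d r : ℕ} (e : Fin r → Fin d) (z : Fin r → QS S) :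
    Measurable (rowCoeff e z) := by
  refine measurable_pi_lambda _ fun i => ?_
  have h1 : Measurable fun w : Fin r → Fin d → QS S => (z ᵥ* (rowsMat e w).adjugate) i :=
    ((continuous_apply i).comp (continuous_const.matrix_vecMul
      (continuous_rowsMat e).matrix_adjugate)).measurable
  exact (measurable_placeInv.comp (continuous_minor e).measurable).mul h1

/-- An `SL_d`-invariant measure on tuples of full rank `r < d` is invariant under the translations
of one row. If `t` is an auxiliary variable with Haar measure, the shear
`(w, t) ↦ (w + t · (rows e), t)` preserves the product measure, and so does
`(w, t) ↦ (w, t + c(w))`; the commutator of the two is the translation of `w`. -/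
theorem map_add_rowTuple {d r : ℕ} (ν : Measure (Fin r → Fin d → QS S)) [SFinite ν]
    (hinv : ∀ h : Matrix (Fin d) (Fin d) (QS S), h.det = 1 → ν.map (tupleMul h) = ν)
    {e : Fin r → Fin d} {a : Fin d} (ha : ∀ l, e l ≠ a) (hu : ∀ᵐ w ∂ν, IsUnit (minor e w))
    (z : Fin r → QS S) : ν.map (fun w => w + rowTuple a z) = ν := by
  set κ : Measure (Fin r → QS S) := Measure.pi fun _ => muQS S with hκ
  have hcont : ∀ ε : QS S, Continuous fun y : (Fin r → QS S) × (Fin r → Fin d → QS S) =>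
      y.2 + rowTuple a ((ε • y.1) ᵥ* rowsMat e y.2) := fun ε => by
    refine continuous_snd.add ((continuous_rowTuple a).comp ?_)
    exact (continuous_fst.const_smul ε).matrix_vecMul ((continuous_rowsMat e).comp continuous_snd)
  have hshear : ∀ ε : QS S, MeasurePreserving
      (fun y : (Fin r → QS S) × (Fin r → Fin d → QS S) =>
        (y.1, y.2 + rowTuple a ((ε • y.1) ᵥ* rowsMat e y.2))) (κ.prod ν) (κ.prod ν) := by
    intro ε
    refine (MeasurePreserving.id κ).skew_product (g := fun t w =>
      w + rowTuple a ((ε • t) ᵥ* rowsMat e w)) ?_ ?_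
    · exact (hcont ε).measurable
    · refine Filter.Eventually.of_forall fun t => ?_
      obtain ⟨h, hdet, hh⟩ := exists_det_one_tupleMul_eq ha (ε • t)
      rw [show (fun w => w + rowTuple a ((ε • t) ᵥ* rowsMat e w)) = tupleMul h from
        (funext hh).symm, hinv h hdet]
  have hslide : ∀ z : Fin r → QS S, MeasurePreserving
      (fun y : (Fin r → QS S) × (Fin r → Fin d → QS S) => (rowCoeff e z y.2 + y.1, y.2))
      (κ.prod ν) (κ.prod ν) := by
    intro z
    have h1 : MeasurePreserving (fun y : (Fin r → Fin d → QS S) × (Fin r → QS S) =>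
        (y.1, rowCoeff e z y.1 + y.2)) (ν.prod κ) (ν.prod κ) := by
      refine (MeasurePreserving.id ν).skew_product (g := fun w t => rowCoeff e z w + t) ?_ ?_
      · exact ((measurable_rowCoeff e z).comp measurable_fst).add measurable_snd
      · exact Filter.Eventually.of_forall fun w => map_add_left_eq_self κ _
    exact (Measure.measurePreserving_swap.comp h1).comp Measure.measurePreserving_swap
  -- the commutator of the shear and of the translation of the coefficients
  have hcomp := (hslide (-z)).comp ((hshear 1).comp ((hslide z).comp (hshear (-1))))
  have hae : (fun y : (Fin r → QS S) × (Fin r → Fin d → QS S) => (y.1, y.2 + rowTuple a z))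
      =ᵐ[κ.prod ν] ((fun y => (rowCoeff e (-z) y.2 + y.1, y.2)) ∘ (fun y =>
        (y.1, y.2 + rowTuple a (((1 : QS S) • y.1) ᵥ* rowsMat e y.2))) ∘
        (fun y => (rowCoeff e z y.2 + y.1, y.2)) ∘ fun y =>
        (y.1, y.2 + rowTuple a (((-1 : QS S) • y.1) ᵥ* rowsMat e y.2))) := by
    have h1 : ∀ᵐ y ∂κ.prod ν, IsUnit (minor e (y : (Fin r → QS S) × (Fin r → Fin d → QS S)).2) :=
      Measure.quasiMeasurePreserving_snd.ae hu
    filter_upwards [h1] with y hy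
    obtain ⟨t, w⟩ := y
    have hR : ∀ z', rowsMat e (w + rowTuple a z') = rowsMat e w := rowsMat_add_rowTuple ha w
    have hm : ∀ z', minor e (w + rowTuple a z') = minor e w := fun z' => by
      rw [← det_rowsMat, hR, det_rowsMat]
    have hc : ∀ z₁ z', rowCoeff e z₁ (w + rowTuple a z') = rowCoeff e z₁ w := fun z₁ z' => by
      rw [rowCoeff, hR, hm, rowCoeff]
    have hneg : rowCoeff e (-z) w = -rowCoeff e z w := by
      rw [rowCoeff, rowCoeff, Matrix.neg_vecMul, smul_neg]
    simp only [Function.comp_apply, hc, hR, add_assoc, ← rowTuple_add, hneg, one_smul,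
      Matrix.add_vecMul, rowCoeff_vecMul hy, neg_one_smul, Matrix.neg_vecMul, neg_add_cancel_left]
    congr 3
    abel
  have hmeas : Measurable fun w : Fin r → Fin d → QS S => w + rowTuple a z :=
    (continuous_id.add continuous_const).measurable
  have hfin : (κ.prod ν).map (fun y => (y.1, y.2 + rowTuple a z)) = κ.prod ν := by
    rw [Measure.map_congr hae]
    exact hcomp.map_eq
  -- test the product measure on rectangles
  ext A hA
  obtain ⟨K⟩ : Nonempty (TopologicalSpace.PositiveCompacts (Fin r → QS S)) := inferInstance
  have hK0 : κ K ≠ 0 := (Measure.measure_pos_of_nonempty_interior κ K.interior_nonempty).ne'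
  have hK1 : κ K ≠ ⊤ := K.isCompact.measure_lt_top.ne
  have h2 := congrArg (fun m => m ((K : Set (Fin r → QS S)) ×ˢ A)) hfin
  have hmeas' : Measurable fun y : (Fin r → QS S) × (Fin r → Fin d → QS S) =>
      (y.1, y.2 + rowTuple a z) := measurable_fst.prodMk (hmeas.comp measurable_snd)
  rw [Measure.map_apply hmeas' (K.isCompact.measurableSet.prod hA)] at h2
  have h3 : (fun y : (Fin r → QS S) × (Fin r → Fin d → QS S) => (y.1, y.2 + rowTuple a z)) ⁻¹'
      ((K : Set (Fin r → QS S)) ×ˢ A) = (K : Set (Fin r → QS S)) ×ˢ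
        ((fun w => w + rowTuple a z) ⁻¹' A) := rfl
  rw [h3, Measure.prod_prod, Measure.prod_prod] at h2
  rw [Measure.map_apply hmeas hA]
  exact (ENNReal.mul_right_inj hK0 hK1).1 h2

/-- **Uniqueness.** An `SL_d(ℚ_S)`-invariant measure on `(ℚ_S^d)^r`, `r < d`, that is carried by
the tuples of full rank and gives finite measure to some nonempty open set is a multiple of Haar
measure. -/
theorem exists_eq_smul_muVec {d r : ℕ} (hr : r < d) (ν : Measure (Fin r → Fin d → QS S)) [SFinite ν]
    (hinv : ∀ h : Matrix (Fin d) (Fin d) (QS S), h.det = 1 → ν.map (tupleMul h) = ν)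
    (hfull : ∀ᵐ w ∂ν, ∃ σ : Matrix (Fin r) (Fin d) (QS S), σ * (Matrix.of w)ᵀ = 1)
    (hfin : ∃ U : Set (Fin r → Fin d → QS S), IsOpen U ∧ U.Nonempty ∧ ν U ≠ ⊤) :
    ∃ c : NNReal, ν = c • muVec S d r := by
  have hrow : ∀ (a : Fin d) (z : Fin r → QS S), ν.map (fun w => w + rowTuple a z) = ν := by
    intro a z
    obtain ⟨d, rfl⟩ : ∃ d', d = d' + 1 := ⟨d - 1, by omega⟩
    let e : Fin r → Fin (d + 1) := fun l => a.succAbove (Fin.castLE (by omega) l)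
    have he : Function.Injective e :=
      Fin.succAbove_right_injective.comp (Fin.castLE_injective _)
    exact map_add_rowTuple ν hinv (e := e) (fun l => Fin.succAbove_ne _ _)
      (ae_isUnit_minor (Nat.succ_pos d) ν hinv hfull he) z
  -- a translation is a composition of translations of single rows
  have htrans : ∀ u : Fin r → Fin d → QS S, ν.map (fun w => u + w) = ν := by
    intro u
    have h1 : ∀ s : Finset (Fin d),
        ν.map (fun w => (∑ a ∈ s, rowTuple a fun i => u i a) + w) = ν := by
      intro s
      induction s using Finset.induction_on with
      | empty => simp
      | insert a s ha ih =>
        have h2 : (fun w => (∑ b ∈ insert a s, rowTuple b fun i => u i b) + w) =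
            (fun w => w + rowTuple a fun i => u i a) ∘
              fun w => (∑ b ∈ s, rowTuple b fun i => u i b) + w := by
          funext w
          rw [Finset.sum_insert ha, Function.comp_apply]
          abel
        rw [h2, ← Measure.map_map (by fun_prop) (by fun_prop), ih, hrow]
    have h3 : ∑ a, rowTuple a (fun i => u i a) = u := by
      funext i
      rw [Finset.sum_apply]
      exact Finset.univ_sum_single (u i)
    have h4 := h1 Finset.univ
    rwa [h3] at h4
  have hI : ν.IsAddLeftInvariant := ⟨htrans⟩
  obtain ⟨U, hUo, ⟨u₀, hu₀⟩, hUfin⟩ := hfin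
  have hloc : IsLocallyFiniteMeasure ν := by
    refine ⟨fun x => ⟨(fun w => (u₀ - x) + w) ⁻¹' U, ?_, ?_⟩⟩
    · exact (hUo.preimage (by fun_prop)).mem_nhds (by simpa using hu₀)
    · rw [measure_preimage_add]
      exact hUfin.lt_top
  exact ⟨_, Measure.isAddLeftInvariant_eq_smul ν (muVec S d r)⟩

/-! ### A measurable choice of bases, and the measures counting lattice tuples -/

/-- A tuple of vectors with `S`-integral coordinates, as a tuple of vectors over `ℚ_S`. -/
noncomputable def intTuple {d r : ℕ} (Y : Fin r → Fin d → SInt S) : Fin r → Fin d → QS S :=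
  fun i j => toQS S (Y i j)

theorem exists_det_one_of_mem_arith {d : ℕ} {G : Subgroup (GL (Fin d) (QS S))} (hG : G ≤ ULQ d S)
    {γ : G} (hγ : γ ∈ arith G) : ∃ M : Matrix (Fin d) (Fin d) (SInt S), M.det = 1 ∧
      M.map (toQS S) = (γ : GL (Fin d) (QS S)).1 := by
  choose M hM using fun i j => mem_ZS_iff.1 (hγ.1 i j)
  have hMγ : (Matrix.of M).map (toQS S) = (γ : GL (Fin d) (QS S)).1 := by
    ext1 i j
    exact hM i j
  refine ⟨Matrix.of M, ?_, hMγ⟩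
  have h1 := (hG γ.2).1
  rw [← hMγ, det_toQS, toQS_fst] at h1
  exact Subtype.ext (by exact_mod_cast h1)

theorem continuous_coe_matrix {d : ℕ} (G : Subgroup (GL (Fin d) (QS S))) :
    Continuous fun g : G => (g : GL (Fin d) (QS S)).1 :=
  Units.continuous_val.comp continuous_subtype_val

/-- The matrices that are close to the identity at all places. -/
def nearOne (S : Finset PrimeNum) (d : ℕ) : Set (Matrix (Fin d) (Fin d) (QS S)) :=
  {M | ∀ i j, |((M - 1) i j).1| < 1 ∧ (M - 1) i j ∈ OS S}

theorem isOpen_OS : IsOpen (OS S : Set (QS S)) := by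
  have h : (OS S : Set (QS S)) = ⋂ p : S, (fun x : QS S => x.2 p) ⁻¹' Metric.closedBall 0 1 := by
    ext x
    simp [mem_OS]
  rw [h]
  refine isOpen_iInter_of_finite fun p => ?_
  exact (IsUltrametricDist.isOpen_closedBall (0 : ℚ_[p.1.1]) one_ne_zero).preimage
    ((continuous_apply p).comp continuous_snd)

theorem isOpen_nearOne (d : ℕ) : IsOpen (nearOne S d) := by
  have h1 : ∀ i j, Continuous fun M : Matrix (Fin d) (Fin d) (QS S) => (M - 1) i j := fun i j =>
    (continuous_id.sub continuous_const).matrix_elem i j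
  have h2 : nearOne S d = ⋂ i, ⋂ j,
      ((fun M : Matrix (Fin d) (Fin d) (QS S) => |((M - 1) i j).1|) ⁻¹' Set.Iio 1 ∩
        (fun M : Matrix (Fin d) (Fin d) (QS S) => (M - 1) i j) ⁻¹' (OS S : Set (QS S))) := by
    ext M
    simp only [nearOne, Set.mem_ofPred_eq, Set.mem_iInter, Set.mem_inter_iff, Set.mem_preimage,
      Set.mem_Iio, SetLike.mem_coe]
  rw [h2]
  exact isOpen_iInter_of_finite fun i => isOpen_iInter_of_finite fun j =>
    (isOpen_Iio.preimage (h1 i j).fst.abs).inter (isOpen_OS.preimage (h1 i j))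

theorem eq_one_of_mem_nearOne {d : ℕ} {M : Matrix (Fin d) (Fin d) (QS S)}
    (hM : ∀ i j, M i j ∈ ZS S) (hN : M ∈ nearOne S d) : M = 1 := by
  ext1 i j
  obtain ⟨h1, h2⟩ := hN i j
  obtain ⟨z, hz⟩ := mem_ZS_iff.1 (hM i j)
  have h3 : (M - 1) i j = toQS S (z - (1 : Matrix (Fin d) (Fin d) (SInt S)) i j) := by
    rw [map_sub, hz, Matrix.sub_apply, Matrix.one_apply, Matrix.one_apply]
    split_ifs <;> simp
  rw [h3] at h1 h2
  obtain ⟨n, hn⟩ := exists_int_of_mem_OS h2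
  have h4 : |(n : ℝ)| < 1 := by
    rw [hn, map_intCast] at h1
    exact h1
  have h5 : n = 0 := by
    rw [← Int.cast_abs] at h4
    exact Int.abs_lt_one_iff.1 (by exact_mod_cast h4)
  rw [h5, Int.cast_zero] at hn
  rw [hn, map_zero, Matrix.sub_apply, sub_eq_zero] at h3
  exact h3

theorem exists_nhds_inv_mul_subset {H : Type*} [Group H] [TopologicalSpace H]
    [IsTopologicalGroup H] {N : Set H} (hN : N ∈ nhds (1 : H)) :
    ∃ V : Set H, IsOpen V ∧ 1 ∈ V ∧ ∀ a ∈ V, ∀ b ∈ V, a⁻¹ * b ∈ N := by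
  have hc : Continuous fun y : H × H => y.1⁻¹ * y.2 := continuous_fst.inv.mul continuous_snd
  have hpre : (fun y : H × H => y.1⁻¹ * y.2) ⁻¹' N ∈ nhds ((1 : H), (1 : H)) :=
    hc.continuousAt.preimage_mem_nhds (by simpa using hN)
  obtain ⟨V, V', hV, h1V, hV', h1V', hVV⟩ := mem_nhds_prod_iff'.1 hpre
  exact ⟨V ∩ V', hV.inter hV', ⟨h1V, h1V'⟩, fun a ha b hb => hVV (Set.mk_mem_prod ha.1 hb.2)⟩

instance isTopologicalGroup_GL (d : ℕ) : IsTopologicalGroup (GL (Fin d) (QS S)) := inferInstance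

instance secondCountableTopology_GL (d : ℕ) : SecondCountableTopology (GL (Fin d) (QS S)) := by
  have h : SecondCountableTopology (Matrix (Fin d) (Fin d) (QS S)) :=
    inferInstanceAs (SecondCountableTopology (Fin d → Fin d → QS S))
  have h' : SecondCountableTopology (Matrix (Fin d) (Fin d) (QS S))ᵐᵒᵖ :=
    MulOpposite.opHomeomorph.symm.isInducing.secondCountableTopology
  exact Units.isEmbedding_embedProduct.isInducing.secondCountableTopology

instance secondCountableTopology_space {d : ℕ} (G : Subgroup (GL (Fin d) (QS S))) :
    SecondCountableTopology (Space G) :=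
  have : SecondCountableTopology G := Topology.IsInducing.subtypeVal.secondCountableTopology
  QuotientGroup.instSecondCountableTopology _

/-- The arithmetic group is discrete. -/
theorem exists_nhds_one_inv_mul_eq {d : ℕ} (G : Subgroup (GL (Fin d) (QS S))) :
    ∃ V : Set G, IsOpen V ∧ 1 ∈ V ∧ ∀ a ∈ V, ∀ b ∈ V, a⁻¹ * b ∈ arith G → a = b := by
  have h1 : (1 : Matrix (Fin d) (Fin d) (QS S)) ∈ nearOne S d := fun i j => by
    simp [zero_mem]
  obtain ⟨V, hV, h1V, hVV⟩ := exists_nhds_inv_mul_subset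
    (((isOpen_nearOne d).preimage (continuous_coe_matrix G)).mem_nhds (x := 1) h1)
  refine ⟨V, hV, h1V, fun a ha b hb hab => ?_⟩
  exact inv_mul_eq_one.1 (Subtype.ext (Units.ext (eq_one_of_mem_nearOne hab.1 (hVV a ha b hb))))

instance countable_SInt : Countable (SInt S) := Subtype.countable

instance countable_intTuples (d r : ℕ) : Countable (Fin r → Fin d → SInt S) := inferInstance

/-- A Borel measurable section of `G → G/Γ`. -/
structure IsSection {d : ℕ} {G : Subgroup (GL (Fin d) (QS S))} [MeasurableSpace (Space G)]
    (s : Space G → G) : Prop where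
  mk_eq : ∀ x, (QuotientGroup.mk (s x) : Space G) = x
  measurable : Measurable fun x (i j : Fin d) => (s x : GL (Fin d) (QS S)).1 i j

/-- As the arithmetic group is discrete, `G → G/Γ` is injective on small open sets; the section is
patched together from the local inverses on a countable cover. -/
theorem exists_measurable_section {d : ℕ} (G : Subgroup (GL (Fin d) (QS S)))
    [MeasurableSpace (Space G)] [BorelSpace (Space G)] :
    ∃ s : Space G → G, IsSection s := by
  obtain ⟨V, hVo, h1V, hV⟩ := exists_nhds_one_inv_mul_eq G
  let W : G → Set G := fun g => (fun a => g⁻¹ * a) ⁻¹' V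
  have hWo : ∀ g, IsOpen (W g) := fun g => hVo.preimage (continuous_const.mul continuous_id)
  have hW : ∀ g, ∀ a ∈ W g, ∀ b ∈ W g, (QuotientGroup.mk a : Space G) = QuotientGroup.mk b →
      a = b := fun g a ha b hb hab => by
    have h1 : a⁻¹ * b ∈ arith G := QuotientGroup.eq.1 hab
    have h2 : (g⁻¹ * a)⁻¹ * (g⁻¹ * b) = a⁻¹ * b := by
      rw [_root_.mul_inv_rev, inv_inv, mul_assoc, mul_inv_cancel_left]
    have h3 : (g⁻¹ * a)⁻¹ * (g⁻¹ * b) ∈ arith G := by rw [h2]; exact h1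
    exact mul_left_cancel (hV _ ha _ hb h3)
  let O : G → Set (Space G) := fun g => QuotientGroup.mk '' W g
  have hO : ∀ g, IsOpen (O g) := fun g => QuotientGroup.isOpenMap_coe _ (hWo g)
  obtain ⟨T, hTc, hT⟩ := TopologicalSpace.countable_cover_nhds (α := Space G)
    (f := fun x => O x.out) fun x => (hO _).mem_nhds
      ⟨x.out, by
        change x.out⁻¹ * x.out ∈ V
        rwa [inv_mul_cancel], Quotient.out_eq' x⟩
  have hTne : T.Nonempty := by
    by_contra h
    rw [Set.not_nonempty_iff_eq_empty] at h
    have h2 : (QuotientGroup.mk (1 : G) : Space G) ∈ (Set.univ : Set (Space G)) := Set.mem_univ _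
    rw [← hT, h, Set.biUnion_empty] at h2
    exact h2
  obtain ⟨t, rfl⟩ := hTc.exists_eq_range hTne
  have hcov : ∀ x, ∃ n, x ∈ O (t n).out := by
    intro x
    have h2 : x ∈ (Set.univ : Set (Space G)) := Set.mem_univ _
    rw [← hT] at h2
    simpa using h2
  classical
  let N : Space G → ℕ := fun x => Nat.find (hcov x)
  have hN : ∀ x, x ∈ O (t (N x)).out := fun x => Nat.find_spec (hcov x)
  choose s hs1 hs2 using hN
  -- the section on `{N = n}` is the local inverse on the `n`-th open set
  have hNm : ∀ n, MeasurableSet {x | N x = n} := by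
    intro n
    have : {x | N x = n} = O (t n).out \ ⋃ k ∈ Finset.range n, O (t k).out := by
      ext x
      simp [N, Nat.find_eq_iff]
    rw [this]
    exact (hO _).measurableSet.diff (Finset.measurableSet_biUnion _ fun k _ => (hO _).measurableSet)
  refine ⟨s, hs2, ?_⟩
  refine measurable_of_isOpen fun U hU => ?_
  have hU' : IsOpen {g : G | (fun i j => (g : GL (Fin d) (QS S)).1 i j) ∈ U} :=
    hU.preimage (continuous_coe_matrix G)
  have hpre : (fun x (i j : Fin d) => (s x : GL (Fin d) (QS S)).1 i j) ⁻¹' U =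
      ⋃ n, {x | N x = n} ∩ QuotientGroup.mk '' (W (t n).out ∩
        {g : G | (fun i j => (g : GL (Fin d) (QS S)).1 i j) ∈ U}) := by
    ext x
    simp only [Set.mem_preimage, Set.mem_iUnion, Set.mem_inter_iff, Set.mem_ofPred_eq,
      exists_eq_left']
    constructor
    · exact fun h => ⟨s x, ⟨hs1 x, h⟩, hs2 x⟩
    · rintro ⟨g, ⟨hg1, hg2⟩, hg3⟩
      rwa [hW _ _ (hs1 x) g hg1 ((hs2 x).trans hg3.symm)]
  rw [hpre]
  refine MeasurableSet.iUnion fun n => (hNm n).inter ?_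
  exact (QuotientGroup.isOpenMap_coe _ ((hWo _).inter hU')).measurableSet

/-- A set of tuples of `S`-integral vectors that is stable under `SL_d(ℤ_S)`. -/
def IsStable {d r : ℕ} (𝒴 : Set (Fin r → Fin d → SInt S)) : Prop :=
  ∀ γ : Matrix (Fin d) (Fin d) (SInt S), γ.det = 1 → ∀ Y ∈ 𝒴, (fun i => γ *ᵥ Y i) ∈ 𝒴

/-- The sum of `F` over the tuples `g Y`, `Y ∈ 𝒴`. -/
noncomputable def orbitSum {d r : ℕ} (𝒴 : Set (Fin r → Fin d → SInt S))
    (F : (Fin r → Fin d → QS S) → ENNReal) (g : Matrix (Fin d) (Fin d) (QS S)) : ENNReal :=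
  ∑' Y : 𝒴, F (tupleMul g (intTuple Y.1))

theorem tupleMul_mul {d r : ℕ} (g h : Matrix (Fin d) (Fin d) (QS S)) (w : Fin r → Fin d → QS S) :
    tupleMul (g * h) w = tupleMul g (tupleMul h w) :=
  funext fun _ => (Matrix.mulVec_mulVec _ _ _).symm

theorem tupleMul_map_intTuple {d r : ℕ} (γ : Matrix (Fin d) (Fin d) (SInt S))
    (Y : Fin r → Fin d → SInt S) :
    tupleMul (γ.map (toQS S)) (intTuple Y) = intTuple fun i => γ *ᵥ Y i := by
  funext i j
  exact (RingHom.map_mulVec (toQS S) γ (Y i) j).symm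

/-- The sum over a stable set of tuples depends only on the lattice. -/
theorem orbitSum_mul {d r : ℕ} {𝒴 : Set (Fin r → Fin d → SInt S)} (h𝒴 : IsStable 𝒴)
    (F : (Fin r → Fin d → QS S) → ENNReal) (g : Matrix (Fin d) (Fin d) (QS S))
    {γ : Matrix (Fin d) (Fin d) (SInt S)} (hγ : γ.det = 1) :
    orbitSum 𝒴 F (g * γ.map (toQS S)) = orbitSum 𝒴 F g := by
  have hγ' : γ.adjugate.det = 1 := by rw [Matrix.det_adjugate, hγ, one_pow]
  have h1 : γ * γ.adjugate = 1 := by rw [Matrix.mul_adjugate, hγ, one_smul]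
  have h2 : γ.adjugate * γ = 1 := by rw [Matrix.adjugate_mul, hγ, one_smul]
  let E : 𝒴 ≃ 𝒴 :=
    { toFun := fun Y => ⟨_, h𝒴 γ hγ Y.1 Y.2⟩
      invFun := fun Y => ⟨_, h𝒴 γ.adjugate hγ' Y.1 Y.2⟩
      left_inv := fun Y => Subtype.ext (by simp [Matrix.mulVec_mulVec, h2])
      right_inv := fun Y => Subtype.ext (by simp [Matrix.mulVec_mulVec, h1]) }
  rw [orbitSum, orbitSum, ← E.tsum_eq fun Y : 𝒴 => F (tupleMul g (intTuple Y.1))]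
  refine tsum_congr fun Y => ?_
  rw [tupleMul_mul, tupleMul_map_intTuple]
  rfl

section LatticeMeasure

variable {d r : ℕ} {G : Subgroup (GL (Fin d) (QS S))} [MeasurableSpace (Space G)]

/-- The measure `A ↦ ∫ #{Y ∈ 𝒴 : g Y ∈ A} dm(gΓ)`, where `g = s (gΓ)`. -/
noncomputable def tupleMeasure (m : Measure (Space G)) (s : Space G → G)
    (𝒴 : Set (Fin r → Fin d → SInt S)) : Measure (Fin r → Fin d → QS S) :=
  Measure.sum fun Y : 𝒴 => m.map fun x => tupleMul (s x : GL (Fin d) (QS S)).1 (intTuple Y.1)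

theorem sFinite_sum_map {α β ι : Type*} [MeasurableSpace α] [MeasurableSpace β] [Countable ι]
    (m : Measure α) [IsFiniteMeasure m] (f : ι → α → β) :
    SFinite (Measure.sum fun i => m.map (f i)) := by
  have h : ∀ i, SFinite (m.map (f i)) := fun i => by
    have := Measure.isFiniteMeasure_map m (f i)
    infer_instance
  infer_instance

instance sFinite_tupleMeasure (m : Measure (Space G)) [IsFiniteMeasure m] (s : Space G → G)
    (𝒴 : Set (Fin r → Fin d → SInt S)) : SFinite (tupleMeasure m s 𝒴) :=
  sFinite_sum_map m fun (Y : 𝒴) x => tupleMul (s x : GL (Fin d) (QS S)).1 (intTuple Y.1)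

theorem measurable_tupleMul_section {s : Space G → G}
    (hs : IsSection s)
    (w : Fin r → Fin d → QS S) :
    Measurable fun x => tupleMul (s x : GL (Fin d) (QS S)).1 w := by
  have h : Continuous fun M : Fin d → Fin d → QS S => tupleMul (Matrix.of M) w :=
    continuous_pi fun i => Continuous.matrix_mulVec continuous_id continuous_const
  exact h.measurable.comp hs.measurable

theorem lintegral_tupleMeasure {m : Measure (Space G)} {s : Space G → G}
    (hs : IsSection s)
    (𝒴 : Set (Fin r → Fin d → SInt S)) {F : (Fin r → Fin d → QS S) → ENNReal} (hF : Measurable F) :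
    ∫⁻ w, F w ∂tupleMeasure m s 𝒴 = ∫⁻ x, orbitSum 𝒴 F (s x : GL (Fin d) (QS S)).1 ∂m := by
  rw [tupleMeasure, lintegral_sum_measure]
  simp only [orbitSum]
  rw [lintegral_tsum (f := fun (Y : 𝒴) x => F (tupleMul (s x : GL (Fin d) (QS S)).1
    (intTuple Y.1))) fun Y => (hF.comp (measurable_tupleMul_section hs _)).aemeasurable]
  exact tsum_congr fun Y => lintegral_map hF (measurable_tupleMul_section hs _)

theorem measurable_orbitSum_section {s : Space G → G}
    (hs : IsSection s)
    (𝒴 : Set (Fin r → Fin d → SInt S)) {F : (Fin r → Fin d → QS S) → ENNReal} (hF : Measurable F) :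
    Measurable fun x => orbitSum 𝒴 F (s x : GL (Fin d) (QS S)).1 :=
  Measurable.tsum fun _ => hF.comp (measurable_tupleMul_section hs _)

theorem orbitSum_section_eq (hUL : G ≤ ULQ d S) {s : Space G → G}
    (hs : IsSection s)
    {𝒴 : Set (Fin r → Fin d → SInt S)} (h𝒴 : IsStable 𝒴)
    (F : (Fin r → Fin d → QS S) → ENNReal) (g : G) :
    orbitSum 𝒴 F (s (QuotientGroup.mk g) : GL (Fin d) (QS S)).1 =
      orbitSum 𝒴 F (g : GL (Fin d) (QS S)).1 := by
  have h1 : g⁻¹ * s (QuotientGroup.mk g) ∈ arith G := QuotientGroup.eq.1 (hs.mk_eq _).symm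
  obtain ⟨γ, hγ, hγ'⟩ := exists_det_one_of_mem_arith hUL h1
  rw [← orbitSum_mul h𝒴 F (g : GL (Fin d) (QS S)).1 hγ, hγ', ← Units.val_mul, ← Subgroup.coe_mul,
    mul_inv_cancel_left]

/-- The invariance of `dg` makes the counting measure invariant under `SL_d(ℚ_S)`. -/
theorem map_tupleMul_tupleMeasure [BorelSpace (Space G)] (hUL : G ≤ ULQ d S) (hSL : SLQ d S ≤ G)
    (m : Measure (Space G)) [SMulInvariantMeasure G (Space G) m] {s : Space G → G}
    (hs : IsSection s)
    {𝒴 : Set (Fin r → Fin d → SInt S)} (h𝒴 : IsStable 𝒴) (h : Matrix (Fin d) (Fin d) (QS S))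
    (hh : h.det = 1) : (tupleMeasure m s 𝒴).map (tupleMul h) = tupleMeasure m s 𝒴 := by
  let h' : GL (Fin d) (QS S) := Matrix.GeneralLinearGroup.mk'' h (by rw [hh]; exact isUnit_one)
  have hh' : h' ∈ SLQ d S := hh
  let h₀ : G := ⟨h', hSL hh'⟩
  refine Measure.ext_of_lintegral _ fun F hF => ?_
  rw [lintegral_map hF (continuous_tupleMul h).measurable,
    lintegral_tupleMeasure hs 𝒴 (F := fun w => F (tupleMul h w))
      (hF.comp (continuous_tupleMul h).measurable),
    lintegral_tupleMeasure hs 𝒴 hF]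
  have hmeas : Measurable fun x : Space G => h₀ • x :=
    (continuous_const_smul h₀).measurable
  have hmp : MeasurePreserving (fun x : Space G => h₀ • x) m m :=
    ⟨hmeas, by
      ext A hA
      rw [Measure.map_apply hmeas hA]
      exact SMulInvariantMeasure.measure_preimage_smul h₀ hA⟩
  rw [← hmp.lintegral_comp (measurable_orbitSum_section hs 𝒴 hF)]
  refine lintegral_congr fun x => ?_
  have h1 : h₀ • x = (QuotientGroup.mk (h₀ * s x) : Space G) := by
    conv_lhs => rw [← hs.mk_eq x]
    rfl
  rw [h1, orbitSum_section_eq hUL hs h𝒴]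
  simp only [orbitSum]
  refine tsum_congr fun Y => ?_
  rw [Subgroup.coe_mul, Units.val_mul, tupleMul_mul]
  rfl

end LatticeMeasure

/-! ### Completing a primitive tuple by a short vector -/

/-- The vectors whose coordinates are bounded by `R` at the real place and integral at the finite
places. -/
def box (S : Finset PrimeNum) (n : ℕ) (R : ℝ) : Set (Fin n → QS S) :=
  {x | ∀ i, |(x i).1| ≤ R ∧ x i ∈ OS S}

theorem box_mono {n : ℕ} {R R' : ℝ} (h : R ≤ R') : box S n R ⊆ box S n R' :=
  fun _ hx i => ⟨(hx i).1.trans h, (hx i).2⟩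

theorem box_eq_pi (n : ℕ) (R : ℝ) : box S n R = Set.pi Set.univ fun _ =>
    Set.Icc (-R) R ×ˢ Set.pi Set.univ fun p : S => Metric.closedBall (0 : ℚ_[p.1.1]) 1 := by
  ext x
  simp [box, mem_OS, abs_le, Set.mem_pi]

theorem isCompact_box (n : ℕ) (R : ℝ) : IsCompact (box S n R) := by
  rw [box_eq_pi]
  exact isCompact_univ_pi fun _ => isCompact_Icc.prod
    (isCompact_univ_pi fun p => isCompact_closedBall _ _)

theorem mulVec_mem_box {m n : ℕ} {A : Matrix (Fin m) (Fin n) (QS S)} {x : Fin n → QS S} {B C : ℝ}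
    (hA : ∀ i j, |(A i j).1| ≤ B ∧ A i j ∈ OS S) (hx : x ∈ box S n C) :
    A *ᵥ x ∈ box S m (n * (B * C)) := fun i =>
  ⟨abs_mulVec_fst_le (fun i j => (hA i j).1) (fun j => (hx j).1) i,
    mulVec_mem_OS (fun i j => (hA i j).2) (fun j => (hx j).2) i⟩

theorem IsSiegel.det_fst {n : ℕ} {T : Matrix (Fin n) (Fin n) (QS S)} (hT : IsSiegel T) :
    (T.det).1 = ∏ i, (T i i).1 := by
  rw [Matrix.det_of_isUpperTriangular fun i j h => hT.lower i j h]
  exact map_prod (atReal S) _ _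

/-- The first diagonal entry is the smallest one up to a constant, so that the determinant bounds
it. -/
theorem IsSiegel.diag_zero_le {n : ℕ} {T : Matrix (Fin (n + 1)) (Fin (n + 1)) (QS S)}
    (hT : IsSiegel T) {C : ℝ} (h1C : 1 ≤ C) (hC : (T.det).1 ≤ C) :
    (T 0 0).1 ≤ 2 ^ ((n + 1) * (n + 1)) * C := by
  have h1 : (T 0 0).1 ^ (n + 1) ≤ 2 ^ ((n + 1) * (n + 1)) * C := by
    calc (T 0 0).1 ^ (n + 1) = ∏ _i : Fin (n + 1), (T 0 0).1 := by simp
      _ ≤ ∏ i : Fin (n + 1), 2 ^ (n + 1) * (T i i).1 :=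
        Finset.prod_le_prod (fun _ _ => (hT.pos 0).le) fun i _ => hT.diag_le 0 i (Fin.zero_le i)
      _ = 2 ^ ((n + 1) * (n + 1)) * (T.det).1 := by
        rw [Finset.prod_mul_distrib, hT.det_fst]; simp [pow_mul]
      _ ≤ _ := by gcongr
  rcases le_total (T 0 0).1 1 with h | h
  · exact h.trans (one_le_mul_of_one_le_of_one_le (one_le_pow₀ one_le_two) h1C)
  · exact (le_self_pow₀ h (Nat.succ_ne_zero n)).trans h1

/-- A lattice of bounded covolume has a basis with a first vector of bounded length. -/
theorem exists_det_one_col_mem_box {n : ℕ} {g : Matrix (Fin (n + 1)) (Fin (n + 1)) (QS S)}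
    (h0 : (g.det).1 ≠ 0) (hp : ∀ p, ‖(g.det).2 p‖ = 1) {C : ℝ} (h1C : 1 ≤ C)
    (hC : |(g.det).1| ≤ C) : ∃ δ : Matrix (Fin (n + 1)) (Fin (n + 1)) (SInt S), δ.det = 1 ∧
      (g *ᵥ fun i => toQS S (δ i 0)) ∈ box S (n + 1) (2 ^ ((n + 1) * (n + 1)) * C) := by
  obtain ⟨k, δ, hk, hδ, hT⟩ := exists_isSiegel (n + 1) g h0 hp
  set T := k * g * δ.map (toQS S) with hTdef
  refine ⟨δ, hδ, ?_⟩
  have hdet : (T.det).1 ≤ C := by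
    refine (le_abs_self _).trans ?_
    rw [hTdef, Matrix.det_mul, Matrix.det_mul, det_toQS, hδ, map_one, mul_one, Prod.fst_mul, abs_mul,
      hk.abs_det, one_mul]
    exact hC
  have h1 := hT.diag_zero_le h1C hdet
  have hcol : k *ᵥ (g *ᵥ fun i => toQS S (δ i 0)) = Pi.single 0 (T 0 0) := by
    have h2 : k *ᵥ (g *ᵥ fun i => toQS S (δ i 0)) = fun i => T i 0 := by
      rw [Matrix.mulVec_mulVec]; rfl
    rw [h2]
    funext i
    rcases eq_or_ne i 0 with rfl | hi
    · simp
    · rw [Pi.single_eq_of_ne hi, hT.lower i 0 (Fin.pos_iff_ne_zero.2 hi)]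
  have h3 : realNormSq (g *ᵥ fun i => toQS S (δ i 0)) = (T 0 0).1 ^ 2 := by
    rw [← hk.realNormSq_mulVec, hcol, realNormSq, Finset.sum_eq_single 0]
    · simp
    · intro i _ hi; simp [hi]
    · simp
  intro i
  refine ⟨(abs_le_of_realNormSq_le (hT.pos 0).le h3.le i).trans h1, ?_⟩
  refine (hk.mulVec_mem_iff.1 fun i => ?_) i
  rw [hcol]
  rcases eq_or_ne i 0 with rfl | hi
  · simpa using hT.mem_OS 0 0
  · simp [hi, zero_mem]

/-- The tuples that consist of the first `r` columns of a matrix in `SL_d(ℤ_S)`. -/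
def primitiveTuples (S : Finset PrimeNum) {d r : ℕ} (h : r ≤ d) : Set (Fin r → Fin d → SInt S) :=
  {Y | ∃ γ : Matrix (Fin d) (Fin d) (SInt S), γ.det = 1 ∧ ∀ i j, Y i j = γ j (Fin.castLE h i)}

theorem isStable_primitiveTuples {d r : ℕ} (h : r ≤ d) : IsStable (primitiveTuples S h) := by
  rintro γ hγ Y ⟨δ, hδ, hY⟩
  refine ⟨γ * δ, by rw [Matrix.det_mul, hγ, hδ, one_mul], fun i j => ?_⟩
  simp only [Matrix.mulVec, dotProduct, Matrix.mul_apply, hY]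

theorem exists_leftInverse_of_mem_primitiveTuples {d r : ℕ} (h : r ≤ d)
    {Y : Fin r → Fin d → SInt S} (hY : Y ∈ primitiveTuples S h) :
    ∃ σ : Matrix (Fin r) (Fin d) (SInt S), σ * (Matrix.of Y)ᵀ = 1 := by
  obtain ⟨γ, hγ, hY⟩ := hY
  refine ⟨γ.adjugate.submatrix (Fin.castLE h) id, ?_⟩
  have h1 : γ.adjugate * γ = 1 := by rw [Matrix.adjugate_mul, hγ, one_smul]
  ext1 i j
  have h2 := congrFun (congrFun h1 (Fin.castLE h i)) (Fin.castLE h j)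
  rw [Matrix.mul_apply] at h2 ⊢
  simp only [Matrix.submatrix_apply, id, Matrix.transpose_apply, Matrix.of_apply, hY]
  rw [h2, Matrix.one_apply, Matrix.one_apply]
  simp

/-- The matrix with first columns `w` and with standard unit vectors as further columns. -/
noncomputable def complete {r n : ℕ} (w : Fin r → Fin (r + n) → QS S) :
    Matrix (Fin (r + n)) (Fin (r + n)) (QS S) :=
  Matrix.of fun i => Fin.addCases (fun l => w l i)
    fun l => (1 : Matrix (Fin (r + n)) (Fin (r + n)) (QS S)) i (Fin.natAdd r l)

@[simp] theorem complete_castAdd {r n : ℕ} (w : Fin r → Fin (r + n) → QS S) (i : Fin (r + n))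
    (l : Fin r) : complete w i (Fin.castAdd n l) = w l i := by simp [complete]

@[simp] theorem complete_natAdd {r n : ℕ} (w : Fin r → Fin (r + n) → QS S) (i : Fin (r + n))
    (l : Fin n) : complete w i (Fin.natAdd r l) =
      (1 : Matrix (Fin (r + n)) (Fin (r + n)) (QS S)) i (Fin.natAdd r l) := by simp [complete]

/-- A neighbourhood of the tuple of the first `r` standard unit vectors, on which the completion by
the remaining unit vectors stays in a bounded set of invertible matrices. -/
def nearStd (S : Finset PrimeNum) (r n : ℕ) : Set (Fin r → Fin (r + n) → QS S) :=
  {w | (∀ i j, |(w i j).1| < 2 ∧ w i j ∈ OS S) ∧ 1 / 2 < (complete w).det.1 ∧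
    ∀ p : S, ‖(complete w).det.2 p‖ = 1}

theorem continuous_complete {r n : ℕ} : Continuous (complete (S := S) (r := r) (n := n)) := by
  refine continuous_matrix fun i j => ?_
  refine Fin.addCases (fun l => ?_) (fun l => ?_) j
  · simp only [complete_castAdd]; fun_prop
  · simp only [complete_natAdd]; fun_prop

theorem isOpen_nearStd (r n : ℕ) : IsOpen (nearStd S r n) := by
  have hc : Continuous fun w : Fin r → Fin (r + n) → QS S => (complete w).det :=
    continuous_complete.matrix_det
  have h1 : ∀ i j, Continuous fun w : Fin r → Fin (r + n) → QS S => w i j := fun i j => by fun_prop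
  have h2 : nearStd S r n = (⋂ i, ⋂ j,
      ((fun w : Fin r → Fin (r + n) → QS S => |(w i j).1|) ⁻¹' Set.Iio 2 ∩
        (fun w : Fin r → Fin (r + n) → QS S => w i j) ⁻¹' (OS S : Set (QS S)))) ∩
      ((fun w : Fin r → Fin (r + n) → QS S => (complete w).det.1) ⁻¹' Set.Ioi (1 / 2) ∩
        ⋂ p : S, (fun w : Fin r → Fin (r + n) → QS S => (complete w).det.2 p) ⁻¹'
          Metric.sphere 0 1) := by
    ext w
    simp only [nearStd, Set.mem_ofPred_eq, Set.mem_iInter, Set.mem_inter_iff, Set.mem_preimage,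
      Set.mem_Iio, Set.mem_Ioi, SetLike.mem_coe, mem_sphere_zero_iff_norm]
  rw [h2]
  refine IsOpen.inter ?_ (IsOpen.inter (isOpen_Ioi.preimage hc.fst) ?_)
  · exact isOpen_iInter_of_finite fun i => isOpen_iInter_of_finite fun j =>
      (isOpen_Iio.preimage (h1 i j).fst.abs).inter (isOpen_OS.preimage (h1 i j))
  · exact isOpen_iInter_of_finite fun p =>
      (IsUltrametricDist.isOpen_sphere (0 : ℚ_[p.1.1]) one_ne_zero).preimage
        ((continuous_apply p).comp hc.snd)

theorem nearStd_nonempty (r n : ℕ) : (nearStd S r n).Nonempty := by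
  refine ⟨fun l i => (1 : Matrix (Fin (r + n)) (Fin (r + n)) (QS S)) i (Fin.castAdd n l), ?_⟩
  have h1 : complete (fun (l : Fin r) i =>
      (1 : Matrix (Fin (r + n)) (Fin (r + n)) (QS S)) i (Fin.castAdd n l)) = 1 := by
    ext1 i j
    refine Fin.addCases (fun l => ?_) (fun l => ?_) j
    · rw [complete_castAdd]
    · rw [complete_natAdd]
  have h2 : ∀ i j, |((1 : Matrix (Fin (r + n)) (Fin (r + n)) (QS S)) i j).1| < 2 ∧
      (1 : Matrix (Fin (r + n)) (Fin (r + n)) (QS S)) i j ∈ OS S := fun i j => by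
    rw [Matrix.one_apply]
    split_ifs
    · exact ⟨by norm_num, one_mem _⟩
    · exact ⟨by norm_num, zero_mem _⟩
  refine ⟨fun i j => h2 _ _, ?_, fun p => ?_⟩
  · rw [h1]; norm_num
  · rw [h1]; simp

theorem complete_bounded {r n : ℕ} {w : Fin r → Fin (r + n) → QS S} (hw : w ∈ nearStd S r n)
    (i j : Fin (r + n)) : |(complete w i j).1| ≤ 2 ∧ complete w i j ∈ OS S := by
  refine Fin.addCases (fun l => ?_) (fun l => ?_) j
  · rw [complete_castAdd]
    exact ⟨(hw.1 l i).1.le, (hw.1 l i).2⟩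
  · rw [complete_natAdd, Matrix.one_apply]
    split_ifs
    · exact ⟨by norm_num, one_mem _⟩
    · exact ⟨by norm_num, zero_mem _⟩

/-- The bound for the completing vector. -/
noncomputable def completionBound (r n : ℕ) : ℝ :=
  (r + (n + 1) : ℕ) * (2 * (2 ^ ((n + 1) * (n + 1)) * 2))

/-- A primitive tuple `Y` for which `g Y` is close to the standard one extends to a basis whose
next vector is bounded. In the coordinates given by `complete (g Y)` the matrix of an arbitrary
completion has the block form `[1 *; 0 g']`, where `g'` has bounded determinant. Reduction theory
for `g'` makes the lower part of the new vector short, and a translation by `ℤ_S`-combinations of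
`Y` makes the upper part short. -/
theorem exists_completion {r n : ℕ}
    {g : Matrix (Fin (r + (n + 1))) (Fin (r + (n + 1))) (QS S)}
    (hg : (g.det).1 = 1) (hgp : ∀ p, ‖(g.det).2 p‖ = 1)
    {Y : Fin r → Fin (r + (n + 1)) → SInt S}
    (hY : Y ∈ primitiveTuples S (Nat.le_add_right r (n + 1)))
    (hA : tupleMul g (intTuple Y) ∈ nearStd S r (n + 1)) :
    ∃ γ : Matrix (Fin (r + (n + 1))) (Fin (r + (n + 1))) (SInt S), γ.det = 1 ∧
      (∀ i j, Y i j = γ j (Fin.castAdd (n + 1) i)) ∧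
      (g *ᵥ fun j => toQS S (γ j (Fin.natAdd r 0))) ∈ box S _ (completionBound r n) := by
  obtain ⟨γ₀, hγ₀, hY⟩ := hY
  set w := tupleMul g (intTuple Y) with hw
  -- the matrix `u` is a basis of `ℚ_S^d` that starts with `g Y`; `M` is `g γ₀` in its coordinates
  set u := complete w with hu
  have huu : IsUnit u.det := isUnit_det_of_norm (by have := hA.2.1; exact (by linarith : (0:ℝ) < _).ne') hA.2.2
  set M := u⁻¹ * (g * γ₀.map (toQS S)) with hM
  have huM : u * M = g * γ₀.map (toQS S) := by
    rw [hM, ← Matrix.mul_assoc, Matrix.mul_nonsing_inv _ huu, Matrix.one_mul]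
  have hgY : ∀ (l : Fin r) i, (g * γ₀.map (toQS S)) i (Fin.castAdd (n + 1) l) = w l i := by
    intro l i
    rw [hw, tupleMul, Matrix.mul_apply]
    simp only [Matrix.mulVec, dotProduct, intTuple, hY, Matrix.map_apply]
    rfl
  have hM1 : ∀ i (l : Fin r), M i (Fin.castAdd (n + 1) l) =
      (1 : Matrix (Fin (r + (n + 1))) (Fin (r + (n + 1))) (QS S)) i (Fin.castAdd (n + 1) l) := by
    intro i l
    rw [← Matrix.nonsing_inv_mul u huu, hM, Matrix.mul_apply, Matrix.mul_apply]
    exact Finset.sum_congr rfl fun j _ => by rw [hgY, hu, complete_castAdd]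
  set g' : Matrix (Fin (n + 1)) (Fin (n + 1)) (QS S) :=
    M.submatrix (Fin.natAdd r) (Fin.natAdd r) with hg'
  have hMdet : M.det = g'.det := by
    rw [← Matrix.det_submatrix_equiv_self (finSumFinEquiv (m := r) (n := n + 1)) M]
    have h1 : M.submatrix (finSumFinEquiv (m := r) (n := n + 1)) finSumFinEquiv =
        Matrix.fromBlocks 1 (M.submatrix (Fin.castAdd (n + 1)) (Fin.natAdd r)) 0 g' := by
      ext1 i j
      rcases i with i | i <;> rcases j with j | j <;>
        simp only [Matrix.submatrix_apply, finSumFinEquiv_apply_left, finSumFinEquiv_apply_right,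
          Matrix.fromBlocks_apply₁₁, Matrix.fromBlocks_apply₁₂, Matrix.fromBlocks_apply₂₁,
          Matrix.fromBlocks_apply₂₂, hM1, hg', Matrix.one_apply, Matrix.zero_apply]
      · simp
      · rw [if_neg]
        intro h
        have := congrArg Fin.val h
        simp at this
        omega
    rw [h1, Matrix.det_fromBlocks_zero₂₁, Matrix.det_one, one_mul]
  have hdet : u.det * g'.det = g.det := by
    rw [← hMdet, ← Matrix.det_mul, huM, Matrix.det_mul, det_toQS, hγ₀, map_one, mul_one]
  have hd1 : (u.det).1 * (g'.det).1 = 1 := by rw [← Prod.fst_mul, hdet, hg]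
  have hdp : ∀ p, ‖(g'.det).2 p‖ = 1 := fun p => by
    have h1 : ‖(u.det).2 p * (g'.det).2 p‖ = 1 := by
      rw [← Pi.mul_apply, ← Prod.snd_mul, hdet, hgp]
    rwa [norm_mul, hA.2.2 p, one_mul] at h1
  have hd0 : (g'.det).1 ≠ 0 := fun h => by simp [h] at hd1
  have hd2 : |(g'.det).1| ≤ 2 := by
    have h2 := hA.2.1
    have h3 : 0 < (g'.det).1 := by
      by_contra h
      nlinarith
    rw [abs_of_pos h3]
    nlinarith
  obtain ⟨δ, hδ, hbox⟩ := exists_det_one_col_mem_box hd0 hdp one_le_two hd2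
  -- the vector `z` translates the upper part of the new vector into a fundamental domain of `ℤ_S`
  choose z hz1 hz2 using fun i : Fin r => exists_sub_toQS_mem
    ((M.submatrix (Fin.castAdd (n + 1)) (Fin.natAdd r) *ᵥ fun i => toQS S (δ i 0)) i)
  let β : Matrix (Fin r ⊕ Fin (n + 1)) (Fin r ⊕ Fin (n + 1)) (SInt S) :=
    Matrix.fromBlocks 1 (Matrix.of fun i j => if j = 0 then -z i else 0) 0 δ
  let B := Matrix.reindex finSumFinEquiv finSumFinEquiv β
  have hB : B.det = 1 := by
    rw [Matrix.det_reindex_self, Matrix.det_fromBlocks_zero₂₁, Matrix.det_one, one_mul, hδ]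
  have hB1 : ∀ j (i : Fin r), B j (Fin.castAdd (n + 1) i) =
      (1 : Matrix (Fin (r + (n + 1))) (Fin (r + (n + 1))) (SInt S)) j (Fin.castAdd (n + 1) i) := by
    intro j i
    refine Fin.addCases (fun l => ?_) (fun l => ?_) j
    · simp [B, β, Matrix.one_apply]
    · have : Fin.natAdd r l ≠ Fin.castAdd (n + 1) i := fun h => by
        have := congrArg Fin.val h
        simp at this
        omega
      simp [B, β, this]
  refine ⟨γ₀ * B, by rw [Matrix.det_mul, hγ₀, hB, one_mul], fun i j => ?_, ?_⟩
  · rw [hY, Matrix.mul_apply]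
    simp only [hB1]
    rw [← Matrix.mul_apply, Matrix.mul_one]
    rfl
  · have h1 : (g *ᵥ fun j => toQS S ((γ₀ * B) j (Fin.natAdd r 0))) =
        u *ᵥ (M *ᵥ fun j => toQS S (B j (Fin.natAdd r 0))) := by
      rw [Matrix.mulVec_mulVec, huM, ← Matrix.mulVec_mulVec]
      congr 1
      funext j
      rw [Matrix.mul_apply, map_sum]
      simp [Matrix.mulVec, dotProduct]
    rw [h1]
    refine mulVec_mem_box (complete_bounded hA) fun j => ?_
    have hc : ∀ i : Fin r, B (Fin.castAdd (n + 1) i) (Fin.natAdd r 0) = -z i := fun i => by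
      simp [B, β]
    have hn : ∀ i, B (Fin.natAdd r i) (Fin.natAdd r 0) = δ i 0 := fun i => by simp [B, β]
    have h2 : ∀ j, (M *ᵥ fun j => toQS S (B j (Fin.natAdd r 0))) j =
        -(∑ i, (1 : Matrix (Fin (r + (n + 1))) (Fin (r + (n + 1))) (QS S)) j
            (Fin.castAdd (n + 1) i) * toQS S (z i)) +
          ∑ i, M j (Fin.natAdd r i) * toQS S (δ i 0) := by
      intro j
      rw [Matrix.mulVec, dotProduct, Fin.sum_univ_add]
      simp only [hc, hn, hM1, map_neg, mul_neg, Finset.sum_neg_distrib]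
    refine Fin.addCases (fun l => ?_) (fun l => ?_) j
    · have h3 : (M *ᵥ fun j => toQS S (B j (Fin.natAdd r 0))) (Fin.castAdd (n + 1) l) =
          (M.submatrix (Fin.castAdd (n + 1)) (Fin.natAdd r) *ᵥ fun i => toQS S (δ i 0)) l -
            toQS S (z l) := by
        rw [h2]
        simp [Matrix.one_apply, Matrix.mulVec, dotProduct, sub_eq_neg_add]
      rw [h3]
      refine ⟨(hz1 l).trans ?_, hz2 l⟩
      have : (1 : ℝ) ≤ 2 ^ ((n + 1) * (n + 1)) := one_le_pow₀ one_le_two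
      linarith
    · have h3 : (M *ᵥ fun j => toQS S (B j (Fin.natAdd r 0))) (Fin.natAdd r l) =
          (g' *ᵥ fun i => toQS S (δ i 0)) l := by
        rw [h2, Finset.sum_eq_zero, neg_zero, zero_add]
        · rfl
        · intro i _
          have : Fin.natAdd r l ≠ Fin.castAdd (n + 1) i := fun h => by
            have := congrArg Fin.val h
            simp at this
            omega
          rw [Matrix.one_apply_ne this, zero_mul]
      rw [h3]
      exact hbox l

/-! ### The measures counting primitive tuples are multiples of Haar measure -/

theorem orbitSum_indicator {d r : ℕ} (𝒴 : Set (Fin r → Fin d → SInt S))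
    (A : Set (Fin r → Fin d → QS S)) (g : Matrix (Fin d) (Fin d) (QS S)) :
    orbitSum 𝒴 (A.indicator 1) g = {Y ∈ 𝒴 | tupleMul g (intTuple Y) ∈ A}.encard := by
  classical
  rw [← ENNReal.tsum_set_one, orbitSum,
    tsum_subtype 𝒴 (fun Y => A.indicator (1 : (Fin r → Fin d → QS S) → ENNReal)
      (tupleMul g (intTuple Y))), tsum_subtype _ (fun _ => (1 : ENNReal))]
  refine tsum_congr fun Y => ?_
  simp only [Set.indicator_apply, Set.mem_ofPred_eq, Pi.one_apply]
  split_ifs <;> simp_all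

theorem abs_adjugate_fst_le {n : ℕ} {M : Matrix (Fin n) (Fin n) (QS S)} {C : ℝ} (h1 : 1 ≤ C)
    (hM : ∀ i j, |(M i j).1| ≤ C) (i j : Fin n) :
    |(M.adjugate i j).1| ≤ n.factorial * C ^ n := by
  rw [Matrix.adjugate_apply, det_fst]
  have h := Matrix.det_le (A := (M.updateRow j (Pi.single i 1)).map (atReal S))
    (abv := AbsoluteValue.abs) (x := C) fun a b => by
      rw [Matrix.map_apply, Matrix.updateRow_apply]
      split_ifs
      · rw [Pi.single_apply]
        split_ifs
        · simpa using h1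
        · simpa using zero_le_one.trans h1
      · exact hM a b
  simpa using h

/-- The number of bases of a unimodular lattice in a bounded set is bounded, uniformly in the
lattice. -/
theorem exists_encard_bases_le (d : ℕ) {C : ℝ} (h1 : 1 ≤ C) : ∃ N : ℕ,
    ∀ g : Matrix (Fin d) (Fin d) (QS S), (g.det).1 = 1 → (∀ p, ‖(g.det).2 p‖ = 1) →
      {γ : Matrix (Fin d) (Fin d) (SInt S) | γ.det = 1 ∧ ∀ j,
        (g *ᵥ fun i => toQS S (γ i j)) ∈ box S d C}.encard ≤ N := by
  set B : ℝ := d * (d.factorial * C ^ d * C)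
  have hfin : {N : Matrix (Fin d) (Fin d) (SInt S) | ∀ i, N i ∈ {z : Fin d → SInt S |
      ∀ i, |(toQS S (z i)).1| ≤ B ∧ toQS S (z i) ∈ OS S}}.Finite := by
    have := Set.Finite.pi (ι := Fin d) fun _ => finite_setOf_int_bounded (S := S) d B
    refine this.subset fun N hN i _ => hN i
  refine ⟨hfin.toFinset.card, fun g hg hgp => ?_⟩
  set E := {γ : Matrix (Fin d) (Fin d) (SInt S) | γ.det = 1 ∧ ∀ j,
        (g *ᵥ fun i => toQS S (γ i j)) ∈ box S d C} with hE
  rcases E.eq_empty_or_nonempty with h | ⟨γ₀, hγ₀, hb₀⟩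
  · rw [h]; simp
  have hγ₀' : γ₀ * γ₀.adjugate = 1 := by rw [Matrix.mul_adjugate, hγ₀, one_smul]
  set M : Matrix (Fin d) (Fin d) (QS S) := Matrix.of fun i j => (g *ᵥ fun i => toQS S (γ₀ i j)) i
    with hM
  have hMg : M = g * γ₀.map (toQS S) := rfl
  have hMdet : M.det = g.det := by rw [hMg, Matrix.det_mul, det_toQS, hγ₀, map_one, mul_one]
  have hMO : ∀ i j, M i j ∈ OS S := fun i j => (hb₀ j i).2
  have hMb : ∀ i j, |(M i j).1| ≤ C := fun i j => (hb₀ j i).1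
  have hinj : Function.Injective fun γ : Matrix (Fin d) (Fin d) (SInt S) => γ₀.adjugate * γ := by
    intro γ γ' h
    have h2 := congrArg (γ₀ * ·) h
    simpa [← Matrix.mul_assoc, hγ₀'] using h2
  -- relative to one basis `γ₀`, all others have integral coordinates, bounded by the adjugate
  rw [← hinj.encard_image, ← Set.encard_coe_eq_coe_finsetCard, hfin.coe_toFinset]
  refine Set.encard_le_encard ?_
  rintro _ ⟨γ, ⟨hγ, hb⟩, rfl⟩
  have hMN : ∀ j, (M *ᵥ fun i => toQS S ((γ₀.adjugate * γ) i j)) =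
      g *ᵥ fun i => toQS S (γ i j) := fun j => by
    have h2 : (fun i => toQS S ((γ₀.adjugate * γ) i j)) =
        (γ₀.adjugate.map (toQS S)) *ᵥ fun i => toQS S (γ i j) := by
      funext i
      rw [Matrix.mul_apply, map_sum]
      simp [Matrix.mulVec, dotProduct]
    rw [h2, Matrix.mulVec_mulVec, hMg, Matrix.mul_assoc, ← Matrix.map_mul, hγ₀',
      Matrix.map_one _ (map_zero _) (map_one _), Matrix.mul_one]
  intro i j
  constructor
  · have h2 : M.adjugate *ᵥ (M *ᵥ fun i => toQS S ((γ₀.adjugate * γ) i j)) =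
        M.det • fun i => toQS S ((γ₀.adjugate * γ) i j) := by
      rw [Matrix.mulVec_mulVec, Matrix.adjugate_mul, Matrix.smul_mulVec, Matrix.one_mulVec]
    have h3 := abs_mulVec_fst_le (abs_adjugate_fst_le h1 hMb) (fun l => (hb j l).1) i
    rw [← hMN, h2, Pi.smul_apply, smul_eq_mul, Prod.fst_mul, hMdet, hg, one_mul] at h3
    exact h3
  · refine mem_OS_of_mulVec_mem hMO (by rw [hMdet]; exact hgp)
      (x := fun i => toQS S ((γ₀.adjugate * γ) i j)) (fun l => ?_) i
    rw [hMN]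
    exact (hb j l).2

theorem completionBound_ge (r n : ℕ) : 2 ≤ completionBound r n := by
  have h1 : (1 : ℝ) ≤ 2 ^ ((n + 1) * (n + 1)) := one_le_pow₀ one_le_two
  have h2 : (1 : ℝ) ≤ (r + (n + 1) : ℕ) := by exact_mod_cast (by omega : 1 ≤ r + (n + 1))
  unfold completionBound
  nlinarith

/-- The completion of `exists_completion` embeds the primitive `r`-tuples near the standard one
into the bounded primitive `(r + 1)`-tuples. -/
theorem exists_orbitSum_primitiveTuples_le {d r : ℕ} (h : r + 1 ≤ d) :
    ∃ U : Set (Fin r → Fin d → QS S), IsOpen U ∧ U.Nonempty ∧ ∃ C : ℝ,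
      ∀ g : Matrix (Fin d) (Fin d) (QS S), (g.det).1 = 1 → (∀ p, ‖(g.det).2 p‖ = 1) →
        orbitSum (primitiveTuples S (Nat.le_of_succ_le h)) (U.indicator 1) g ≤
          orbitSum (primitiveTuples S h) ((Set.pi Set.univ fun _ => box S d C).indicator 1) g := by
  obtain ⟨n, rfl⟩ : ∃ n, d = r + (n + 1) := ⟨d - r - 1, by omega⟩
  refine ⟨nearStd S r (n + 1), isOpen_nearStd _ _, nearStd_nonempty _ _, completionBound r n,
    fun g hg hgp => ?_⟩
  rw [orbitSum_indicator, orbitSum_indicator]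
  refine ENat.toENNReal_mono ?_
  refine le_trans (Set.encard_le_encard ?_) (Set.encard_image_le (fun Y => Fin.init Y) _)
  rintro Y ⟨hY, hA⟩
  obtain ⟨γ, hγ, hY', hb⟩ := exists_completion hg hgp hY hA
  refine ⟨fun i j => γ j (Fin.castLE h i), ⟨⟨γ, hγ, fun _ _ => rfl⟩, fun i _ => ?_⟩, ?_⟩
  · refine Fin.lastCases ?_ (fun i => ?_) i
    · exact hb
    · have h1 : tupleMul g (intTuple fun i j => γ j (Fin.castLE h i)) i.castSucc =
          tupleMul g (intTuple Y) i := by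
        simp only [tupleMul]
        congr 1
        funext j
        simp only [intTuple, hY']
        rfl
      rw [h1]
      exact fun j => ⟨((hA.1 i j).1.le).trans (completionBound_ge r n), (hA.1 i j).2⟩
  · funext i j
    rw [hY']
    rfl

/-- The base of the downward induction: for `r = d - 1` the completed tuples are bases, and only
boundedly many bases lie in a bounded set. -/
theorem exists_orbitSum_primitiveTuples_le_nat {d r : ℕ} (h : r + 1 = d) :
    ∃ U : Set (Fin r → Fin d → QS S), IsOpen U ∧ U.Nonempty ∧ ∃ N : ℕ,
      ∀ g : Matrix (Fin d) (Fin d) (QS S), (g.det).1 = 1 → (∀ p, ‖(g.det).2 p‖ = 1) →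
        orbitSum (primitiveTuples S (h ▸ Nat.le_succ r)) (U.indicator 1) g ≤ N := by
  obtain ⟨U, hU, hUne, C, hUC⟩ := exists_orbitSum_primitiveTuples_le (S := S) h.le
  obtain ⟨N, hN⟩ := exists_encard_bases_le (S := S) d (le_max_left 1 C)
  refine ⟨U, hU, hUne, N, fun g hg hgp => (hUC g hg hgp).trans ?_⟩
  rw [orbitSum_indicator]
  refine (ENat.toENNReal_mono (b := N) ?_).trans_eq (by simp)
  refine le_trans (le_trans (Set.encard_le_encard ?_)
    (Set.encard_image_le (fun γ i j => γ j (Fin.castLE h.le i)) _)) (hN g hg hgp)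
  rintro Y ⟨⟨γ, hγ, hY⟩, hb⟩
  refine ⟨γ, ⟨hγ, fun j => box_mono (le_max_right 1 C) ?_⟩, by funext i j; exact (hY i j).symm⟩
  subst h
  have := hb j (Set.mem_univ _)
  have h1 : tupleMul g (intTuple Y) j = g *ᵥ fun i => toQS S (γ i j) := by
    simp only [tupleMul]
    congr 1
    funext l
    simp only [intTuple, hY]
    rfl
  rwa [h1] at this

/-- The tuples of full rank form an open set, as full rank means that some matrix `σ` makes `det (σ
w)` a unit. -/
theorem isOpen_setOf_leftInverse (d r : ℕ) : IsOpen {w : Fin r → Fin d → QS S |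
    ∃ σ : Matrix (Fin r) (Fin d) (QS S), σ * (Matrix.of w)ᵀ = 1} := by
  have h : {w : Fin r → Fin d → QS S | ∃ σ : Matrix (Fin r) (Fin d) (QS S),
      σ * (Matrix.of w)ᵀ = 1} = ⋃ σ : Matrix (Fin r) (Fin d) (QS S),
        (fun w : Fin r → Fin d → QS S => (σ * (Matrix.of w)ᵀ).det) ⁻¹'
          {x : QS S | ¬ IsUnit x}ᶜ := by
    ext w
    simp only [Set.mem_ofPred_eq, Set.mem_iUnion, Set.mem_preimage, Set.mem_compl_iff, not_not]
    refine ⟨fun ⟨σ, hσ⟩ => ⟨σ, by rw [hσ, Matrix.det_one]; exact isUnit_one⟩, fun ⟨σ, hσ⟩ =>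
      ⟨(σ * (Matrix.of w)ᵀ)⁻¹ * σ, by rw [Matrix.mul_assoc, Matrix.nonsing_inv_mul _ hσ]⟩⟩
  rw [h]
  refine isOpen_iUnion fun σ => isClosed_setOf_not_isUnit.isOpen_compl.preimage ?_
  refine Continuous.matrix_det (continuous_const.matrix_mul ?_)
  exact Continuous.matrix_transpose continuous_id

theorem leftInverse_map {d r : ℕ} {Y : Fin r → Fin d → SInt S}
    (h : ∃ σ : Matrix (Fin r) (Fin d) (SInt S), σ * (Matrix.of Y)ᵀ = 1) :
    ∃ σ : Matrix (Fin r) (Fin d) (QS S), σ * (Matrix.of (intTuple Y))ᵀ = 1 := by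
  obtain ⟨σ, hσ⟩ := h
  refine ⟨σ.map (toQS S), ?_⟩
  have h1 : (Matrix.of (intTuple Y))ᵀ = ((Matrix.of Y)ᵀ).map (toQS S) := by ext1; rfl
  rw [h1, ← Matrix.map_mul, hσ, Matrix.map_one _ (map_zero _) (map_one _)]

section LatticeMeasure

variable {d r : ℕ} {G : Subgroup (GL (Fin d) (QS S))} [MeasurableSpace (Space G)]

theorem ae_leftInverse_tupleMeasure {m : Measure (Space G)} {s : Space G → G} (hs : IsSection s)
    {𝒴 : Set (Fin r → Fin d → SInt S)}
    (hfull : ∀ Y ∈ 𝒴, ∃ σ : Matrix (Fin r) (Fin d) (QS S), σ * (Matrix.of (intTuple Y))ᵀ = 1) :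
    ∀ᵐ w ∂tupleMeasure m s 𝒴, ∃ σ : Matrix (Fin r) (Fin d) (QS S), σ * (Matrix.of w)ᵀ = 1 := by
  rw [tupleMeasure, Measure.ae_sum_iff' (isOpen_setOf_leftInverse d r).measurableSet]
  rintro ⟨Y, hY⟩
  rw [ae_map_iff (measurable_tupleMul_section hs _).aemeasurable
    (isOpen_setOf_leftInverse d r).measurableSet]
  refine Filter.Eventually.of_forall fun x => ?_
  obtain ⟨σ, hσ⟩ := hfull Y hY
  set g := (s x : GL (Fin d) (QS S))
  refine ⟨σ * (g⁻¹).1, ?_⟩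
  have h1 : (Matrix.of (tupleMul g.1 (intTuple Y)))ᵀ = g.1 * (Matrix.of (intTuple Y))ᵀ := by
    ext1 i j
    rfl
  rw [h1, Matrix.mul_assoc, ← Matrix.mul_assoc _ g.1, ← Units.val_mul, inv_mul_cancel, Units.val_one,
    Matrix.one_mul, hσ]

/-- The uniqueness theorem applied to the measure that counts the tuples in a stable set. -/
theorem exists_tupleMeasure_eq_smul [BorelSpace (Space G)] (hUL : G ≤ ULQ d S) (hSL : SLQ d S ≤ G)
    (m : Measure (Space G)) [IsFiniteMeasure m] [SMulInvariantMeasure G (Space G) m]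
    {s : Space G → G} (hs : IsSection s) (hr : r < d) {𝒴 : Set (Fin r → Fin d → SInt S)}
    (h𝒴 : IsStable 𝒴)
    (hfull : ∀ Y ∈ 𝒴, ∃ σ : Matrix (Fin r) (Fin d) (QS S), σ * (Matrix.of (intTuple Y))ᵀ = 1)
    {U : Set (Fin r → Fin d → QS S)} (hU : IsOpen U) (hUne : U.Nonempty)
    (hfin : ∫⁻ x, orbitSum 𝒴 (U.indicator 1) (s x : GL (Fin d) (QS S)).1 ∂m ≠ ⊤) :
    ∃ c : NNReal, tupleMeasure m s 𝒴 = c • muVec S d r := by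
  refine exists_eq_smul_muVec hr _ (map_tupleMul_tupleMeasure hUL hSL m hs h𝒴)
    (ae_leftInverse_tupleMeasure hs hfull) ⟨U, hU, hUne, ?_⟩
  rwa [← lintegral_tupleMeasure hs 𝒴 (measurable_one.indicator hU.measurableSet),
    lintegral_indicator_one hU.measurableSet] at hfin

/-- The mean number of primitive tuples of a random lattice in a set is proportional to the
volume, with a finite constant. -/
theorem exists_tupleMeasure_primitiveTuples [BorelSpace (Space G)] (hUL : G ≤ ULQ d S)
    (hSL : SLQ d S ≤ G) (m : Measure (Space G)) [IsFiniteMeasure m]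
    [SMulInvariantMeasure G (Space G) m] {s : Space G → G} (hs : IsSection s) (hr : r + 1 ≤ d) :
    ∃ c : NNReal, tupleMeasure m s (primitiveTuples S (Nat.le_of_succ_le hr)) =
      c • muVec S d r := by
  obtain ⟨n, hn⟩ : ∃ n, r + 1 + n = d := ⟨d - (r + 1), by omega⟩
  induction n generalizing r with
  | zero =>
    obtain ⟨U, hU, hUne, N, hN⟩ := exists_orbitSum_primitiveTuples_le_nat (S := S) hn
    refine exists_tupleMeasure_eq_smul hUL hSL m hs hr (isStable_primitiveTuples _)
      (fun Y hY => leftInverse_map (exists_leftInverse_of_mem_primitiveTuples _ hY)) hU hUne ?_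
    refine ne_top_of_le_ne_top ?_ (lintegral_mono fun x => hN _ (hUL (s x).2).1 (hUL (s x).2).2)
    rw [lintegral_const]
    exact ENNReal.mul_ne_top (ENNReal.natCast_ne_top N) (measure_ne_top _ _)
  | succ n ih =>
    obtain ⟨U, hU, hUne, C, hUC⟩ := exists_orbitSum_primitiveTuples_le (S := S) hr
    obtain ⟨c, hc⟩ := ih (r := r + 1) (by omega) (by omega)
    refine exists_tupleMeasure_eq_smul hUL hSL m hs hr (isStable_primitiveTuples _)
      (fun Y hY => leftInverse_map (exists_leftInverse_of_mem_primitiveTuples _ hY)) hU hUne ?_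
    refine ne_top_of_le_ne_top ?_ (lintegral_mono fun x => hUC _ (hUL (s x).2).1 (hUL (s x).2).2)
    have hK : IsCompact (Set.pi Set.univ fun _ : Fin (r + 1) => box S d C) :=
      isCompact_univ_pi fun _ => isCompact_box d C
    rw [← lintegral_tupleMeasure hs _ (measurable_one.indicator hK.measurableSet),
      lintegral_indicator_one hK.measurableSet, hc, Measure.smul_apply]
    exact ENNReal.mul_ne_top ENNReal.coe_ne_top hK.measure_lt_top.ne

end LatticeMeasure

/-! ### Counting lattice vectors in a box -/

/-- The number of lattice vectors `g z`, `z ∈ ℤ_S^d`, in the box of size `R`. -/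
noncomputable def latticeCount {d : ℕ} (g : Matrix (Fin d) (Fin d) (QS S)) (R : ℝ) : ℕ∞ :=
  {z : Fin d → SInt S | (g *ᵥ fun i => toQS S (z i)) ∈ box S d R}.encard

theorem IsSiegel.norm_det {n : ℕ} {T : Matrix (Fin n) (Fin n) (QS S)} (hT : IsSiegel T) (p : S) :
    ‖(T.det).2 p‖ = 1 := by
  have h : (T.det).2 p = ∏ i, (T i i).2 p := by
    rw [Matrix.det_of_isUpperTriangular fun i j h => hT.lower i j h]
    exact map_prod (atPadic p) _ _
  rw [h, norm_prod]
  exact Finset.prod_eq_one fun i _ => hT.norm_diag i p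

/-- The integral vectors in a box are counted by the integer parts of the coordinates of `T y`,
scaled by the diagonal: since `T` is upper triangular, these determine `y`, starting from the last
coordinate. -/
theorem IsSiegel.exists_latticeCount_le {n : ℕ} {T : Matrix (Fin n) (Fin n) (QS S)}
    (hT : IsSiegel T) {R : ℝ} (hR : 0 ≤ R) : ∃ N : ℕ, latticeCount T R ≤ N ∧
      (N : ℝ) ≤ ∏ i, (2 * (R / (T i i).1) + 2) := by
  let c : (Fin n → SInt S) → Fin n → ℝ := fun y i =>
    ((T *ᵥ fun i => toQS S (y i)) i).1 / (T i i).1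
  let F : Finset (Fin n → ℤ) :=
    Fintype.piFinset fun i => Finset.Icc ⌊-(R / (T i i).1)⌋ ⌊R / (T i i).1⌋
  refine ⟨F.card, ?_, ?_⟩
  · rw [latticeCount, ← Set.encard_coe_eq_coe_finsetCard]
    refine Set.encard_le_encard_of_injOn (f := fun y i => ⌊c y i⌋) ?_ ?_
    · intro y hy
      simp only [F, Finset.mem_coe, Fintype.mem_piFinset, Finset.mem_Icc]
      intro i
      have h1 := _root_.abs_le.1 (hy i).1
      have h2 := hT.pos i
      constructor
      · refine Int.floor_mono ?_
        rw [← neg_div]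
        exact div_le_div_of_nonneg_right h1.1 h2.le
      · exact Int.floor_mono (div_le_div_of_nonneg_right h1.2 h2.le)
    · intro y hy y' hy' h
      have hint : ∀ y ∈ {z : Fin n → SInt S | (T *ᵥ fun i => toQS S (z i)) ∈ box S n R}, ∀ i,
          ∃ m : ℤ, y i = m := fun y hy i => exists_int_of_mem_OS
        (mem_OS_of_mulVec_mem hT.mem_OS hT.norm_det (fun i => (hy i).2) i)
      have key : ∀ i, (∀ j, i < j → y j = y' j) → y i = y' i := by
        intro i hi
        have h1 : |c y i - c y' i| < 1 := Int.abs_sub_lt_one_of_floor_eq_floor (congrFun h i)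
        have h2 : c y i - c y' i = ((y i : ℚ) : ℝ) - ((y' i : ℚ) : ℝ) := by
          have h3 : ∀ z : Fin n → SInt S, ((T *ᵥ fun i => toQS S (z i)) i).1 =
              ∑ j, (T i j).1 * ((z j : ℚ) : ℝ) := fun z => map_sum (atReal S) _ _
          simp only [c]
          rw [← sub_div, div_eq_iff (hT.pos i).ne', h3, h3, ← Finset.sum_sub_distrib,
            Finset.sum_eq_single i]
          · ring
          · intro j _ hj
            rcases lt_or_gt_of_ne hj with hj | hj
            · simp [hT.lower i j hj]
            · rw [hi j hj, sub_self]
          · simp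
        obtain ⟨a, ha⟩ := hint y hy i
        obtain ⟨b, hb⟩ := hint y' hy' i
        rw [h2, ha, hb] at h1
        have h4 : |((a - b : ℤ) : ℝ)| < 1 := by
          push_cast
          exact h1
        rw [← Int.cast_abs] at h4
        have h4 : |a - b| < 1 := by exact_mod_cast h4
        rw [ha, hb, sub_eq_zero.1 (Int.abs_lt_one_iff.1 h4)]
      funext i
      induction i using WellFoundedGT.induction with
      | _ i ih => exact key i ih
  · simp only [F, Fintype.card_piFinset, Int.card_Icc]
    push_cast
    refine Finset.prod_le_prod (fun _ _ => by positivity) fun i _ => ?_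
    have h0 : 0 ≤ R / (T i i).1 := div_nonneg hR (hT.pos i).le
    have h1 := Int.floor_le (R / (T i i).1)
    have h2 := Int.lt_floor_add_one (-(R / (T i i).1))
    have h3 : (0 : ℤ) ≤ ⌊R / (T i i).1⌋ + 1 - ⌊-(R / (T i i).1)⌋ := by
      have : ⌊-(R / (T i i).1)⌋ ≤ ⌊R / (T i i).1⌋ := Int.floor_mono (by linarith)
      omega
    have h4 : (((⌊R / (T i i).1⌋ + 1 - ⌊-(R / (T i i).1)⌋).toNat : ℤ) : ℝ) =
        ⌊R / (T i i).1⌋ + 1 - ⌊-(R / (T i i).1)⌋ := by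
      rw [Int.toNat_of_nonneg h3]
      push_cast
      ring
    rw [Int.cast_natCast] at h4
    rw [h4]
    linarith

theorem realNormSq_le_of_mem_box {n : ℕ} {x : Fin n → QS S} {R : ℝ} (hx : x ∈ box S n R) :
    realNormSq x ≤ n * R ^ 2 := by
  have h : ∀ i, (x i).1 ^ 2 ≤ R ^ 2 := fun i => sq_le_sq' (abs_le.1 (hx i).1).1 (abs_le.1 (hx i).1).2
  exact (Finset.sum_le_sum fun i _ => h i).trans (by simp)

theorem IsPlaceIsometry.mem_box {n : ℕ} {k : Matrix (Fin n) (Fin n) (QS S)} (hk : IsPlaceIsometry k)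
    {x : Fin n → QS S} {R : ℝ} (hR : 0 ≤ R) (hx : x ∈ box S n R) : k *ᵥ x ∈ box S n (n * R) := by
  refine fun i => ⟨abs_le_of_realNormSq_le (by positivity) ?_ i,
    hk.mulVec_mem_iff.2 (fun i => (hx i).2) i⟩
  rw [hk.realNormSq_mulVec]
  refine (realNormSq_le_of_mem_box hx).trans ?_
  rw [mul_pow]
  have : (n : ℝ) ≤ (n : ℝ) ^ 2 := by
    rcases Nat.eq_zero_or_pos n with rfl | h
    · simp
    · exact le_self_pow₀ (by exact_mod_cast h) two_ne_zero
  exact mul_le_mul_of_nonneg_right this (sq_nonneg R)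

theorem latticeCount_le_of_isPlaceIsometry {n : ℕ} {k g : Matrix (Fin n) (Fin n) (QS S)}
    {γ : Matrix (Fin n) (Fin n) (SInt S)} (hk : IsPlaceIsometry k) (hγ : γ.det = 1) {R : ℝ}
    (hR : 0 ≤ R) : latticeCount g R ≤ latticeCount (k * g * γ.map (toQS S)) (n * R) := by
  have h1 : γ * γ.adjugate = 1 := by rw [Matrix.mul_adjugate, hγ, one_smul]
  refine Set.encard_le_encard_of_injOn (f := fun z => γ.adjugate *ᵥ z) ?_ ?_
  · intro z hz
    have h2 : (k * g * γ.map (toQS S)) *ᵥ (fun i => toQS S ((γ.adjugate *ᵥ z) i)) =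
        k *ᵥ (g *ᵥ fun i => toQS S (z i)) := by
      have h3 : (γ.map (toQS S)) *ᵥ (fun i => toQS S ((γ.adjugate *ᵥ z) i)) =
          fun i => toQS S (z i) := by
        funext i
        refine (RingHom.map_mulVec (toQS S) γ (γ.adjugate *ᵥ z) i).symm.trans ?_
        rw [Matrix.mulVec_mulVec, h1, Matrix.one_mulVec]
      rw [← Matrix.mulVec_mulVec, h3, Matrix.mulVec_mulVec]
    change _ ∈ box S n _
    rw [h2]
    exact hk.mem_box hR hz
  · intro z _ z' _ h
    have h2 := congrArg (γ *ᵥ ·) h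
    simpa [Matrix.mulVec_mulVec, h1] using h2

/-- The size of a vector of a reduced basis is comparable to the diagonal entry. -/
theorem IsSiegel.col_mem_box {n : ℕ} {k g : Matrix (Fin n) (Fin n) (QS S)}
    {γ : Matrix (Fin n) (Fin n) (SInt S)} (hk : IsPlaceIsometry k)
    (hT : IsSiegel (k * g * γ.map (toQS S))) (i : Fin n) :
    (g *ᵥ fun j => toQS S (γ j i)) ∈ box S n (n * (2 ^ n * ((k * g * γ.map (toQS S)) i i).1)) := by
  set T := k * g * γ.map (toQS S) with hTdef
  have h1 : k *ᵥ (g *ᵥ fun j => toQS S (γ j i)) = fun j => T j i := by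
    rw [Matrix.mulVec_mulVec]; rfl
  have h2 : (fun j => T j i) ∈ box S n (2 ^ n * (T i i).1) := by
    refine fun j => ⟨?_, hT.mem_OS j i⟩
    rcases lt_or_ge i j with h | h
    · have := (hT.pos i).le
      change |(T j i).1| ≤ _
      rw [hT.lower j i h]
      simp only [Prod.fst_zero, abs_zero]
      positivity
    · exact (hT.abs_le j i).trans (hT.diag_le j i h)
  have h0 : 0 ≤ 2 ^ n * (T i i).1 := mul_nonneg (by positivity) (hT.pos i).le
  refine fun j => ⟨abs_le_of_realNormSq_le (by positivity) ?_ j,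
    hk.mulVec_mem_iff.1 (fun j => by rw [h1]; exact hT.mem_OS j i) j⟩
  rw [← hk.realNormSq_mulVec, h1]
  refine (realNormSq_le_of_mem_box h2).trans ?_
  rw [mul_pow (n : ℝ)]
  have : (n : ℝ) ≤ (n : ℝ) ^ 2 := le_self_pow₀ (by exact_mod_cast i.pos) two_ne_zero
  exact mul_le_mul_of_nonneg_right this (sq_nonneg _)

/-- The length of the longest initial segment of `{0, …, n - 1}` on which a property holds. -/
theorem exists_le_forall_lt (P : ℕ → Prop) (n : ℕ) :
    ∃ s ≤ n, (∀ i < s, P i) ∧ (s < n → ¬ P s) := by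
  induction n with
  | zero => exact ⟨0, le_rfl, by simp, by simp⟩
  | succ n ih =>
    obtain ⟨s, hs, h1, h2⟩ := ih
    by_cases h : s = n ∧ P n
    · refine ⟨n + 1, le_rfl, fun i hi => ?_, by simp⟩
      rcases Nat.lt_succ_iff_lt_or_eq.1 hi with h3 | rfl
      · exact h1 i (h.1 ▸ h3)
      · exact h.2
    · refine ⟨s, hs.trans n.le_succ, h1, fun _ hP => ?_⟩
      rcases hs.lt_or_eq with h3 | rfl
      · exact h2 h3 hP
      · exact h ⟨rfl, hP⟩

/-- Only the short vectors of a reduced basis contribute to the number of lattice vectors in a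
box; the last basis vector of a unimodular lattice is never short. -/
theorem IsSiegel.exists_prod_le {n : ℕ} {T : Matrix (Fin (n + 1)) (Fin (n + 1)) (QS S)}
    (hT : IsSiegel T) (hdet : (T.det).1 = 1) {R : ℝ} (hR : 1 ≤ R) :
    ∃ (s : ℕ) (hs : s ≤ n + 1), s ≤ n ∧
      (∀ i : Fin s, (T (Fin.castLE hs i) (Fin.castLE hs i)).1 ≤
        2 ^ ((n + 1) * (n + 1)) * R) ∧
      ∏ i, (2 * (R / (T i i).1) + 2) ≤ (4 * (2 ^ ((n + 1) * (n + 1)) * R)) ^ (n + 1) *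
        ∏ i : Fin s, ((T (Fin.castLE hs i) (Fin.castLE hs i)).1)⁻¹ := by
  set ρ : ℝ := 2 ^ ((n + 1) * (n + 1)) * R with hρ
  have h2 : (2 : ℝ) ^ (n + 1) ≤ 2 ^ ((n + 1) * (n + 1)) :=
    pow_le_pow_right₀ one_le_two (Nat.le_mul_self _)
  have h3 : (1 : ℝ) ≤ 2 ^ ((n + 1) * (n + 1)) := one_le_pow₀ one_le_two
  have hρR : R ≤ ρ := le_mul_of_one_le_left (by linarith) h3
  -- the last diagonal entry is the largest one up to a constant, and the product of all is `1`
  have hlast : 1 ≤ 2 ^ ((n + 1) * (n + 1)) * (T (Fin.last n) (Fin.last n)).1 := by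
    have h4 : (1 : ℝ) ≤ (2 ^ (n + 1) * (T (Fin.last n) (Fin.last n)).1) ^ (n + 1) := by
      calc (1 : ℝ) = ∏ i, (T i i).1 := by rw [← hT.det_fst, hdet]
        _ ≤ ∏ _i : Fin (n + 1), 2 ^ (n + 1) * (T (Fin.last n) (Fin.last n)).1 :=
          Finset.prod_le_prod (fun i _ => (hT.pos i).le) fun i _ =>
            hT.diag_le i _ (Fin.le_last i)
        _ = _ := by simp
    have h5 : 1 ≤ 2 ^ (n + 1) * (T (Fin.last n) (Fin.last n)).1 := by
      by_contra h
      push Not at h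
      exact absurd h4 (not_le.2 (pow_lt_one₀ (mul_nonneg (by positivity) (hT.pos _).le) h
        (Nat.succ_ne_zero n)))
    exact h5.trans (mul_le_mul_of_nonneg_right h2 (hT.pos _).le)
  -- `s` is the number of short vectors before the first long one, the last vector not counted
  obtain ⟨s, hs, h1, hlt⟩ := exists_le_forall_lt
    (fun i => ∀ h : i < n + 1, (T ⟨i, h⟩ ⟨i, h⟩).1 ≤ ρ) n
  refine ⟨s, hs.trans n.le_succ, hs, fun i => h1 i i.2 (by omega), ?_⟩
  -- once a diagonal entry exceeds `ρ`, all later ones are at least `1`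
  have hbig : ∀ i : Fin (n + 1), s ≤ (i : ℕ) → 2 * (R / (T i i).1) + 2 ≤ 4 * ρ := by
    intro i hi
    have hρ1 : 1 ≤ ρ := hR.trans hρR
    have h4 : R / (T i i).1 ≤ ρ := by
      rw [div_le_iff₀ (hT.pos i)]
      rcases (Fin.le_last i).lt_or_eq with hi' | rfl
      · have hsn : s < n := lt_of_le_of_lt hi hi'
        have h5 := hlt hsn
        push Not at h5
        obtain ⟨h6, h7⟩ := h5
        have h8 := hT.diag_le ⟨s, h6⟩ i hi
        have h9 : 1 ≤ (T i i).1 := by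
          have h10 : 2 ^ (n + 1) ≤ 2 ^ (n + 1) * (T i i).1 := by
            refine le_trans ?_ (h7.le.trans h8)
            exact h2.trans (le_mul_of_one_le_right (by positivity) hR)
          exact (le_mul_iff_one_le_right (by positivity)).1 h10
        nlinarith
      · rw [hρ]
        nlinarith
    linarith
  have hsmall : ∀ i : Fin (n + 1), (i : ℕ) < s →
      2 * (R / (T i i).1) + 2 ≤ 4 * ρ * ((T i i).1)⁻¹ := by
    intro i hi
    have h4 : (T i i).1 ≤ ρ := h1 i hi i.2
    have h5 := hT.pos i
    rw [← div_eq_mul_inv, le_div_iff₀ h5, add_mul, mul_assoc, div_mul_cancel₀ _ h5.ne']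
    linarith
  have h6 : ∏ i : Fin s, ((T (Fin.castLE (hs.trans n.le_succ) i)
      (Fin.castLE (hs.trans n.le_succ) i)).1)⁻¹ =
      ∏ i : Fin (n + 1), if (i : ℕ) < s then ((T i i).1)⁻¹ else 1 := by
    rw [← Finset.prod_filter]
    refine Finset.prod_bij (fun i _ => Fin.castLE (hs.trans n.le_succ) i) ?_ ?_ ?_ ?_
    · intro i _
      simp
    · intro i _ j _ h
      exact Fin.castLE_injective _ h
    · intro i hi
      exact ⟨⟨i, (Finset.mem_filter.1 hi).2⟩, Finset.mem_univ _, rfl⟩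
    · intro i _
      rfl
  rw [h6]
  calc ∏ i, (2 * (R / (T i i).1) + 2)
      ≤ ∏ i : Fin (n + 1), (4 * ρ * if (i : ℕ) < s then ((T i i).1)⁻¹ else 1) := by
        refine Finset.prod_le_prod (fun i _ => ?_) fun i _ => ?_
        · have := hT.pos i
          positivity
        · split_ifs with h
          · exact hsmall i h
          · rw [mul_one]
            exact hbig i (not_lt.1 h)
    _ = _ := by rw [Finset.prod_mul_distrib]; simp

/-! ### The moments of the number of lattice vectors in a box -/

theorem measurableSet_box (n : ℕ) (R : ℝ) : MeasurableSet (box S n R) :=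
  (isCompact_box n R).measurableSet

theorem pi_muQS_box (n : ℕ) (R : ℝ) :
    (Measure.pi fun _ : Fin n => muQS S) (box S n R) = ENNReal.ofReal (2 * R) ^ n := by
  have h1 : ∀ p : S, padicHaar p.1.1 (Metric.closedBall (0 : ℚ_[p.1.1]) 1) = 1 := fun p =>
    Measure.addHaarMeasure_self
  rw [box_eq_pi, Measure.pi_pi]
  simp only [muQS, Measure.prod_prod, Measure.pi_pi, h1, Real.volume_Icc, Finset.prod_const_one,
    mul_one, Finset.prod_const, Finset.card_univ, Fintype.card_fin]
  rw [sub_neg_eq_add, ← two_mul]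

/-- A majorant of `C^k` times the power `-k` of the real size of an integral vector, as a sum over
dyadic boxes. -/
noncomputable def dyadic (S : Finset PrimeNum) (n k : ℕ) (C : ℝ) (x : Fin n → QS S) : ENNReal :=
  ∑' j : ℕ, (2 : ENNReal) ^ (k * j) * (box S n (C * (1 / 2) ^ j)).indicator 1 x

theorem measurable_dyadic (n k : ℕ) (C : ℝ) : Measurable (dyadic S n k C) :=
  Measurable.tsum fun _ => (measurable_one.indicator (measurableSet_box _ _)).const_mul _

/-- The integrability of `|x|^{-k}` near the origin of `ℝ^n` for `k < n`. -/
theorem lintegral_dyadic_ne_top {n k : ℕ} (hk : k < n) {C : ℝ} (hC : 0 ≤ C) :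
    ∫⁻ x, dyadic S n k C x ∂(Measure.pi fun _ : Fin n => muQS S) ≠ ⊤ := by
  have hm : ∀ j, Measurable ((box S n (C * (1 / 2) ^ j)).indicator
      (1 : (Fin n → QS S) → ENNReal)) := fun j => measurable_one.indicator (measurableSet_box _ _)
  simp only [dyadic]
  rw [lintegral_tsum fun j => ((hm j).const_mul _).aemeasurable]
  have h1 : ∀ j : ℕ, ∫⁻ x, (2 : ENNReal) ^ (k * j) * (box S n (C * (1 / 2) ^ j)).indicator 1 x
      ∂(Measure.pi fun _ : Fin n => muQS S) ≤ ENNReal.ofReal (2 * C) ^ n * (2⁻¹ : ENNReal) ^ j := by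
    intro j
    rw [lintegral_const_mul _ (hm j), lintegral_indicator_one (measurableSet_box _ _),
      pi_muQS_box n, ← mul_assoc, ENNReal.ofReal_mul (by positivity), mul_pow,
      mul_left_comm]
    refine mul_le_mul_right ?_ _
    have h2 : ENNReal.ofReal ((1 / 2) ^ j) = (2⁻¹ : ENNReal) ^ j := by
      rw [ENNReal.ofReal_pow (by norm_num), one_div, ENNReal.ofReal_inv_of_pos two_pos]
      simp
    have h3 : (2 : ENNReal) ^ (k * j) * (2⁻¹ : ENNReal) ^ (k * j) = 1 := by
      rw [← mul_pow, ENNReal.mul_inv_cancel (by simp) (by simp), one_pow]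
    rw [h2, ← pow_mul, mul_comm j n]
    calc (2 : ENNReal) ^ (k * j) * 2⁻¹ ^ (n * j)
        = (2 : ENNReal) ^ (k * j) * (2⁻¹ ^ (k * j) * 2⁻¹ ^ ((n - k) * j)) := by
          rw [← pow_add, ← add_mul, Nat.add_sub_cancel' hk.le]
      _ = 2⁻¹ ^ ((n - k) * j) := by rw [← mul_assoc, h3, one_mul]
      _ ≤ 2⁻¹ ^ j := by
        refine pow_le_pow_right_of_le_one' (by simp) ?_
        exact Nat.le_mul_of_pos_left j (by omega)
  refine ne_top_of_le_ne_top ?_ (ENNReal.tsum_le_tsum h1)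
  rw [ENNReal.tsum_mul_left, ENNReal.tsum_geometric]
  exact ENNReal.mul_ne_top (ENNReal.pow_ne_top ENNReal.ofReal_ne_top) (by simp)

/-- The dyadic majorant bounds `a^{-k}` for every vector whose size is at most a constant times
`a`. -/
theorem le_dyadic {n k : ℕ} {c ρ a : ℝ} (hc : 0 ≤ c) (hρ : 1 ≤ ρ) (ha : 0 < a) (haρ : a ≤ ρ)
    {x : Fin n → QS S} (hx : x ∈ box S n (c * a)) :
    ENNReal.ofReal a⁻¹ ^ k ≤ 2 ^ k * dyadic S n k (c * ρ) x := by
  obtain ⟨j, hj1, hj2⟩ := exists_nat_pow_near_of_lt_one (x := a / ρ) (y := 1 / 2)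
    (by positivity) ((div_le_one (by linarith)).2 haρ) (by norm_num) (by norm_num)
  have h1 : x ∈ box S n (c * ρ * (1 / 2) ^ j) := by
    refine box_mono ?_ hx
    rw [mul_assoc]
    refine mul_le_mul_of_nonneg_left ?_ hc
    rwa [div_le_iff₀' (by linarith)] at hj2
  have h2 : (2 : ENNReal) ^ (k * j) ≤ dyadic S n k (c * ρ) x := by
    refine le_trans (le_of_eq ?_) (ENNReal.le_tsum j)
    rw [Set.indicator_of_mem h1, Pi.one_apply, mul_one]
  have h3 : ENNReal.ofReal a⁻¹ ≤ 2 ^ (j + 1) := by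
    have h4 : a⁻¹ ≤ 2 ^ (j + 1) := by
      rw [one_div, inv_pow, lt_div_iff₀ (by linarith)] at hj1
      refine inv_le_of_inv_le₀ (by positivity) (le_trans ?_ hj1.le)
      exact le_mul_of_one_le_right (by positivity) hρ
    refine (ENNReal.ofReal_le_ofReal h4).trans_eq ?_
    rw [ENNReal.ofReal_pow (by norm_num)]
    simp
  calc ENNReal.ofReal a⁻¹ ^ k ≤ (2 ^ (j + 1)) ^ k := pow_le_pow_left' h3 k
    _ = 2 ^ k * 2 ^ (k * j) := by rw [← pow_mul, ← pow_add]; congr 1; ring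
    _ ≤ _ := mul_le_mul_right h2 _

theorem lintegral_prod_apply {α : Type*} [MeasurableSpace α] (μ : Measure α) [SigmaFinite μ]
    {f : α → ENNReal} (hf : Measurable f) (n : ℕ) :
    ∫⁻ w : Fin n → α, ∏ i, f (w i) ∂(Measure.pi fun _ => μ) = (∫⁻ x, f x ∂μ) ^ n := by
  induction n with
  | zero => simp
  | succ n ih =>
    have h1 := (measurePreserving_piFinSuccAbove (fun _ : Fin (n + 1) => μ) 0).symm
    have hm : ∀ n : ℕ, Measurable fun w : Fin n → α => ∏ i, f (w i) := fun n =>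
      Finset.measurable_prod _ fun i _ => hf.comp (measurable_pi_apply i)
    rw [← h1.lintegral_comp (hm (n + 1))]
    have h2 : ∀ a : α × (Fin n → α), ∏ i, f ((MeasurableEquiv.piFinSuccAbove
        (fun _ : Fin (n + 1) => α) 0).symm a i) = f a.1 * ∏ i, f (a.2 i) := fun a => by
      rw [Fin.prod_univ_succ]
      simp [MeasurableEquiv.piFinSuccAbove]
    simp only [h2]
    rw [lintegral_prod_mul hf.aemeasurable (hm n).aemeasurable, ih, pow_succ']

theorem lintegral_prod_dyadic_ne_top {n k : ℕ} (hk : k < n) {C : ℝ} (hC : 0 ≤ C) (r : ℕ) :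
    ∫⁻ w, ∏ i, dyadic S n k C (w i) ∂(muVec S n r) ≠ ⊤ := by
  rw [muVec, lintegral_prod_apply _ (measurable_dyadic n k C)]
  exact ENNReal.pow_ne_top (lintegral_dyadic_ne_top hk hC)

/-- Domination of the powers of the number of lattice vectors in a box by sums over primitive
tuples. -/
theorem exists_latticeCount_pow_le (d k : ℕ) {R : ℝ} (hR : 1 ≤ R) : ∃ K : ENNReal, K ≠ ⊤ ∧
    ∃ C : ℝ, 0 ≤ C ∧ ∀ g : Matrix (Fin (d + 1)) (Fin (d + 1)) (QS S), (g.det).1 = 1 →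
      (∀ p, ‖(g.det).2 p‖ = 1) → (latticeCount g R : ENNReal) ^ k ≤
        ∑ r : Fin (d + 1), K * orbitSum (primitiveTuples S r.2.le)
          (fun w => ∏ i, dyadic S (d + 1) k C (w i)) g := by
  set n := d + 1 with hn
  have hn1 : (1 : ℝ) ≤ n := by exact_mod_cast Nat.le_add_left 1 d
  set R' : ℝ := n * R with hR'
  have hR'1 : 1 ≤ R' := one_le_mul_of_one_le_of_one_le hn1 hR
  set ρ : ℝ := 2 ^ (n * n) * R' with hρ
  have hρ1 : 1 ≤ ρ := one_le_mul_of_one_le_of_one_le (one_le_pow₀ one_le_two) hR'1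
  set c : ℝ := n * 2 ^ n with hc
  have hc0 : 0 ≤ c := by positivity
  refine ⟨ENNReal.ofReal ((4 * ρ) ^ n) ^ k * (2 ^ k) ^ n, ENNReal.mul_ne_top (by simp) (by simp),
    c * ρ, by positivity, fun g hg hgp => ?_⟩
  obtain ⟨κ, γ, hκ, hγ, hT⟩ := exists_isSiegel n g (by rw [hg]; exact one_ne_zero) hgp
  set T := κ * g * γ.map (toQS S) with hTdef
  have hdet : (T.det).1 = 1 := by
    have h1 : |(T.det).1| = 1 := by
      rw [hTdef, Matrix.det_mul, Matrix.det_mul, det_toQS, hγ, map_one, mul_one, Prod.fst_mul,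
        abs_mul, hκ.abs_det, one_mul, hg, abs_one]
    rwa [abs_of_nonneg] at h1
    rw [hT.det_fst]
    exact Finset.prod_nonneg fun i _ => (hT.pos i).le
  obtain ⟨N, hN1, hN2⟩ := hT.exists_latticeCount_le (zero_le_one.trans hR'1)
  obtain ⟨s, hs, hsd, hs1, hs2⟩ := hT.exists_prod_le hdet hR'1
  have hcount : latticeCount g R ≤ N :=
    (latticeCount_le_of_isPlaceIsometry hκ hγ (zero_le_one.trans hR)).trans hN1
  let a : Fin s → ℝ := fun i => (T (Fin.castLE hs i) (Fin.castLE hs i)).1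
  have ha : ∀ i, 0 < a i := fun i => hT.pos _
  let Y : Fin s → Fin n → SInt S := fun i j => γ j (Fin.castLE hs i)
  have hY : Y ∈ primitiveTuples S hs := ⟨γ, hγ, fun _ _ => rfl⟩
  have hstep : (latticeCount g R : ENNReal) ^ k ≤ ENNReal.ofReal ((4 * ρ) ^ n) ^ k * (2 ^ k) ^ n *
      ∏ i, dyadic S n k (c * ρ) (tupleMul g (intTuple Y) i) := by
    calc (latticeCount g R : ENNReal) ^ k ≤ (N : ENNReal) ^ k :=
          pow_le_pow_left' ((ENat.toENNReal_mono hcount).trans_eq (by simp)) k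
      _ ≤ ENNReal.ofReal ((4 * ρ) ^ n * ∏ i, (a i)⁻¹) ^ k := by
          refine pow_le_pow_left' ?_ k
          rw [← ENNReal.ofReal_natCast]
          exact ENNReal.ofReal_le_ofReal (hN2.trans hs2)
      _ = ENNReal.ofReal ((4 * ρ) ^ n) ^ k * ∏ i, ENNReal.ofReal (a i)⁻¹ ^ k := by
          rw [ENNReal.ofReal_mul (by positivity), mul_pow,
            ENNReal.ofReal_prod_of_nonneg fun i _ => inv_nonneg.2 (ha i).le, Finset.prod_pow]
      _ ≤ ENNReal.ofReal ((4 * ρ) ^ n) ^ k * ∏ i,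
            (2 ^ k * dyadic S n k (c * ρ) (tupleMul g (intTuple Y) i)) := by
          refine mul_le_mul_right (Finset.prod_le_prod' fun i _ => ?_) _
          refine le_dyadic hc0 hρ1 (ha i) (hs1 i) ?_
          rw [hc, mul_assoc]
          exact hT.col_mem_box hκ (Fin.castLE hs i)
      _ ≤ _ := by
          rw [Finset.prod_mul_distrib, ← mul_assoc]
          refine mul_le_mul' (mul_le_mul' le_rfl ?_) le_rfl
          rw [Finset.prod_const, Finset.card_univ, Fintype.card_fin]
          exact pow_le_pow_right₀ (one_le_pow₀ (by norm_num)) hs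
  refine hstep.trans ?_
  let rs : Fin n := ⟨s, Nat.lt_succ_of_le hsd⟩
  refine le_trans ?_ (Finset.single_le_sum (f := fun r : Fin n => _ * orbitSum
    (primitiveTuples S r.2.le) (fun w => ∏ i, dyadic S n k (c * ρ) (w i)) g)
    (fun _ _ => zero_le) (Finset.mem_univ rs))
  refine mul_le_mul_right ?_ _
  exact ENNReal.le_tsum (f := fun Y' : primitiveTuples S hs =>
    ∏ i, dyadic S n k (c * ρ) (tupleMul g (intTuple Y'.1) i)) ⟨Y, hY⟩

/-- The number of lattice vectors in a box has finite moments of all orders `k < d`. -/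
theorem lintegral_latticeCount_pow_ne_top {d : ℕ} {G : Subgroup (GL (Fin d) (QS S))}
    [MeasurableSpace (Space G)] [BorelSpace (Space G)] (hUL : G ≤ ULQ d S)
    (hSL : SLQ d S ≤ G) (m : Measure (Space G)) [IsFiniteMeasure m]
    [SMulInvariantMeasure G (Space G) m] {s : Space G → G} (hs : IsSection s) {k : ℕ} (hk : k < d)
    (R : ℝ) :
    ∫⁻ x, (latticeCount (s x : GL (Fin d) (QS S)).1 R : ENNReal) ^ k ∂m ≠ ⊤ := by
  obtain ⟨d, rfl⟩ : ∃ e, d = e + 1 := ⟨d - 1, by omega⟩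
  obtain ⟨K, hK, C, hC, hle⟩ := exists_latticeCount_pow_le (S := S) d k (le_max_left 1 R)
  have hF : ∀ r : Fin (d + 1), Measurable fun w : Fin r → Fin (d + 1) → QS S =>
      ∏ i, dyadic S (d + 1) k C (w i) := fun r =>
    Finset.measurable_prod _ fun i _ => (measurable_dyadic _ _ _).comp (measurable_pi_apply i)
  have h1 : ∀ x, (latticeCount (s x : GL (Fin (d + 1)) (QS S)).1 R : ENNReal) ^ k ≤
      ∑ r : Fin (d + 1), K * orbitSum (primitiveTuples S r.2.le)
        (fun w => ∏ i, dyadic S (d + 1) k C (w i)) (s x : GL (Fin (d + 1)) (QS S)).1 := fun x => by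
    refine le_trans (pow_le_pow_left' (ENat.toENNReal_mono ?_) k) (hle _ (hUL (s x).2).1 (hUL (s x).2).2)
    exact Set.encard_le_encard fun z hz => box_mono (le_max_right 1 R) hz
  refine ne_top_of_le_ne_top ?_ (lintegral_mono h1)
  rw [lintegral_finsetSum _ fun r _ => (measurable_orbitSum_section hs _ (hF r)).const_mul _]
  refine ENNReal.sum_ne_top.2 fun r _ => ?_
  obtain ⟨c, hc⟩ := exists_tupleMeasure_primitiveTuples hUL hSL m hs r.2
  rw [lintegral_const_mul _ (measurable_orbitSum_section hs _ (hF r)),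
    ← lintegral_tupleMeasure hs _ (hF r), hc, lintegral_smul_measure]
  exact ENNReal.mul_ne_top hK (ENNReal.mul_ne_top ENNReal.coe_ne_top
    (lintegral_prod_dyadic_ne_top hk hC _))

/-! ### Counting integral points in parallelepipeds -/

/-- The integral points `x` for which `A x` lies in the cube with centre `a` and radius `ρ`. -/
def intPoints {d : ℕ} (A : Matrix (Fin d) (Fin d) ℝ) (a : Fin d → ℝ) (ρ : ℝ) : Set (Fin d → ℤ) :=
  {x | ∀ i, |(A *ᵥ fun j => (x j : ℝ)) i - a i| ≤ ρ}

section IntPoints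

variable {d : ℕ} {A : Matrix (Fin d) (Fin d) ℝ}

theorem volume_setOf_abs_mulVec_sub_le (hA : A.det ≠ 0) (a : Fin d → ℝ) (ρ : ℝ) :
    volume {y : Fin d → ℝ | ∀ i, |(A *ᵥ y) i - a i| ≤ ρ} =
      ENNReal.ofReal |A.det⁻¹| * ENNReal.ofReal (2 * ρ) ^ d := by
  have h1 : {y : Fin d → ℝ | ∀ i, |(A *ᵥ y) i - a i| ≤ ρ} =
      Matrix.toLin' A ⁻¹' Set.pi Set.univ fun i => Set.Icc (a i - ρ) (a i + ρ) := by
    ext y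
    simp only [Set.mem_ofPred_eq, Set.mem_preimage, Set.mem_pi, Set.mem_univ, true_imp_iff,
      Set.mem_Icc, Matrix.toLin'_apply, _root_.abs_le]
    exact forall_congr' fun i => ⟨fun h => ⟨by linarith, by linarith⟩,
      fun h => ⟨by linarith, by linarith⟩⟩
  have hm : Measurable (Matrix.toLin' A) := (LinearMap.continuous_of_finiteDimensional _).measurable
  have hpi : MeasurableSet (Set.pi Set.univ fun i => Set.Icc (a i - ρ) (a i + ρ)) :=
    MeasurableSet.univ_pi fun i => measurableSet_Icc
  rw [h1, ← Measure.map_apply hm hpi, Real.map_matrix_volume_pi_eq_smul_volume_pi hA,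
    Measure.smul_apply, smul_eq_mul, volume_pi_pi]
  congr 1
  simp only [Real.volume_Icc]
  rw [Finset.prod_congr rfl fun i _ => by rw [show a i + ρ - (a i - ρ) = 2 * ρ by ring]]
  simp

theorem exists_abs_mulVec_le (A : Matrix (Fin d) (Fin d) ℝ) : ∃ C : ℝ, 0 ≤ C ∧
    ∀ t : Fin d → ℝ, (∀ i, |t i| ≤ 1) → ∀ i, |(A *ᵥ t) i| ≤ C := by
  refine ⟨∑ i, ∑ j, |A i j|, by positivity, fun t ht i => ?_⟩
  calc |(A *ᵥ t) i| ≤ ∑ j, |A i j * t j| :=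
        Finset.abs_sum_le_sum_abs (fun j => A i j * t j) Finset.univ
    _ ≤ ∑ j, |A i j| := Finset.sum_le_sum fun j _ => by
        rw [abs_mul]
        exact mul_le_of_le_one_right (abs_nonneg _) (ht j)
    _ ≤ _ := Finset.single_le_sum (f := fun i => ∑ j, |A i j|)
        (fun _ _ => Finset.sum_nonneg fun _ _ => abs_nonneg _) (Finset.mem_univ i)

/-- The half-open unit cube with lower corner `x`. -/
def unitCube (x : Fin d → ℤ) : Set (Fin d → ℝ) :=
  Set.pi Set.univ fun i => Set.Ico (x i : ℝ) (x i + 1)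

theorem volume_unitCube (x : Fin d → ℤ) : volume (unitCube x) = 1 := by
  rw [unitCube, volume_pi_pi]
  simp

theorem mem_unitCube_iff {x : Fin d → ℤ} {y : Fin d → ℝ} :
    y ∈ unitCube x ↔ ∀ i, ⌊y i⌋ = x i := by
  simp only [unitCube, Set.mem_pi, Set.mem_univ, true_imp_iff, Set.mem_Ico, Int.floor_eq_iff]

theorem abs_mulVec_sub_le_of_mem_unitCube {C : ℝ}
    (hC : ∀ t : Fin d → ℝ, (∀ i, |t i| ≤ 1) → ∀ i, |(A *ᵥ t) i| ≤ C) {x : Fin d → ℤ}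
    {y : Fin d → ℝ} (hy : y ∈ unitCube x) (i : Fin d) :
    |(A *ᵥ y) i - (A *ᵥ fun j => (x j : ℝ)) i| ≤ C := by
  rw [← Pi.sub_apply, ← Matrix.mulVec_sub]
  refine hC _ (fun j => ?_) i
  have h := hy j (Set.mem_univ _)
  rw [Pi.sub_apply, abs_of_nonneg (by linarith [h.1])]
  linarith [h.2]

/-- The disjoint unit cubes at the integral points lie in a slightly larger parallelepiped. -/
theorem encard_intPoints_le (hA : A.det ≠ 0) {C : ℝ}
    (hC : ∀ t : Fin d → ℝ, (∀ i, |t i| ≤ 1) → ∀ i, |(A *ᵥ t) i| ≤ C) (a : Fin d → ℝ) (ρ : ℝ) :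
    ((intPoints A a ρ).encard : ENNReal) ≤
      ENNReal.ofReal |A.det⁻¹| * ENNReal.ofReal (2 * (ρ + C)) ^ d := by
  rw [← volume_setOf_abs_mulVec_sub_le hA a, ← ENNReal.tsum_set_one]
  have h1 : (intPoints A a ρ).PairwiseDisjoint unitCube := by
    intro x _ x' _ hxx
    refine Set.disjoint_left.2 fun y hy hy' => hxx (funext fun i => ?_)
    rw [← mem_unitCube_iff.1 hy i, mem_unitCube_iff.1 hy' i]
  have h2 := measure_biUnion (μ := volume) (Set.to_countable (intPoints A a ρ)) h1 fun x _ =>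
    MeasurableSet.univ_pi fun i => measurableSet_Ico
  simp only [volume_unitCube] at h2
  rw [← h2]
  refine measure_mono (Set.iUnion₂_subset fun x hx y hy i => ?_)
  have h3 := abs_mulVec_sub_le_of_mem_unitCube hC hy i
  have h4 := abs_sub_le ((A *ᵥ y) i) ((A *ᵥ fun j => (x j : ℝ)) i) (a i)
  have := hx i
  linarith

/-- The unit cubes at the integral points cover a slightly smaller parallelepiped. -/
theorem le_encard_intPoints (hA : A.det ≠ 0) {C : ℝ}
    (hC : ∀ t : Fin d → ℝ, (∀ i, |t i| ≤ 1) → ∀ i, |(A *ᵥ t) i| ≤ C) (a : Fin d → ℝ) (ρ : ℝ) :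
    ENNReal.ofReal |A.det⁻¹| * ENNReal.ofReal (2 * (ρ - C)) ^ d ≤
      ((intPoints A a ρ).encard : ENNReal) := by
  rw [← volume_setOf_abs_mulVec_sub_le hA a, ← ENNReal.tsum_set_one]
  have h2 := measure_biUnion_le volume (Set.to_countable (intPoints A a ρ)) (unitCube (d := d))
  simp only [volume_unitCube] at h2
  refine (measure_mono fun y hy => ?_).trans h2
  have hx : y ∈ unitCube fun i => ⌊y i⌋ := mem_unitCube_iff.2 fun _ => rfl
  refine Set.mem_iUnion₂.2 ⟨_, fun i => ?_, hx⟩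
  have h3 := abs_mulVec_sub_le_of_mem_unitCube hC hx i
  have h4 := abs_sub_le ((A *ᵥ fun j => ((⌊y j⌋ : ℤ) : ℝ)) i) ((A *ᵥ y) i) (a i)
  rw [abs_sub_comm ((A *ᵥ fun j => ((⌊y j⌋ : ℤ) : ℝ)) i) ((A *ᵥ y) i)] at h4
  have := hy i
  linarith

theorem finite_intPoints (hA : A.det ≠ 0) (a : Fin d → ℝ) (ρ : ℝ) : (intPoints A a ρ).Finite := by
  obtain ⟨C, -, hC⟩ := exists_abs_mulVec_le A
  have h := encard_intPoints_le hA hC a ρ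
  rw [← Set.encard_ne_top_iff]
  intro htop
  rw [htop] at h
  exact absurd h (not_le.2 (ENNReal.mul_lt_top ENNReal.ofReal_lt_top
    (ENNReal.pow_lt_top ENNReal.ofReal_lt_top)))

/-- The number of integral points in a dilated parallelepiped is asymptotic to the volume. -/
theorem tendsto_card_intPoints (hA : A.det ≠ 0) (a b : Fin d → ℝ) {ε : ℝ} (hε : 0 < ε) :
    Filter.Tendsto (fun n : ℕ => (Nat.card (intPoints A (n • a - b) (n * ε)) : ℝ) / (n : ℝ) ^ d)
      Filter.atTop (nhds (|A.det⁻¹| * (2 * ε) ^ d)) := by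
  obtain ⟨C, hC0, hC⟩ := exists_abs_mulVec_le A
  have hcast : ∀ n : ℕ, ((intPoints A (n • a - b) (n * ε)).encard : ENNReal) =
      ENNReal.ofReal (Nat.card (intPoints A (n • a - b) (n * ε))) := fun n => by
    rw [ENNReal.ofReal_natCast, Nat.card_coe_set_eq,
      ← (finite_intPoints hA (n • a - b) (n * ε)).cast_ncard_eq]
    simp
  have hlim : ∀ D : ℝ, Filter.Tendsto (fun n : ℕ => |A.det⁻¹| * (2 * (ε + D / n)) ^ d)
      Filter.atTop (nhds (|A.det⁻¹| * (2 * ε) ^ d)) := fun D => by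
    have h1 := tendsto_const_div_atTop_nhds_zero_nat D
    have h2 := (((h1.const_add ε).const_mul 2).pow d).const_mul |A.det⁻¹|
    simpa using h2
  refine tendsto_of_tendsto_of_tendsto_of_le_of_le' (hlim (-C)) (hlim C) ?_ ?_
  · filter_upwards [Filter.eventually_gt_atTop 0, Filter.eventually_ge_atTop ⌈C / ε⌉₊] with n hn hnC
    have hn' : (0 : ℝ) < n := by exact_mod_cast hn
    have h0 : 0 ≤ n * ε - C := by
      have := (Nat.ceil_le.1 hnC)
      rw [div_le_iff₀ hε] at this
      linarith
    have h1 := le_encard_intPoints hA hC (n • a - b) (n * ε)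
    rw [hcast, ← ENNReal.ofReal_pow (by linarith), ← ENNReal.ofReal_mul (abs_nonneg _),
      ENNReal.ofReal_le_ofReal_iff (by positivity)] at h1
    rw [le_div_iff₀ (by positivity), mul_assoc, ← mul_pow]
    have h2 : 2 * (ε + -C / n) * n = 2 * (n * ε - C) := by
      field_simp
      ring
    rwa [h2]
  · filter_upwards [Filter.eventually_gt_atTop 0] with n hn
    have hn' : (0 : ℝ) < n := by exact_mod_cast hn
    have h1 := encard_intPoints_le hA hC (n • a - b) (n * ε)
    rw [hcast, ← ENNReal.ofReal_pow (by positivity), ← ENNReal.ofReal_mul (abs_nonneg _),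
      ENNReal.ofReal_le_ofReal_iff (by positivity)] at h1
    rw [div_le_iff₀ (by positivity), mul_assoc, ← mul_pow]
    have h2 : 2 * (ε + C / n) * n = 2 * (n * ε + C) := by field_simp
    rwa [h2]

end IntPoints

/-! ### Tuples of full rank with rows in a sublattice, and their asymptotic number -/

/-- The tuples `Y` of linearly independent vectors for which `(1/q) Y D` is `S`-integral. The columns
of the matrix `Y` are the vectors `Y i`, so that the row with index `j` is `(Y i j)_i`. -/
def independentTuples (d : ℕ) {r k : ℕ} (D : Matrix (Fin r) (Fin k) (SInt S)) (q : ℕ) :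
    Set (Fin r → Fin d → SInt S) :=
  {Y | LinearIndependent ℚ (fun i j => (Y i j : ℚ)) ∧
    ∀ j c, (1 / (q : ℚ)) * ∑ i, (Y i j : ℚ) * (D i c : ℚ) ∈ SInt S}

section IndependentTuples

variable {d r k : ℕ} {D : Matrix (Fin r) (Fin k) (SInt S)} {q : ℕ}

theorem isStable_independentTuples : IsStable (independentTuples d D q) := by
  rintro γ hγ Y ⟨h1, h2⟩
  let γ' : Matrix (Fin d) (Fin d) ℚ := γ.map (SInt S).subtype
  have hγ' : IsUnit γ' := by
    rw [Matrix.isUnit_iff_isUnit_det]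
    have : γ'.det = 1 :=
      (RingHom.map_det (SInt S).subtype γ).symm.trans (by rw [hγ, map_one])
    rw [this]
    exact isUnit_one
  have hcoe : ∀ i j, (((γ *ᵥ Y i) j : SInt S) : ℚ) = (γ' *ᵥ fun j => (Y i j : ℚ)) j := fun i j =>
    RingHom.map_mulVec (SInt S).subtype γ (Y i) j
  constructor
  · have h3 := h1.map' (Matrix.mulVecLin γ') (LinearMap.ker_eq_bot.2
      (Matrix.mulVec_injective_iff_isUnit.2 hγ'))
    have h4 : (fun i j => (((γ *ᵥ Y i) j : SInt S) : ℚ)) =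
        Matrix.mulVecLin γ' ∘ fun i j => (Y i j : ℚ) := funext fun i => funext fun j => hcoe i j
    rw [← h4] at h3
    exact h3
  · intro j c
    have h3 : (1 / (q : ℚ)) * ∑ i, (((γ *ᵥ Y i) j : SInt S) : ℚ) * (D i c : ℚ) =
        ∑ l, (γ j l : ℚ) * ((1 / (q : ℚ)) * ∑ i, (Y i l : ℚ) * (D i c : ℚ)) := by
      simp only [hcoe]
      simp only [Matrix.mulVec, dotProduct, Finset.mul_sum, Finset.sum_mul]
      rw [Finset.sum_comm]
      refine Finset.sum_congr rfl fun l _ => Finset.sum_congr rfl fun i _ => ?_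
      simp only [γ', Matrix.map_apply, Subring.subtype_apply]
      ring
    rw [h3]
    exact sum_mem fun l _ => mul_mem (γ j l).2 (h2 l c)

theorem exists_leftInverse_of_linearIndependent {Y : Fin r → Fin d → SInt S}
    (h : LinearIndependent ℚ (fun i j => (Y i j : ℚ))) :
    ∃ σ : Matrix (Fin r) (Fin d) (QS S), σ * (Matrix.of (intTuple Y))ᵀ = 1 := by
  let B : Matrix (Fin d) (Fin r) ℚ := Matrix.of fun j i => (Y i j : ℚ)
  have hB : Function.Injective (Matrix.toLin' B) := Matrix.mulVec_injective_iff.2 h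
  obtain ⟨f, hf⟩ := LinearMap.exists_leftInverse_of_injective _ (LinearMap.ker_eq_bot.2 hB)
  have h1 : LinearMap.toMatrix' f * B = 1 := by
    rw [← LinearMap.toMatrix'_toLin' B, ← LinearMap.toMatrix'_comp, hf, LinearMap.toMatrix'_id]
  refine ⟨(LinearMap.toMatrix' f).map (diagQ S), ?_⟩
  have h2 : (Matrix.of (intTuple Y))ᵀ = B.map (diagQ S) := by ext1; rfl
  rw [h2, ← Matrix.map_mul, h1, Matrix.map_one _ (map_zero _) (map_one _)]

/-- Neighbourhoods of `n` times the tuple of the first `r` standard unit vectors. -/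
def nearMultiple (S : Finset PrimeNum) {d r : ℕ} (h : r ≤ d) (ε : ℝ) (n : ℕ) :
    Set (Fin r → Fin d → QS S) :=
  {w | ∀ i j, |(w i j).1 - n * (Pi.single (Fin.castLE h i) 1 : Fin d → ℝ) j| ≤ n * ε ∧
    w i j ∈ OS S}

/-- Near a multiple of the standard tuple the upper square block is diagonally dominant, which
makes the tuple independent. -/
theorem linearIndependent_of_mem_nearMultiple {h : r ≤ d} {ε : ℝ} (hε0 : 0 ≤ ε) (hε : ε * (r + 1) < 1) {n : ℕ}
    (hn : 0 < n) {g : Matrix (Fin d) (Fin d) (QS S)} {Y : Fin r → Fin d → SInt S}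
    (hY : tupleMul g (intTuple Y) ∈ nearMultiple S h ε n) :
    LinearIndependent ℚ (fun i j => (Y i j : ℚ)) := by
  have hn' : (0 : ℝ) < n := by exact_mod_cast hn
  let M : Matrix (Fin r) (Fin r) ℝ :=
    Matrix.of fun i l => (tupleMul g (intTuple Y) i (Fin.castLE h l)).1
  have hM : M.det ≠ 0 := by
    refine det_ne_zero_of_sum_row_lt_diag fun i => ?_
    have h1 : n * (1 - ε) ≤ ‖M i i‖ := by
      have h2 := (hY i (Fin.castLE h i)).1
      rw [Pi.single_eq_same, mul_one] at h2
      have h3 := (abs_le.1 h2).1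
      refine le_trans ?_ (le_abs_self _)
      change _ ≤ (tupleMul g (intTuple Y) i (Fin.castLE h i)).1
      linarith
    have h4 : ∀ l ∈ Finset.univ.erase i, ‖M i l‖ ≤ n * ε := fun l hl => by
      have h2 := (hY i (Fin.castLE h l)).1
      rw [Pi.single_eq_of_ne fun hh => (Finset.ne_of_mem_erase hl) (Fin.castLE_injective h hh),
        mul_zero, sub_zero] at h2
      exact h2
    refine (Finset.sum_le_card_nsmul _ _ _ h4).trans_lt (lt_of_lt_of_le ?_ h1)
    rw [Finset.card_erase_of_mem (Finset.mem_univ _), Finset.card_univ, Fintype.card_fin,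
      nsmul_eq_mul, Nat.cast_sub i.pos]
    push_cast
    have h5 : ε * r < 1 := by nlinarith
    nlinarith
  rw [Fintype.linearIndependent_iff]
  intro c hc
  have h1 : (fun i => (c i : ℝ)) ᵥ* M = 0 := by
    funext l
    have h2 : ∀ j, ∑ i, (c i : ℝ) * ((Y i j : ℚ) : ℝ) = 0 := fun j => by
      have h3 := congrFun hc j
      simp only [Finset.sum_apply, Pi.smul_apply, smul_eq_mul, Pi.zero_apply] at h3
      exact_mod_cast h3
    have h3 : ∀ i, M i l = ∑ j, (g (Fin.castLE h l) j).1 * ((Y i j : ℚ) : ℝ) := fun i =>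
      map_sum (atReal S) _ _
    simp only [Matrix.vecMul, dotProduct, h3, Finset.mul_sum, Pi.zero_apply]
    rw [Finset.sum_comm]
    refine Finset.sum_eq_zero fun j _ => ?_
    rw [← mul_zero (g (Fin.castLE h l) j).1, ← h2 j, Finset.mul_sum]
    exact Finset.sum_congr rfl fun i _ => by ring
  have h2 := Matrix.eq_zero_of_vecMul_eq_zero hM h1
  intro i
  simpa using congrFun h2 i

/-- The residues `x mod q` of the sublattice of all `x` for which `(1/q) x D` is `S`-integral. -/
def residues (D : Matrix (Fin r) (Fin k) (SInt S)) (q : ℕ) : Set (Fin r → Fin q) :=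
  {x | ∀ c, (1 / (q : ℚ)) * ∑ i, ((x i : ℕ) : ℚ) * (D i c : ℚ) ∈ SInt S}

noncomputable instance fintypeResidues : Fintype (residues D q) := Fintype.ofFinite _

theorem natCard_residues : Nat.card (residues D q) = NDq D q := rfl

theorem mem_residues_iff {y : Fin r → ℤ} {x : Fin r → Fin q} (t : Fin r → ℤ)
    (h : ∀ i, y i = (x i : ℕ) + q * t i) (hq : 0 < q) :
    x ∈ residues D q ↔ ∀ c, (1 / (q : ℚ)) * ∑ i, (y i : ℚ) * (D i c : ℚ) ∈ SInt S := by
  refine forall_congr' fun c => ?_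
  have hq' : (q : ℚ) ≠ 0 := by exact_mod_cast hq.ne'
  have h1 : (1 / (q : ℚ)) * ∑ i, (y i : ℚ) * (D i c : ℚ) =
      (1 / (q : ℚ)) * ∑ i, ((x i : ℕ) : ℚ) * (D i c : ℚ) + ∑ i, (t i : ℚ) * (D i c : ℚ) := by
    simp only [h, Finset.mul_sum, ← Finset.sum_add_distrib]
    refine Finset.sum_congr rfl fun i _ => ?_
    push_cast
    field_simp
  have h2 : ∑ i, (t i : ℚ) * (D i c : ℚ) ∈ SInt S :=
    sum_mem fun i _ => mul_mem (intCast_mem _ _) (D i c).2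
  rw [h1]
  exact (add_mem_cancel_right h2).symm

/-- For a basis `g` that is integral at the finite places, the tuples `Y` near a multiple of the
standard one are integral. Writing `Y = Z + q X` with residues `Z`, whose rows lie in the
sublattice, their number becomes a sum of numbers of integral points in parallelepipeds. -/
theorem natCard_setOf_tuples (h : r ≤ d) {ε : ℝ} (hε0 : 0 ≤ ε) (hε : ε * (r + 1) < 1) (hq : 0 < q)
    {g : Matrix (Fin d) (Fin d) (QS S)} (hg0 : (g.det).1 ≠ 0) (hgO : ∀ i j, g i j ∈ OS S)
    (hgp : ∀ p, ‖(g.det).2 p‖ = 1) {n : ℕ} (hn : 0 < n) :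
    {Y ∈ independentTuples d D q | tupleMul g (intTuple Y) ∈ nearMultiple S h ε n}.Finite ∧
    Nat.card {Y ∈ independentTuples d D q | tupleMul g (intTuple Y) ∈ nearMultiple S h ε n} =
      ∑ Z : Fin d → residues D q, ∏ i, Nat.card (intPoints ((q : ℝ) • g.map (atReal S))
        (n • (Pi.single (Fin.castLE h i) 1 : Fin d → ℝ) -
          g.map (atReal S) *ᵥ fun j => (((Z j).1 i : ℕ) : ℝ)) (n * ε)) := by
  classical
  set E := {Y ∈ independentTuples d D q | tupleMul g (intTuple Y) ∈ nearMultiple S h ε n} with hE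
  set A := g.map (atReal S) with hA
  set P := fun (Z : Fin d → residues D q) (i : Fin r) => intPoints ((q : ℝ) • A)
        (n • (Pi.single (Fin.castLE h i) 1 : Fin d → ℝ) -
          A *ᵥ fun j => (((Z j).1 i : ℕ) : ℝ)) (n * ε) with hP
  have hq' : (0 : ℝ) < q := by exact_mod_cast hq
  have hdet : ((q : ℝ) • A).det ≠ 0 := by
    rw [Matrix.det_smul, ← det_fst]
    exact mul_ne_zero (pow_ne_zero _ hq'.ne') hg0
  have hfin : ∀ Z i, Finite (P Z i) := fun Z i => (finite_intPoints hdet _ _).to_subtype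
  let toY : (Fin d → residues D q) → (Fin r → Fin d → ℤ) → Fin r → Fin d → SInt S :=
    fun Z X i j => ((((Z j).1 i : ℕ) + q * X i j : ℤ) : SInt S)
  -- the real components of `g Y` for an integral tuple `Y = Z + q X`
  have hreal : ∀ Z X i j, (tupleMul g (intTuple (toY Z X)) i j).1 =
      (A *ᵥ fun j => (((Z j).1 i : ℕ) : ℝ)) j + (((q : ℝ) • A) *ᵥ fun j => (X i j : ℝ)) j := by
    intro Z X i j
    have h1 : (tupleMul g (intTuple (toY Z X)) i j).1 =
        ∑ l, (g j l).1 * (((toY Z X i l : SInt S) : ℚ) : ℝ) := map_sum (atReal S) _ _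
    rw [h1, Matrix.smul_mulVec, Pi.smul_apply, smul_eq_mul]
    simp only [Matrix.mulVec, dotProduct, Finset.mul_sum, ← Finset.sum_add_distrib]
    refine Finset.sum_congr rfl fun l _ => ?_
    simp only [toY, hA, Matrix.map_apply]
    push_cast
    change _ = (g j l).1 * _ + _ * ((g j l).1 * _)
    ring
  have hmem : ∀ Z X, tupleMul g (intTuple (toY Z X)) ∈ nearMultiple S h ε n ↔
      ∀ i, X i ∈ P Z i := by
    intro Z X
    have hO : ∀ i j, tupleMul g (intTuple (toY Z X)) i j ∈ OS S := fun i j =>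
      mulVec_mem_OS hgO (fun l => by
        change toQS S _ ∈ OS S
        rw [map_intCast]
        exact int_mem_OS _) j
    refine forall_congr' fun i => forall_congr' fun j => ?_
    rw [hreal, and_iff_left (hO i j)]
    simp only [Pi.sub_apply, Pi.smul_apply]
    rw [nsmul_eq_mul]
    rw [show ∀ a b c : ℝ, a + b - c = b - (c - a) by intros; ring]
  have hsub : ∀ Z X, toY Z X ∈ E ↔ ∀ i, X i ∈ P Z i := by
    intro Z X
    rw [← hmem]
    refine ⟨fun hY => hY.2, fun hY => ⟨⟨linearIndependent_of_mem_nearMultiple hε0 hε hn hY,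
      fun j => ?_⟩, hY⟩⟩
    have h1 := (mem_residues_iff (D := D) (x := (Z j).1)
      (y := fun i => ((Z j).1 i : ℕ) + q * X i j) (fun i => X i j) (fun i => rfl) hq).1 (Z j).2
    intro c
    simpa [toY] using h1 c
  let F : (Σ Z : Fin d → residues D q, ∀ i, P Z i) → E := fun a =>
    ⟨toY a.1 fun i => (a.2 i).1, (hsub _ _).2 fun i => (a.2 i).2⟩
  have hinj : ∀ Z X Z' X', toY Z X = toY Z' X' → Z = Z' ∧ X = X' := by
    intro Z X Z' X' hh
    have h1 : ∀ i j, (((Z j).1 i : ℕ) : ℤ) + q * X i j = (((Z' j).1 i : ℕ) : ℤ) + q * X' i j :=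
      fun i j => by
        have := congrArg (fun x : SInt S => (x : ℚ)) (congrFun (congrFun hh i) j)
        simp only [toY] at this
        exact_mod_cast this
    have hqz : (q : ℤ) ≠ 0 := by exact_mod_cast hq.ne'
    have h2 : ∀ (x : Fin q) (t : ℤ), (((x : ℕ) : ℤ) + q * t) % q = (x : ℕ) := fun x t => by
      rw [Int.add_mul_emod_self_left]
      exact Int.emod_eq_of_lt (by positivity) (by exact_mod_cast x.2)
    have h3 : Z = Z' := by
      funext j
      refine Subtype.ext (funext fun i => Fin.ext ?_)
      have h4 := congrArg (· % (q : ℤ)) (h1 i j)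
      simp only [h2] at h4
      exact_mod_cast h4
    subst h3
    refine ⟨rfl, ?_⟩
    funext i j
    exact mul_left_cancel₀ hqz (add_left_cancel (h1 i j))
  have hbij : Function.Bijective F := by
    constructor
    · rintro ⟨Z, X⟩ ⟨Z', X'⟩ hh
      obtain ⟨h1, h2⟩ := hinj _ _ _ _ (congrArg Subtype.val hh)
      dsimp only at h1
      subst h1
      congr 1
      funext i
      exact Subtype.ext (congrFun h2 i)
    · rintro ⟨Y, hY⟩
      choose y hy using fun i j => exists_int_of_mem_OS (mem_OS_of_mulVec_mem
        (x := intTuple Y i) hgO hgp (fun j => (hY.2 i j).2) j)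
      let Z₀ : Fin d → Fin r → Fin q := fun j i => ⟨(y i j % q).toNat, by
        have h1 := Int.emod_lt_of_pos (y i j) (by exact_mod_cast hq : (0 : ℤ) < q)
        have h2 := Int.emod_nonneg (y i j) (by exact_mod_cast hq.ne' : (q : ℤ) ≠ 0)
        omega⟩
      have hZ₀ : ∀ i j, y i j = ((Z₀ j i : ℕ) : ℤ) + q * (y i j / q) := fun i j => by
        have h2 := Int.emod_nonneg (y i j) (by exact_mod_cast hq.ne' : (q : ℤ) ≠ 0)
        have h3 : ((Z₀ j i : ℕ) : ℤ) = y i j % q := Int.toNat_of_nonneg h2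
        rw [h3, Int.emod_add_mul_ediv]
      let Z : Fin d → residues D q := fun j => ⟨Z₀ j,
        (mem_residues_iff (fun i => y i j / q) (fun i => hZ₀ i j) hq).2 fun c => by
          have := hY.1.2 j c
          simpa [hy] using this⟩
      have hYZ : toY Z (fun i j => y i j / q) = Y := by
        funext i j
        rw [hy i j, hZ₀ i j]
      refine ⟨⟨Z, fun i => ⟨fun j => y i j / q, ?_⟩⟩, Subtype.ext hYZ⟩
      exact (hsub Z fun i j => y i j / q).1 (hYZ.symm ▸ hY) i
  have hfin' : ∀ Z, Finite (∀ i, P Z i) := fun Z => inferInstance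
  refine ⟨?_, ?_⟩
  · have : Finite E := Finite.of_surjective F hbij.2
    exact Set.toFinite E
  · rw [← Nat.card_congr (Equiv.ofBijective F hbij), Nat.card_sigma]
    exact Finset.sum_congr rfl fun Z _ => Nat.card_pi

end IndependentTuples

/-! ### The mean number of full rank tuples -/

theorem encard_pi_const {α : Type*} {A : Set α} (hA : A.Finite) (r : ℕ) :
    (Set.pi Set.univ fun _ : Fin r => A).encard = A.encard ^ r := by
  have h1 : (Set.pi Set.univ fun _ : Fin r => A).Finite := Set.Finite.pi fun _ => hA
  rw [← h1.cast_ncard_eq, ← hA.cast_ncard_eq, ← Nat.card_coe_set_eq, ← Nat.card_coe_set_eq,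
    Nat.card_congr (Equiv.Set.univPi fun _ : Fin r => A), Nat.card_pi]
  simp

theorem finite_latticePoints {d : ℕ} {g : Matrix (Fin d) (Fin d) (QS S)} (hg : IsUnit g.det)
    (R : ℝ) : {z : Fin d → SInt S | (g *ᵥ fun i => toQS S (z i)) ∈ box S d R}.Finite :=
  finite_setOf_lattice_bounded hg R

theorem orbitSum_indicator_le {d r : ℕ} {g : Matrix (Fin d) (Fin d) (QS S)} (hg : IsUnit g.det)
    (𝒴 : Set (Fin r → Fin d → SInt S)) {U : Set (Fin r → Fin d → QS S)} {R : ℝ}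
    (hU : ∀ w ∈ U, ∀ i, w i ∈ box S d R) :
    orbitSum 𝒴 (U.indicator 1) g ≤ (latticeCount g R : ENNReal) ^ r := by
  have h := encard_pi_const (finite_latticePoints hg R) r
  rw [orbitSum_indicator]
  refine (ENat.toENNReal_mono (Set.encard_le_encard fun Y hY => ?_)).trans_eq
    ((congrArg ENat.toENNReal h).trans (by rw [ENat.toENNReal_pow]; rfl))
  exact fun i _ => hU _ hY.2 i

/-- The box of size `2 n` is covered by about `(4 n)^d` translates of the box of size `1`. -/
theorem latticeCount_two_mul_le {d : ℕ} (g : Matrix (Fin d) (Fin d) (QS S)) (n : ℕ) :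
    latticeCount g (2 * n) ≤ ((4 * n + 1) ^ d : ℕ) * latticeCount g 1 := by
  classical
  let F : Finset (Fin d → ℤ) := Fintype.piFinset fun _ => Finset.Icc (-(2 * n : ℤ)) (2 * n)
  let f : (Fin d → SInt S) → Fin d → ℤ := fun z i => ⌊((g *ᵥ fun i => toQS S (z i)) i).1⌋
  set E := {z : Fin d → SInt S | (g *ᵥ fun i => toQS S (z i)) ∈ box S d (2 * n)} with hE
  have hF : F.card = (4 * n + 1) ^ d := by
    simp only [F, Fintype.card_piFinset, Int.card_Icc, Finset.prod_const, Finset.card_univ,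
      Fintype.card_fin]
    congr 1
    omega
  have h1 : E ⊆ ⋃ b ∈ F, {z ∈ E | f z = b} := fun z hz => by
    refine Set.mem_iUnion₂.2 ⟨f z, ?_, hz, rfl⟩
    simp only [F, Fintype.mem_piFinset, Finset.mem_Icc]
    intro i
    have h2 := _root_.abs_le.1 (hz i).1
    constructor
    · refine Int.le_floor.2 ?_
      push_cast
      exact h2.1
    · refine Int.floor_le_iff.2 ?_
      push_cast
      linarith [h2.2]
  have h2 : ∀ b ∈ F, {z ∈ E | f z = b}.encard ≤ latticeCount g 1 := by
    intro b _
    rcases Set.eq_empty_or_nonempty {z ∈ E | f z = b} with h | ⟨z₀, hz₀, hb₀⟩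
    · rw [h]; simp
    · refine Set.encard_le_encard_of_injOn (f := fun z => z - z₀) ?_ ?_
      · rintro z ⟨hz, hb⟩ i
        have h3 : (g *ᵥ fun i => toQS S ((z - z₀) i)) =
            (g *ᵥ fun i => toQS S (z i)) - g *ᵥ fun i => toQS S (z₀ i) := by
          rw [← Matrix.mulVec_sub]
          congr 1
          funext i
          exact map_sub _ _ _
        rw [h3]
        refine ⟨?_, sub_mem (hz i).2 (hz₀ i).2⟩
        exact (Int.abs_sub_lt_one_of_floor_eq_floor (congrFun (hb.trans hb₀.symm) i)).le
      · exact fun z _ z' _ h => sub_left_injective h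
  calc latticeCount g (2 * n) ≤ (⋃ b ∈ F, {z ∈ E | f z = b}).encard := Set.encard_le_encard h1
    _ ≤ ∑ b ∈ F, {z ∈ E | f z = b}.encard := Finset.set_encard_biUnion_le _ _
    _ ≤ ∑ _b ∈ F, latticeCount g 1 := Finset.sum_le_sum h2
    _ = _ := by rw [Finset.sum_const, hF, nsmul_eq_mul]

section Density

variable {d r k : ℕ} {D : Matrix (Fin r) (Fin k) (SInt S)} {q : ℕ}

theorem natCard_pi_residues :
    Fintype.card (Fin d → residues D q) = NDq D q ^ d := by
  rw [Fintype.card_pi, Finset.prod_const, Finset.card_univ, Fintype.card_fin,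
    ← Nat.card_eq_fintype_card, natCard_residues]

theorem tendsto_natCard_tuples (h : r ≤ d) {ε : ℝ} (hε0 : 0 < ε) (hε : ε * (r + 1) < 1)
    (hq : 0 < q) {g : Matrix (Fin d) (Fin d) (QS S)} (hg0 : |(g.det).1| = 1)
    (hgO : ∀ i j, g i j ∈ OS S) (hgp : ∀ p, ‖(g.det).2 p‖ = 1) :
    Filter.Tendsto (fun n : ℕ => (Nat.card {Y ∈ independentTuples d D q |
      tupleMul g (intTuple Y) ∈ nearMultiple S h ε n} : ℝ) / (n : ℝ) ^ (d * r)) Filter.atTop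
      (nhds ((NDq D q : ℝ) ^ d * (((q : ℝ) ^ d)⁻¹ * (2 * ε) ^ d) ^ r)) := by
  have hq' : (0 : ℝ) < q := by exact_mod_cast hq
  have hg1 : (g.det).1 ≠ 0 := fun hh => by simp [hh] at hg0
  have hdet : |((q : ℝ) • g.map (atReal S)).det⁻¹| = ((q : ℝ) ^ d)⁻¹ := by
    rw [Matrix.det_smul, ← det_fst, abs_inv, abs_mul, hg0, mul_one, Fintype.card_fin,
      abs_of_pos (by positivity)]
  have hdet0 : ((q : ℝ) • g.map (atReal S)).det ≠ 0 := by
    rw [Matrix.det_smul, ← det_fst]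
    exact mul_ne_zero (pow_ne_zero _ hq'.ne') hg1
  have h1 : ∀ (Z : Fin d → residues D q) (i : Fin r), Filter.Tendsto
      (fun n : ℕ => (Nat.card (intPoints ((q : ℝ) • g.map (atReal S))
        (n • (Pi.single (Fin.castLE h i) 1 : Fin d → ℝ) -
          g.map (atReal S) *ᵥ fun j => (((Z j).1 i : ℕ) : ℝ)) (n * ε)) : ℝ) / (n : ℝ) ^ d)
      Filter.atTop (nhds (((q : ℝ) ^ d)⁻¹ * (2 * ε) ^ d)) := fun Z i => by
    rw [← hdet]
    exact tendsto_card_intPoints hdet0 _ _ hε0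
  have h2 := tendsto_finsetSum (Finset.univ : Finset (Fin d → residues D q)) fun Z _ =>
    tendsto_finsetProd (Finset.univ : Finset (Fin r)) fun i _ => h1 Z i
  have h3 : ∑ _Z : Fin d → residues D q, ∏ _i : Fin r, (((q : ℝ) ^ d)⁻¹ * (2 * ε) ^ d) =
      (NDq D q : ℝ) ^ d * (((q : ℝ) ^ d)⁻¹ * (2 * ε) ^ d) ^ r := by
    rw [Finset.sum_const, Finset.card_univ, natCard_pi_residues, Finset.prod_const,
      Finset.card_univ, Fintype.card_fin, nsmul_eq_mul]
    push_cast
    rfl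
  rw [h3] at h2
  refine h2.congr' ?_
  filter_upwards [Filter.eventually_gt_atTop 0] with n hn
  rw [(natCard_setOf_tuples h hε0.le hε hq hg1 hgO hgp hn).2]
  push_cast
  rw [Finset.sum_div]
  refine Finset.sum_congr rfl fun Z _ => ?_
  rw [Finset.prod_div_distrib, Finset.prod_const, Finset.card_univ, Fintype.card_fin, pow_mul]

theorem nearMultiple_eq_pi (h : r ≤ d) (ε : ℝ) (n : ℕ) : nearMultiple S h ε n =
    Set.pi Set.univ fun i => Set.pi Set.univ fun j =>
      Set.Icc (n * (Pi.single (Fin.castLE h i) 1 : Fin d → ℝ) j - n * ε)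
        (n * (Pi.single (Fin.castLE h i) 1 : Fin d → ℝ) j + n * ε) ×ˢ
      Set.pi Set.univ fun p : S => Metric.closedBall (0 : ℚ_[p.1.1]) 1 := by
  ext w
  simp only [nearMultiple, Set.mem_ofPred_eq, Set.mem_pi, Set.mem_univ, true_imp_iff, Set.mem_prod,
    Set.mem_Icc, mem_OS, mem_closedBall_zero_iff, _root_.abs_le]
  refine forall_congr' fun i => forall_congr' fun j => and_congr_left fun _ => ?_
  exact ⟨fun hh => ⟨by linarith, by linarith⟩, fun hh => ⟨by linarith, by linarith⟩⟩

theorem isCompact_nearMultiple (h : r ≤ d) (ε : ℝ) (n : ℕ) :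
    IsCompact (nearMultiple S h ε n) := by
  rw [nearMultiple_eq_pi]
  exact isCompact_univ_pi fun _ => isCompact_univ_pi fun _ => isCompact_Icc.prod
    (isCompact_univ_pi fun p => isCompact_closedBall _ _)

theorem muVec_nearMultiple (h : r ≤ d) (ε : ℝ) (n : ℕ) :
    muVec S d r (nearMultiple S h ε n) = ENNReal.ofReal (2 * (n * ε)) ^ (d * r) := by
  have h1 : ∀ p : S, padicHaar p.1.1 (Metric.closedBall (0 : ℚ_[p.1.1]) 1) = 1 := fun p =>
    Measure.addHaarMeasure_self
  have h2 : ∀ a b : ℝ, a + b - (a - b) = 2 * b := fun a b => by ring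
  rw [nearMultiple_eq_pi, muVec]
  simp only [Measure.pi_pi, muQS, Measure.prod_prod, h1, Real.volume_Icc, Finset.prod_const_one,
    mul_one, Finset.prod_const, Finset.card_univ, Fintype.card_fin, h2, ← pow_mul]

theorem mem_box_of_mem_nearMultiple {h : r ≤ d} {ε : ℝ} (hε : ε ≤ 1) {n : ℕ}
    {w : Fin r → Fin d → QS S} (hw : w ∈ nearMultiple S h ε n) (i : Fin r) :
    w i ∈ box S d (2 * n) := by
  refine fun j => ⟨?_, (hw i j).2⟩
  have h1 : |n * (Pi.single (Fin.castLE h i) 1 : Fin d → ℝ) j| ≤ n := by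
    rw [Pi.single_apply]
    split_ifs <;> simp
  have h2 := abs_sub_abs_le_abs_sub (w i j).1 (n * (Pi.single (Fin.castLE h i) 1 : Fin d → ℝ) j)
  have h3 := (hw i j).1
  have h4 : n * ε ≤ n := mul_le_of_le_one_right (Nat.cast_nonneg n) hε
  linarith

/-- The normalized number of tuples converges for every lattice, since every unimodular lattice has
a basis that is integral at the finite places. -/
theorem tendsto_orbitSum_nearMultiple (h : r ≤ d) {ε : ℝ} (hε0 : 0 < ε) (hε : ε * (r + 1) < 1)
    (hq : 0 < q) {g : Matrix (Fin d) (Fin d) (QS S)} (hg : (g.det).1 = 1)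
    (hgp : ∀ p, ‖(g.det).2 p‖ = 1) :
    Filter.Tendsto (fun n : ℕ => ENNReal.ofReal (((n + 1 : ℕ) : ℝ) ^ (d * r))⁻¹ *
      orbitSum (independentTuples d D q) ((nearMultiple S h ε (n + 1)).indicator 1) g)
      Filter.atTop
      (nhds (ENNReal.ofReal ((NDq D q : ℝ) ^ d * (((q : ℝ) ^ d)⁻¹ * (2 * ε) ^ d) ^ r))) := by
  obtain ⟨κ, γ, hκ, hγ, hT⟩ := exists_isSiegel d g (by rw [hg]; exact one_ne_zero) hgp
  -- a basis of the lattice that is integral at the finite places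
  set g' := g * γ.map (toQS S) with hg'
  have hdet : g'.det = g.det := by rw [hg', Matrix.det_mul, det_toQS, hγ, map_one, mul_one]
  have hgO : ∀ i j, g' i j ∈ OS S := fun i j => by
    have h1 : κ *ᵥ (fun l => g' l j) = fun l => (κ * g * γ.map (toQS S)) l j := by
      rw [Matrix.mul_assoc]; rfl
    exact hκ.mulVec_mem_iff.1 (fun l => by rw [h1]; exact hT.mem_OS l j) i
  have h1 := tendsto_natCard_tuples (D := D) h hε0 hε hq (g := g')
    (by rw [hdet, hg, abs_one]) hgO (by rwa [hdet])
  have h2 := (ENNReal.continuous_ofReal.tendsto _).comp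
    (h1.comp (Filter.tendsto_add_atTop_nat 1))
  refine h2.congr fun n => ?_
  have hfin := (natCard_setOf_tuples (D := D) h hε0.le hε hq (g := g')
    (by rw [hdet, hg]; exact one_ne_zero) hgO (by rwa [hdet]) n.succ_pos).1
  rw [← orbitSum_mul isStable_independentTuples _ g hγ, orbitSum_indicator,
    ← hfin.cast_ncard_eq, ← Nat.card_coe_set_eq]
  simp only [Function.comp_apply]
  rw [div_eq_inv_mul, ENNReal.ofReal_mul (by positivity), ENNReal.ofReal_natCast]
  rfl

variable {G : Subgroup (GL (Fin d) (QS S))} [MeasurableSpace (Space G)] [BorelSpace (Space G)]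

/-- The mean number of tuples `g Y` in a set, for `Y` independent with all `d` rows in the sublattice
`{x : (1/q) x D ∈ ℤ_S^k}`, is the volume times the `d`-th power of the density `N(D,q) / q^r` of the
sublattice. The constant is found by counting near large multiples of the standard tuple, where the
tuples are independent automatically, and by dominated convergence. -/
theorem tupleMeasure_independentTuples (hUL : G ≤ ULQ d S) (hSL : SLQ d S ≤ G)
    (m : Measure (Space G)) [IsProbabilityMeasure m] [SMulInvariantMeasure G (Space G) m]
    {s : Space G → G} (hs : IsSection s) (hr : r < d) (hq : 0 < q) :
    tupleMeasure m s (independentTuples d D q) =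
      ENNReal.ofReal ((NDq D q : ℝ) ^ d / (q : ℝ) ^ (d * r)) • muVec S d r := by
  set 𝒴 := independentTuples d D q with h𝒴
  have hunit : ∀ x, IsUnit (s x : GL (Fin d) (QS S)).1.det := fun x =>
    (Matrix.isUnit_iff_isUnit_det _).1 (s x : GL (Fin d) (QS S)).isUnit
  have hbox : IsOpen {w : Fin r → Fin d → QS S | ∀ i j, |(w i j).1| < 1 ∧ w i j ∈ OS S} := by
    have h1 : ∀ i j, Continuous fun w : Fin r → Fin d → QS S => w i j := fun i j => by fun_prop
    have h2 : {w : Fin r → Fin d → QS S | ∀ i j, |(w i j).1| < 1 ∧ w i j ∈ OS S} = ⋂ i, ⋂ j,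
        ((fun w : Fin r → Fin d → QS S => |(w i j).1|) ⁻¹' Set.Iio 1 ∩
          (fun w : Fin r → Fin d → QS S => w i j) ⁻¹' (OS S : Set (QS S))) := by
      ext w
      simp only [Set.mem_ofPred_eq, Set.mem_iInter, Set.mem_inter_iff, Set.mem_preimage,
        Set.mem_Iio, SetLike.mem_coe]
    rw [h2]
    exact isOpen_iInter_of_finite fun i => isOpen_iInter_of_finite fun j =>
      (isOpen_Iio.preimage (h1 i j).fst.abs).inter (isOpen_OS.preimage (h1 i j))
  obtain ⟨c, hc⟩ := exists_tupleMeasure_eq_smul hUL hSL m hs hr isStable_independentTuples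
    (𝒴 := 𝒴) (fun Y hY => exists_leftInverse_of_linearIndependent hY.1) hbox
    ⟨0, fun i j => ⟨by simp, zero_mem _⟩⟩ (ne_top_of_le_ne_top
      (lintegral_latticeCount_pow_ne_top hUL hSL m hs hr 1) (lintegral_mono fun x =>
        orbitSum_indicator_le (hunit x) _ fun w hw i j => ⟨(hw i j).1.le, (hw i j).2⟩))
  rw [hc]
  -- this `ε` makes the tuples in `nearMultiple` diagonally dominant
  set ε : ℝ := 1 / (r + 2) with hεdef
  have hε0 : 0 < ε := by positivity
  have hε1 : ε ≤ 1 := by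
    rw [hεdef, div_le_one (by positivity)]
    linarith [Nat.cast_nonneg (α := ℝ) r]
  have hε : ε * (r + 1) < 1 := by
    rw [hεdef, one_div_mul_eq_div, div_lt_one (by positivity)]
    linarith
  have hmeas : ∀ n, MeasurableSet (nearMultiple S hr.le ε n) := fun n =>
    (isCompact_nearMultiple _ _ _).measurableSet
  have hm : ∀ n, Measurable fun x => orbitSum 𝒴 ((nearMultiple S hr.le ε n).indicator 1)
      (s x : GL (Fin d) (QS S)).1 := fun n =>
    measurable_orbitSum_section hs _ (measurable_one.indicator (hmeas n))
  -- `(4 (n + 1) + 1)^d` translates of the unit box are at most `(5 (n + 1))^d`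
  have hbound : ∀ (n : ℕ) x, ENNReal.ofReal (((n + 1 : ℕ) : ℝ) ^ (d * r))⁻¹ *
      orbitSum 𝒴 ((nearMultiple S hr.le ε (n + 1)).indicator 1) (s x : GL (Fin d) (QS S)).1 ≤
      5 ^ (d * r) * (latticeCount (s x : GL (Fin d) (QS S)).1 1 : ENNReal) ^ r := by
    intro n x
    have h1 := orbitSum_indicator_le (hunit x) 𝒴 (U := nearMultiple S hr.le ε (n + 1))
      fun w hw i => mem_box_of_mem_nearMultiple hε1 hw i
    have h2 : (latticeCount (s x : GL (Fin d) (QS S)).1 (2 * (n + 1 : ℕ)) : ENNReal) ≤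
        ((5 * (n + 1)) ^ d : ℕ) * (latticeCount (s x : GL (Fin d) (QS S)).1 1 : ENNReal) := by
      refine (ENat.toENNReal_mono (latticeCount_two_mul_le _ _)).trans ?_
      rw [ENat.toENNReal_mul]
      refine mul_le_mul' ?_ le_rfl
      rw [ENat.toENNReal_coe, Nat.cast_le]
      exact Nat.pow_le_pow_left (by omega) d
    refine (mul_le_mul' le_rfl (h1.trans (pow_le_pow_left' h2 r))).trans_eq ?_
    rw [mul_pow, ← mul_assoc]
    congr 1
    push_cast
    rw [mul_pow, mul_pow, ← pow_mul, ← pow_mul, mul_left_comm, ENNReal.ofReal_inv_of_pos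
      (by positivity), ENNReal.ofReal_pow (by positivity)]
    have h3 : ENNReal.ofReal ((n : ℝ) + 1) = (n : ENNReal) + 1 := by
      rw [ENNReal.ofReal_add (by positivity) zero_le_one]
      simp
    rw [h3, ENNReal.inv_mul_cancel, mul_one]
    · exact pow_ne_zero _ (by simp)
    · exact ENNReal.pow_ne_top (by simp)
  have hlim := tendsto_lintegral_of_dominated_convergence (μ := m)
    (fun x => 5 ^ (d * r) * (latticeCount (s x : GL (Fin d) (QS S)).1 1 : ENNReal) ^ r)
    (fun n => (hm (n + 1)).const_mul (ENNReal.ofReal (((n + 1 : ℕ) : ℝ) ^ (d * r))⁻¹))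
    (fun n => Filter.Eventually.of_forall (hbound n)) (by
      rw [lintegral_const_mul' _ _ (ENNReal.pow_ne_top (by simp))]
      exact ENNReal.mul_ne_top (ENNReal.pow_ne_top (by simp))
        (lintegral_latticeCount_pow_ne_top hUL hSL m hs hr 1))
    (Filter.Eventually.of_forall fun x => tendsto_orbitSum_nearMultiple hr.le hε0 hε hq
      (hUL (s x).2).1 (hUL (s x).2).2)
  rw [lintegral_const, measure_univ, mul_one] at hlim
  have hconst : ∀ n : ℕ, ∫⁻ x, ENNReal.ofReal (((n + 1 : ℕ) : ℝ) ^ (d * r))⁻¹ *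
      orbitSum 𝒴 ((nearMultiple S hr.le ε (n + 1)).indicator 1) (s x : GL (Fin d) (QS S)).1 ∂m =
      c * ENNReal.ofReal ((2 * ε) ^ (d * r)) := by
    intro n
    rw [lintegral_const_mul _ (hm _), ← lintegral_tupleMeasure hs 𝒴
      (measurable_one.indicator (hmeas _)), lintegral_indicator_one (hmeas _), hc,
      Measure.smul_apply, muVec_nearMultiple, ← ENNReal.ofReal_pow (by positivity)]
    change _ * ((c : ENNReal) * _) = _
    rw [mul_left_comm, ← ENNReal.ofReal_mul (by positivity)]
    congr 2
    rw [mul_left_comm, mul_pow, inv_mul_cancel_left₀ (by positivity)]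
  simp only [hconst] at hlim
  -- the normalized integrals do not depend on `n`, so that they equal their limit
  have heq := tendsto_nhds_unique hlim tendsto_const_nhds
  have hq' : (0 : ℝ) < q := by exact_mod_cast hq
  have h5 : (NDq D q : ℝ) ^ d * (((q : ℝ) ^ d)⁻¹ * (2 * ε) ^ d) ^ r =
      (NDq D q : ℝ) ^ d / (q : ℝ) ^ (d * r) * (2 * ε) ^ (d * r) := by
    rw [mul_pow, inv_pow, ← pow_mul, ← pow_mul]
    ring
  rw [h5, ENNReal.ofReal_mul (by positivity)] at heq
  have h6 : (c : ENNReal) = ENNReal.ofReal ((NDq D q : ℝ) ^ d / (q : ℝ) ^ (d * r)) :=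
    (ENNReal.mul_left_inj (ENNReal.ofReal_pos.2 (by positivity)).ne' ENNReal.ofReal_ne_top).1
      heq.symm
  rw [← h6]
  rfl

end Density

/-! ### Pivots and echelon coordinates of a finite sequence of vectors -/

section Pivots

variable {K V : Type*} [Field K] [AddCommGroup V] [Module K V] {k r : ℕ}

open Classical in
/-- The indices of the vectors of a sequence that are not in the span of the preceding ones. -/
noncomputable def pivots (K : Type*) {V : Type*} [Field K] [AddCommGroup V] [Module K V] {k : ℕ}
    (x : Fin k → V) : Finset (Fin k) :=
  Finset.univ.filter fun c => x c ∉ Submodule.span K (x '' Set.Iio c)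

theorem mem_pivots {x : Fin k → V} {c : Fin k} :
    c ∈ pivots K x ↔ x c ∉ Submodule.span K (x '' Set.Iio c) := by
  simp [pivots]

/-- Every vector is in the span of the pivot vectors up to its own place. -/
theorem mem_span_pivots (x : Fin k → V) (c : Fin k) :
    x c ∈ Submodule.span K (x '' {b | b ∈ pivots K x ∧ b ≤ c}) := by
  induction c using WellFoundedLT.induction with
  | _ c ih =>
    by_cases hc : c ∈ pivots K x
    · exact Submodule.subset_span ⟨c, ⟨hc, le_rfl⟩, rfl⟩
    · rw [mem_pivots, not_not] at hc
      refine Submodule.span_le.2 ?_ hc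
      rintro _ ⟨b, hb, rfl⟩
      refine Submodule.span_mono (Set.image_mono ?_) (ih b hb)
      exact fun a ha => ⟨ha.1, ha.2.trans (le_of_lt hb)⟩

theorem linearIndependent_comp_of_mem_pivots {x : Fin k → V} {j : Fin r → Fin k}
    (hj : StrictMono j) (hp : ∀ i, j i ∈ pivots K x) : LinearIndependent K (x ∘ j) := by
  classical
  rw [Fintype.linearIndependent_iff]
  intro a ha
  by_contra! hne
  obtain ⟨i₁, hi₁⟩ := hne
  have hne' : (Finset.univ.filter fun i => a i ≠ 0).Nonempty := ⟨i₁, by simpa using hi₁⟩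
  obtain ⟨i₀, hi₀, hmax⟩ := Finset.exists_max_image _ id hne'
  have h0 : a i₀ ≠ 0 := (Finset.mem_filter.1 hi₀).2
  refine mem_pivots.1 (hp i₀) ?_
  have h1 : a i₀ • x (j i₀) = -∑ i ∈ Finset.univ.erase i₀, a i • x (j i) := by
    rw [eq_neg_iff_add_eq_zero, Finset.add_sum_erase _ (fun i => a i • x (j i)) (Finset.mem_univ _)]
    exact ha
  have h2 : a i₀ • x (j i₀) ∈ Submodule.span K (x '' Set.Iio (j i₀)) := by
    rw [h1]
    refine neg_mem (Submodule.sum_mem _ fun i hi => ?_)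
    by_cases hai : a i = 0
    · rw [hai, zero_smul]
      exact zero_mem _
    · refine Submodule.smul_mem _ _ (Submodule.subset_span ⟨j i, ?_, rfl⟩)
      have h3 : i ≤ i₀ := hmax i (by simpa using hai)
      exact hj (lt_of_le_of_ne h3 (Finset.ne_of_mem_erase hi))
  exact (Submodule.smul_mem_iff _ h0).1 h2

/-- Echelon matrices with pivot columns `e_1, …, e_r` in the places `j`. -/
structure IsEchelon (j : Fin r → Fin k) (E : Matrix (Fin r) (Fin k) K) : Prop where
  strictMono : StrictMono j
  pivot : ∀ i l, E i (j l) = if i = l then 1 else 0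
  zero : ∀ i c, c < j i → E i c = 0

/-- A sequence of vectors has echelon coordinates with respect to its pivot vectors. -/
theorem exists_isEchelon {x : Fin k → V} (hr : (pivots K x).card = r) :
    ∃ (j : Fin r → Fin k) (E : Matrix (Fin r) (Fin k) K), IsEchelon j E ∧
      LinearIndependent K (x ∘ j) ∧ ∀ c, x c = ∑ i, E i c • x (j i) := by
  classical
  set j := (pivots K x).orderEmbOfFin hr with hjdef
  have hj : StrictMono j := ((pivots K x).orderEmbOfFin hr).strictMono
  have hp : ∀ i, j i ∈ pivots K x := fun i => Finset.orderEmbOfFin_mem _ hr i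
  have hli := linearIndependent_comp_of_mem_pivots hj hp
  have h1 : ∀ c, ∃ a : Fin r → K, ∑ i, a i • (if j i ≤ c then x (j i) else 0) = x c := by
    intro c
    rw [← Submodule.mem_span_range_iff_exists_fun]
    refine Submodule.span_mono ?_ (mem_span_pivots (K := K) x c)
    rintro _ ⟨b, ⟨hb, hbc⟩, rfl⟩
    have h2 : b ∈ Set.range j := by
      rw [hjdef, Finset.range_orderEmbOfFin]
      exact hb
    obtain ⟨i, rfl⟩ := h2
    exact ⟨i, if_pos hbc⟩
  choose a ha using h1
  have hsum : ∀ c, x c = ∑ i, (if j i ≤ c then a c i else 0) • x (j i) := fun c => by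
    rw [← ha c]
    refine Finset.sum_congr rfl fun i _ => ?_
    split_ifs <;> simp
  refine ⟨j, Matrix.of fun i c => if j i ≤ c then a c i else 0, ⟨hj, fun i l => ?_, fun i c hc => ?_⟩,
    hli, hsum⟩
  · have h2 : ∑ i, (if j i ≤ j l then a (j l) i else 0) • (x ∘ j) i =
        ∑ i, (if i = l then (1 : K) else 0) • (x ∘ j) i := by
      refine (hsum (j l)).symm.trans ?_
      simp
    exact hli.eq_coords_of_eq h2 i
  · exact if_neg (not_le.2 hc)

theorem IsEchelon.apply_pivot {j : Fin r → Fin k} {E : Matrix (Fin r) (Fin k) K}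
    (hE : IsEchelon j E) {x : Fin k → V} {y : Fin r → V} (hx : ∀ c, x c = ∑ i, E i c • y i)
    (l : Fin r) : x (j l) = y l := by
  rw [hx]
  simp [hE.pivot]

theorem IsEchelon.mem_pivots_iff {j : Fin r → Fin k} {E : Matrix (Fin r) (Fin k) K}
    (hE : IsEchelon j E) {x : Fin k → V} {y : Fin r → V} (hy : LinearIndependent K y)
    (hx : ∀ c, x c = ∑ i, E i c • y i) (c : Fin k) : c ∈ pivots K x ↔ c ∈ Set.range j := by
  rw [mem_pivots]
  constructor
  · intro h
    by_contra hc
    refine h ?_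
    rw [hx]
    refine Submodule.sum_mem _ fun i _ => ?_
    rcases lt_or_ge c (j i) with h1 | h1
    · rw [hE.zero i c h1, zero_smul]
      exact zero_mem _
    · refine Submodule.smul_mem _ _ (Submodule.subset_span ⟨j i, ?_, hE.apply_pivot hx i⟩)
      exact lt_of_le_of_ne h1 fun h2 => hc ⟨i, h2⟩
  · rintro ⟨l, rfl⟩ h
    rw [hE.apply_pivot hx] at h
    refine hy.notMem_span_image (s := Set.Iio l) (x := l) (by simp) (Submodule.span_le.2 ?_ h)
    rintro _ ⟨b, hb, rfl⟩
    rw [hx, SetLike.mem_coe]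
    refine Submodule.sum_mem _ fun i _ => ?_
    rcases lt_or_ge i l with h1 | h1
    · exact Submodule.smul_mem _ _ (Submodule.subset_span ⟨i, h1, rfl⟩)
    · rw [hE.zero i b (lt_of_lt_of_le hb (hE.strictMono.monotone h1)), zero_smul]
      exact zero_mem _

theorem IsEchelon.pivots_eq {j : Fin r → Fin k} {E : Matrix (Fin r) (Fin k) K}
    (hE : IsEchelon j E) {x : Fin k → V} {y : Fin r → V} (hy : LinearIndependent K y)
    (hx : ∀ c, x c = ∑ i, E i c • y i) :
    pivots K x = Finset.univ.map ⟨j, hE.strictMono.injective⟩ := by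
  ext c
  rw [hE.mem_pivots_iff hy hx]
  simp

/-- A sequence of vectors determines its echelon coordinates. -/
theorem IsEchelon.unique {j j' : Fin r → Fin k} {E E' : Matrix (Fin r) (Fin k) K}
    (hE : IsEchelon j E) (hE' : IsEchelon j' E') {x : Fin k → V} {y y' : Fin r → V}
    (hy : LinearIndependent K y) (hy' : LinearIndependent K y')
    (hx : ∀ c, x c = ∑ i, E i c • y i) (hx' : ∀ c, x c = ∑ i, E' i c • y' i) :
    j = j' ∧ E = E' ∧ y = y' := by
  have h1 : Set.range j = Set.range j' := Set.ext fun c =>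
    (hE.mem_pivots_iff hy hx c).symm.trans (hE'.mem_pivots_iff hy' hx' c)
  have h2 : j = j' := hE.strictMono.range_inj hE'.strictMono |>.1 h1
  have h3 : y = y' := funext fun i => by
    rw [← hE.apply_pivot hx i, ← hE'.apply_pivot hx' i, h2]
  refine ⟨h2, ?_, h3⟩
  ext1 i c
  refine hy.eq_coords_of_eq (f := fun i => E i c) (g := fun i => E' i c) ?_ i
  rw [← hx c]
  simp only [h3]
  rw [← hx' c]

theorem card_pivots_eq_zero_iff {x : Fin k → V} : (pivots K x).card = 0 ↔ x = 0 := by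
  constructor
  · intro h
    funext c
    have h1 := mem_span_pivots (K := K) x c
    rw [Finset.card_eq_zero.1 h] at h1
    simpa using h1
  · rintro rfl
    rw [Finset.card_eq_zero]
    ext c
    simp [mem_pivots]

theorem card_pivots_eq_iff {x : Fin k → V} :
    (pivots K x).card = k ↔ LinearIndependent K x := by
  constructor
  · intro h
    have h1 : pivots K x = Finset.univ := Finset.eq_univ_of_card _ (by simpa using h)
    exact linearIndependent_comp_of_mem_pivots (j := id) strictMono_id fun i => by simp [h1]
  · intro h
    have hE : IsEchelon id (1 : Matrix (Fin k) (Fin k) K) :=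
      ⟨strictMono_id, fun i l => Matrix.one_apply, fun i c hc => Matrix.one_apply_ne (ne_of_gt hc)⟩
    rw [hE.pivots_eq h fun c => by simp [Matrix.one_apply]]
    simp

end Pivots

/-! ### Reduced integral matrices -/

section Reduced

variable {r k : ℕ}

/-- A rational matrix with an entry `1` has a positive multiple that is integral with entries of
greatest common divisor `1`: take the least common denominator. The entry `1` becomes the
multiplier, so a common divisor would divide the denominator. -/
theorem exists_primitive_multiple (E : Matrix (Fin r) (Fin k) ℚ) {i₀ : Fin r} {c₀ : Fin k}
    (h1 : E i₀ c₀ = 1) : ∃ (n : ℕ) (M : Matrix (Fin r) (Fin k) ℤ), 0 < n ∧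
      (∀ i c, (n : ℚ) * E i c = M i c) ∧
      (Finset.univ : Finset (Fin r × Fin k)).gcd (fun ij => M ij.1 ij.2) = 1 := by
  classical
  have hex : ∃ n : ℕ, 0 < n ∧ ∀ i c, ∃ z : ℤ, (n : ℚ) * E i c = z := by
    refine ⟨∏ ij : Fin r × Fin k, (E ij.1 ij.2).den, Finset.prod_pos fun _ _ => Rat.den_pos _,
      fun i c => ?_⟩
    obtain ⟨b, hb⟩ := Finset.dvd_prod_of_mem (fun ij : Fin r × Fin k => (E ij.1 ij.2).den)
      (Finset.mem_univ (i, c))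
    refine ⟨b * (E i c).num, ?_⟩
    rw [hb]
    push_cast
    rw [mul_comm ((E i c).den : ℚ), mul_assoc, Rat.den_mul_eq_num]
  obtain ⟨hn, hM⟩ := Nat.find_spec hex
  have hmin := fun m => Nat.find_min' hex (m := m)
  set n := Nat.find hex
  choose M hM using hM
  refine ⟨n, Matrix.of M, hn, hM, ?_⟩
  set g := (Finset.univ : Finset (Fin r × Fin k)).gcd (fun ij => Matrix.of M ij.1 ij.2) with hg
  have hdvd : ∀ i c, g ∣ M i c := fun i c =>
    Finset.gcd_dvd (f := fun ij : Fin r × Fin k => Matrix.of M ij.1 ij.2) (Finset.mem_univ (i, c))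
  -- as the entry `1` of `E` becomes `n`, the common divisor of the entries of `n E` divides `n`
  have hM₀ : M i₀ c₀ = n := by
    have := hM i₀ c₀
    rw [h1, mul_one] at this
    exact_mod_cast this.symm
  have hgn : g.natAbs ∣ n := by
    have := hdvd i₀ c₀
    rw [hM₀] at this
    exact Int.natAbs_dvd_natAbs.2 this
  obtain ⟨n', hn'⟩ := hgn
  have hg0 : g.natAbs ≠ 0 := fun h => by rw [hn', h, zero_mul] at hn; exact lt_irrefl _ hn
  have hgabs : (g.natAbs : ℤ) = g := by
    rw [Int.natCast_natAbs, Int.abs_eq_normalize]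
    exact Finset.normalize_gcd
  have hn'pos : 0 < n' := Nat.pos_of_ne_zero fun h => by rw [hn', h, mul_zero] at hn; exact lt_irrefl _ hn
  have h2 : n ≤ n' := by
    refine hmin n' ⟨hn'pos, fun i c => ?_⟩
    obtain ⟨b, hb⟩ := hdvd i c
    refine ⟨b, ?_⟩
    have h3 := hM i c
    rw [hn', hb, ← hgabs, Nat.cast_mul, Int.cast_mul, Int.cast_natCast, mul_assoc] at h3
    exact mul_left_cancel₀ (Nat.cast_ne_zero.2 hg0) h3
  have h3 : g.natAbs = 1 := by
    have h4 : g.natAbs * n' ≤ 1 * n' := by rw [← hn', one_mul]; exact h2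
    have := Nat.le_of_mul_le_mul_right h4 hn'pos
    omega
  rw [← hgabs, h3]
  rfl

theorem primitive_multiple_unique {E : Matrix (Fin r) (Fin k) ℚ} {n n' : ℕ}
    {M M' : Matrix (Fin r) (Fin k) ℤ}
    (hM : ∀ i c, (n : ℚ) * E i c = M i c) (hM' : ∀ i c, (n' : ℚ) * E i c = M' i c)
    (hg : (Finset.univ : Finset (Fin r × Fin k)).gcd (fun ij => M ij.1 ij.2) = 1)
    (hg' : (Finset.univ : Finset (Fin r × Fin k)).gcd (fun ij => M' ij.1 ij.2) = 1) : n = n' := by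
  have h1 : (fun ij : Fin r × Fin k => (n' : ℤ) * M ij.1 ij.2) =
      fun ij => (n : ℤ) * M' ij.1 ij.2 := by
    funext ij
    have h2 : ((n' : ℤ) * M ij.1 ij.2 : ℚ) = (n : ℤ) * M' ij.1 ij.2 := by
      rw [← hM, ← hM']
      push_cast
      ring
    exact_mod_cast h2
  have h2 := congrArg (Finset.univ : Finset (Fin r × Fin k)).gcd h1
  rw [Finset.gcd_mul_left, Finset.gcd_mul_left, hg, hg', mul_one, mul_one] at h2
  rw [Int.normalize_of_nonneg (by positivity), Int.normalize_of_nonneg (by positivity)] at h2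
  exact_mod_cast h2.symm

theorem coprime_of_inv_mem {t q : ℕ} (ht : 0 < t) (h : (t : ℚ)⁻¹ ∈ SInt S) (hq : q ∈ NS S) :
    Nat.Coprime t q := by
  refine Nat.Coprime.symm (Nat.coprime_of_dvd fun p hp hpq hpt => ?_)
  by_cases hpS : (⟨p, hp⟩ : PrimeNum) ∈ S
  · have h1 : p ∣ ∏ p ∈ S, (p : ℕ) := Finset.dvd_prod_of_mem (fun p : PrimeNum => (p : ℕ)) hpS
    have h2 := Nat.dvd_gcd hpq h1
    rw [hq.2] at h2
    exact hp.one_lt.ne' (Nat.dvd_one.1 h2)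
  · have : Fact p.Prime := ⟨hp⟩
    have h1 : padicNorm p (t : ℚ)⁻¹ ≤ 1 := h ⟨p, hp⟩ hpS
    have h2 : padicNorm p (t : ℚ) < 1 := by
      have := (padicNorm.nat_lt_one_iff (p := p) t).2 hpt
      exact_mod_cast this
    have h3 : padicNorm p (t : ℚ)⁻¹ * padicNorm p (t : ℚ) = 1 := by
      rw [← padicNorm.mul, inv_mul_cancel₀ (by exact_mod_cast ht.ne'), padicNorm.one]
    have h4 := padicNorm.nonneg (p := p) (t : ℚ)
    nlinarith

theorem inv_mem_of_forall_prime {t : ℕ} (h : ∀ p : PrimeNum, p ∉ S → ¬ (p : ℕ) ∣ t) :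
    (t : ℚ)⁻¹ ∈ SInt S := by
  intro p hp
  rw [← one_div, padicNorm.div, padicNorm_natCast_eq_one_of_not_dvd (h p hp)]
  simp

/-- A positive integer is a product of a unit of `ℤ_S` and an element of `ℕ_S`. -/
theorem exists_eq_mul_mem_NS (S : Finset PrimeNum) (n : ℕ) (hn : 0 < n) :
    ∃ t q : ℕ, n = t * q ∧ 0 < t ∧ q ∈ NS S ∧ (t : ℚ)⁻¹ ∈ SInt S := by
  induction n using Nat.strong_induction_on with
  | _ n ih =>
    by_cases h : ∃ p ∈ S, ((p : PrimeNum) : ℕ) ∣ n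
    · obtain ⟨p, hp, n', rfl⟩ := h
      have hn' : 0 < n' := Nat.pos_of_mul_pos_left hn
      obtain ⟨t, q, rfl, ht, hq, hinv⟩ := ih n' (by nlinarith [p.2.two_le]) hn'
      refine ⟨p * t, q, (mul_assoc _ _ _).symm, Nat.mul_pos p.2.pos ht, hq, ?_⟩
      push_cast
      rw [mul_inv]
      refine mul_mem (inv_mem_of_forall_prime fun p' hp' hd => hp' ?_) hinv
      rwa [Subtype.ext ((Nat.prime_dvd_prime_iff_eq p'.2 p.2).1 hd)]
    · push Not at h
      refine ⟨1, n, (one_mul n).symm, one_pos, ⟨hn, Nat.Coprime.prod_right fun p hp => ?_⟩,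
        by simp [one_mem]⟩
      exact ((Nat.Prime.coprime_iff_not_dvd p.2).2 (h p hp)).symm

/-- The multiplier `t` that makes a reduced `S`-integral matrix primitive is a unit of `ℤ_S`: a
prime outside `S` that divides `t` would divide all entries of `t D`. -/
theorem inv_mem_of_isReduced {D : Matrix (Fin r) (Fin k) (SInt S)} {t : ℕ}
    {M : Matrix (Fin r) (Fin k) ℤ} (hM : ∀ i c, (t : ℚ) * (D i c : ℚ) = M i c)
    (hg : (Finset.univ : Finset (Fin r × Fin k)).gcd (fun ij => M ij.1 ij.2) = 1) :
    (t : ℚ)⁻¹ ∈ SInt S := by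
  refine inv_mem_of_forall_prime fun p hp hpt => ?_
  have h1 : ((p : ℕ) : ℤ) ∣ (Finset.univ : Finset (Fin r × Fin k)).gcd (fun ij => M ij.1 ij.2) := by
    refine Finset.dvd_gcd fun ij _ => ?_
    rw [← padicNorm.int_lt_one_iff, ← hM, padicNorm.mul]
    have h2 : padicNorm p (t : ℚ) < 1 := by
      have := (padicNorm.nat_lt_one_iff (p := p) t).2 hpt
      exact_mod_cast this
    exact mul_lt_one_of_nonneg_of_lt_one_left (padicNorm.nonneg _) h2 ((D ij.1 ij.2).2 p hp)
  rw [hg] at h1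
  exact p.2.one_lt.ne' (by exact_mod_cast Int.eq_one_of_dvd_one (by positivity) h1)

end Reduced

/-! ### The decomposition of integral tuples by their echelon form -/

/-- A tuple of `S`-integral vectors, as a tuple of rational vectors. -/
def ratTuple {d k : ℕ} (X : Fin k → Fin d → SInt S) : Fin k → Fin d → ℚ := fun c j => X c j

/-- The tuples of `S`-integral vectors of rank `r`. -/
def tuplesOfRank (S : Finset PrimeNum) (d k r : ℕ) : Set (Fin k → Fin d → SInt S) :=
  {X | (pivots ℚ (ratTuple X)).card = r}

section Echelon

variable {d k r q : ℕ} {D : Matrix (Fin r) (Fin k) (SInt S)}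

/-- The tuple `(1/q) Y D`. -/
def combine (D : Matrix (Fin r) (Fin k) (SInt S)) (q : ℕ) (Y : independentTuples d D q) :
    Fin k → Fin d → SInt S :=
  fun c j => ⟨(1 / (q : ℚ)) * ∑ i, (Y.1 i j : ℚ) * (D i c : ℚ), Y.2.2 j c⟩

theorem ratTuple_combine (Y : independentTuples d D q) (c : Fin k) :
    ratTuple (combine D q Y) c = ∑ i, (1 / (q : ℚ) * (D i c : ℚ)) • ratTuple Y.1 i := by
  funext j
  simp only [ratTuple, combine, Finset.sum_apply, Pi.smul_apply, smul_eq_mul, Finset.mul_sum]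
  exact Finset.sum_congr rfl fun i _ => by ring

theorem isEchelon_of_mem_DSet (hq : 0 < q) (hD : D ∈ DSet S k r q) :
    ∃ j : Fin r → Fin k, IsEchelon j (Matrix.of fun i c => 1 / (q : ℚ) * (D i c : ℚ)) := by
  obtain ⟨-, j, hj, h1, h2⟩ := hD
  have hq' : (q : ℚ) ≠ 0 := by exact_mod_cast hq.ne'
  refine ⟨j, hj, fun i l => ?_, fun i c hc => ?_⟩
  · rw [Matrix.of_apply, h1]
    split_ifs <;> simp [hq']
  · rw [Matrix.of_apply, h2 i c hc]
    simp

theorem combine_mem_tuplesOfRank (hq : 0 < q) (hD : D ∈ DSet S k r q)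
    (Y : independentTuples d D q) : combine D q Y ∈ tuplesOfRank S d k r := by
  obtain ⟨j, hE⟩ := isEchelon_of_mem_DSet hq hD
  have h1 := hE.pivots_eq (x := ratTuple (combine D q Y)) Y.2.1 (ratTuple_combine Y)
  change (pivots ℚ (ratTuple (combine D q Y))).card = r
  rw [h1]
  simp

/-- The matrix `D / q` determines `q`, because its primitive multiple is `t q` with `t` a unit of
`ℤ_S` and `q` coprime to the primes in `S_f`. -/
theorem q_eq_of_isReduced {q' : ℕ} (hq : q ∈ NS S) (hq' : q' ∈ NS S)
    {D' : Matrix (Fin r) (Fin k) (SInt S)} (hD : IsReduced D) (hD' : IsReduced D')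
    (h : ∀ i c, 1 / (q : ℚ) * (D i c : ℚ) = 1 / (q' : ℚ) * (D' i c : ℚ)) : q = q' := by
  obtain ⟨t, M, ht, hM, hg⟩ := hD
  obtain ⟨t', M', ht', hM', hg'⟩ := hD'
  have hq0 : (q : ℚ) ≠ 0 := by exact_mod_cast hq.1.ne'
  have hq0' : (q' : ℚ) ≠ 0 := by exact_mod_cast hq'.1.ne'
  have h1 : t * q = t' * q' := by
    refine primitive_multiple_unique (E := Matrix.of fun i c => 1 / (q : ℚ) * (D i c : ℚ))
      (fun i c => ?_) (fun i c => ?_) hg hg'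
    · rw [Matrix.of_apply, ← hM]
      push_cast
      field_simp
    · rw [Matrix.of_apply, h, ← hM']
      push_cast
      field_simp
  have h2 : Nat.Coprime t' q := coprime_of_inv_mem ht' (inv_mem_of_isReduced hM' hg') hq
  have h3 : Nat.Coprime t q' := coprime_of_inv_mem ht (inv_mem_of_isReduced hM hg) hq'
  refine Nat.dvd_antisymm ?_ ?_
  · exact h2.symm.dvd_of_dvd_mul_left (h1 ▸ Nat.dvd_mul_left q t)
  · exact h3.symm.dvd_of_dvd_mul_left (h1.symm ▸ Nat.dvd_mul_left q' t')

/-- Every tuple of rank `r ≥ 1` is `(1/q) Y D` for exactly one triple `(q, D, Y)`: the columns of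
`Y` are the pivot vectors of the tuple, and `D / q` consists of its echelon coordinates. -/
theorem bijective_combine (hr : 1 ≤ r) : Function.Bijective
    (fun a : Σ q : NS S, Σ D : DSet S k r q, independentTuples d D.1 q =>
      (⟨combine a.2.1.1 a.1 a.2.2, combine_mem_tuplesOfRank a.1.2.1 a.2.1.2 a.2.2⟩ :
        tuplesOfRank S d k r)) := by
  constructor
  · rintro ⟨⟨q, hq⟩, ⟨D, hD⟩, Y⟩ ⟨⟨q', hq'⟩, ⟨D', hD'⟩, Y'⟩ h
    have hX : combine D q Y = combine D' q' Y' := congrArg Subtype.val h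
    obtain ⟨j, hE⟩ := isEchelon_of_mem_DSet hq.1 hD
    obtain ⟨j', hE'⟩ := isEchelon_of_mem_DSet hq'.1 hD'
    obtain ⟨-, h1, h2⟩ := hE.unique hE' (x := ratTuple (combine D q Y)) Y.2.1 Y'.2.1
      (ratTuple_combine Y) (fun c => by rw [hX]; exact ratTuple_combine Y' c)
    have h3 : ∀ i c, 1 / (q : ℚ) * (D i c : ℚ) = 1 / (q' : ℚ) * (D' i c : ℚ) := fun i c =>
      congrFun (congrFun h1 i) c
    have h4 := q_eq_of_isReduced hq hq' hD.1 hD'.1 h3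
    subst h4
    have hq0 : (1 / (q : ℚ)) ≠ 0 := one_div_ne_zero (by exact_mod_cast hq.1.ne')
    have h5 : D = D' := by
      ext1 i c
      exact Subtype.ext (mul_left_cancel₀ hq0 (h3 i c))
    subst h5
    have h6 : Y = Y' := Subtype.ext (funext fun i => funext fun l =>
      Subtype.ext (congrFun (congrFun h2 i) l))
    subst h6
    rfl
  · rintro ⟨X, hX⟩
    obtain ⟨j, E, hE, hli, hx⟩ := exists_isEchelon (x := ratTuple X) hX
    have h1 : E ⟨0, hr⟩ (j ⟨0, hr⟩) = 1 := by rw [hE.pivot, if_pos rfl]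
    obtain ⟨n, M, hn, hM, hg⟩ := exists_primitive_multiple E h1
    -- `q` is the part of the denominator prime to `S_f`; the rest is a unit of `ℤ_S`
    obtain ⟨t, q, rfl, ht, hq, htS⟩ := exists_eq_mul_mem_NS S n hn
    have ht0 : (t : ℚ) ≠ 0 := by exact_mod_cast ht.ne'
    have hq0 : (q : ℚ) ≠ 0 := by exact_mod_cast hq.1.ne'
    have hqE : ∀ i c, (q : ℚ) * E i c = (t : ℚ)⁻¹ * M i c := fun i c => by
      rw [← hM]
      push_cast
      field_simp
    let D : Matrix (Fin r) (Fin k) (SInt S) := Matrix.of fun i c => ⟨(q : ℚ) * E i c, by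
      rw [hqE]
      exact mul_mem htS (intCast_mem _ _)⟩
    have hDE : ∀ i c, (D i c : ℚ) = q * E i c := fun _ _ => rfl
    have hD : D ∈ DSet S k r q := by
      refine ⟨⟨t, M, ht, fun i c => ?_, hg⟩, j, hE.strictMono, fun i l => ?_, fun i c hc => ?_⟩
      · rw [hDE, ← hM]
        push_cast
        ring
      · rw [hDE, hE.pivot]
        split_ifs <;> simp
      · refine Subtype.ext ?_
        rw [hDE, hE.zero i c hc, mul_zero]
        rfl
    have hsum : ∀ l c, (1 / (q : ℚ)) * ∑ i, (X (j i) l : ℚ) * (D i c : ℚ) = X c l := fun l c => by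
      have h2 := congrFun (hx c) l
      simp only [ratTuple, Finset.sum_apply, Pi.smul_apply, smul_eq_mul] at h2
      rw [h2, Finset.mul_sum]
      refine Finset.sum_congr rfl fun i _ => ?_
      rw [hDE]
      field_simp
    refine ⟨⟨⟨q, hq⟩, ⟨D, hD⟩, ⟨fun i => X (j i), hli, fun l c => ?_⟩⟩, ?_⟩
    · rw [hsum]
      exact (X c l).2
    · refine Subtype.ext (funext fun c => funext fun l => Subtype.ext ?_)
      exact hsum l c

theorem intTuple_combine (Y : independentTuples d D q) :
    intTuple (combine D q Y) = applyD D q (intTuple Y.1) := by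
  funext c j
  simp only [intTuple, combine, applyD, toQS_eq, Finset.sum_apply, Pi.smul_apply, smul_eq_mul]
  rw [Finset.mul_sum, map_sum]
  refine Finset.sum_congr rfl fun i _ => ?_
  rw [← map_mul]
  congr 1
  ring

theorem tupleMul_applyD (g : Matrix (Fin d) (Fin d) (QS S)) (w : Fin r → Fin d → QS S) :
    tupleMul g (applyD D q w) = applyD D q (tupleMul g w) := by
  funext c
  simp only [tupleMul, applyD]
  rw [Matrix.mulVec_sum]
  exact Finset.sum_congr rfl fun i _ => Matrix.mulVec_smul _ _ _

theorem orbitSum_tuplesOfRank (hr : 1 ≤ r) (F : (Fin k → Fin d → QS S) → ENNReal)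
    (g : Matrix (Fin d) (Fin d) (QS S)) :
    orbitSum (tuplesOfRank S d k r) F g = ∑' q : NS S, ∑' D : DSet S k r q,
      orbitSum (independentTuples d D.1 q) (fun w => F (applyD D.1 q w)) g := by
  rw [orbitSum, ← (Equiv.ofBijective _ (bijective_combine (S := S) (d := d) (k := k) hr)).tsum_eq,
    ENNReal.tsum_sigma']
  refine tsum_congr fun q => ?_
  rw [ENNReal.tsum_sigma']
  refine tsum_congr fun D => tsum_congr fun Y => ?_
  rw [Equiv.ofBijective_apply, intTuple_combine, tupleMul_applyD]

theorem tuplesOfRank_zero : tuplesOfRank S d k 0 = {0} := by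
  ext X
  rw [tuplesOfRank, Set.mem_ofPred_eq, card_pivots_eq_zero_iff, Set.mem_singleton_iff]
  constructor
  · intro h
    funext c j
    exact Subtype.ext (congrFun (congrFun h c) j)
  · rintro rfl
    rfl

theorem tuplesOfRank_self :
    tuplesOfRank S d k k = independentTuples d (1 : Matrix (Fin k) (Fin k) (SInt S)) 1 := by
  ext X
  rw [tuplesOfRank, Set.mem_ofPred_eq, card_pivots_eq_iff]
  refine (and_iff_left fun j c => ?_).symm
  exact mul_mem (by simp [one_mem]) (sum_mem fun i _ => mul_mem (X i j).2 (SetLike.coe_mem _))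

theorem NDq_one_one : NDq (1 : Matrix (Fin k) (Fin k) (SInt S)) 1 = 1 := by
  rw [NDq, Nat.card_eq_one_iff_unique]
  refine ⟨⟨fun a b => Subtype.ext (Subsingleton.elim _ _)⟩, ⟨⟨fun _ => 0, fun c => ?_⟩⟩⟩
  simp [zero_mem]

theorem orbitSum_univ (F : (Fin k → Fin d → QS S) → ENNReal)
    (g : Matrix (Fin d) (Fin d) (QS S)) :
    orbitSum Set.univ F g = ∑ r ∈ Finset.range (k + 1), orbitSum (tuplesOfRank S d k r) F g := by
  classical
  have h1 : ∀ r, orbitSum (tuplesOfRank S d k r) F g = ∑' X,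
      (tuplesOfRank S d k r).indicator (fun X => F (tupleMul g (intTuple X))) X := fun r =>
    tsum_subtype (tuplesOfRank S d k r) fun X => F (tupleMul g (intTuple X))
  rw [orbitSum, tsum_univ fun X => F (tupleMul g (intTuple X))]
  simp only [h1]
  rw [← Summable.tsum_finsetSum fun r _ => ENNReal.summable]
  refine tsum_congr fun X => ?_
  rw [Finset.sum_eq_single (pivots ℚ (ratTuple X)).card]
  · rw [Set.indicator_of_mem]
    rfl
  · intro r _ hr
    exact Set.indicator_of_notMem (fun h => hr h.symm) _
  · intro h
    refine absurd (Finset.mem_range.2 (Nat.lt_succ_of_le ?_)) h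
    exact (Finset.card_le_univ _).trans_eq (Fintype.card_fin k)

end Echelon

section MeanValue

variable {d k : ℕ} {G : Subgroup (GL (Fin d) (QS S))} [MeasurableSpace (Space G)]
  [BorelSpace (Space G)]

theorem continuous_applyD {r : ℕ} (D : Matrix (Fin r) (Fin k) (SInt S)) (q : ℕ) :
    Continuous (applyD (d := d) D q) := by
  have h : ∀ (i : Fin r) (a : QS S), Continuous fun v : Fin r → Fin d → QS S => a • v i :=
    fun i a => (continuous_const_smul a).comp (continuous_apply i)
  exact continuous_pi fun c => continuous_finsetSum _ fun i _ => h i _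

/-- The mean value formula for nonnegative measurable functions. -/
theorem lintegral_orbitSum_univ (hUL : G ≤ ULQ d S) (hSL : SLQ d S ≤ G) (m : Measure (Space G))
    [IsProbabilityMeasure m] [SMulInvariantMeasure G (Space G) m] {s : Space G → G}
    (hs : IsSection s) (hk : 1 ≤ k) (hkd : k < d) {F : (Fin k → Fin d → QS S) → ENNReal}
    (hF : Measurable F) :
    ∫⁻ x, orbitSum Set.univ F (s x : GL (Fin d) (QS S)).1 ∂m =
      F 0 + ∫⁻ v, F v ∂(muVec S d k) + ∑ r ∈ Finset.Icc 1 (k - 1), ∑' q : NS S,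
        ∑' D : DSet S k r q, ENNReal.ofReal ((NDq D.1 q : ℝ) ^ d / ((q : ℕ) : ℝ) ^ (d * r)) *
          ∫⁻ v, F (applyD D.1 q v) ∂(muVec S d r) := by
  have hm : ∀ {r : ℕ} (𝒴 : Set (Fin r → Fin d → SInt S)) {F : (Fin r → Fin d → QS S) → ENNReal},
      Measurable F → Measurable fun x => orbitSum 𝒴 F (s x : GL (Fin d) (QS S)).1 :=
    fun 𝒴 _ hF => measurable_orbitSum_section hs 𝒴 hF
  have h0 : ∫⁻ x, orbitSum (tuplesOfRank S d k 0) F (s x : GL (Fin d) (QS S)).1 ∂m = F 0 := by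
    have h1 : ∀ g : Matrix (Fin d) (Fin d) (QS S), orbitSum (tuplesOfRank S d k 0) F g = F 0 := by
      intro g
      rw [tuplesOfRank_zero, orbitSum,
        tsum_singleton (0 : Fin k → Fin d → SInt S) fun X => F (tupleMul g (intTuple X))]
      congr 1
      funext i j
      simp [tupleMul, intTuple, Matrix.mulVec, dotProduct]
    simp [h1]
  have hkk : ∫⁻ x, orbitSum (tuplesOfRank S d k k) F (s x : GL (Fin d) (QS S)).1 ∂m =
      ∫⁻ v, F v ∂(muVec S d k) := by
    rw [tuplesOfRank_self, ← lintegral_tupleMeasure hs _ hF,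
      tupleMeasure_independentTuples hUL hSL m hs hkd one_pos, NDq_one_one]
    simp
  have hr : ∀ r ∈ Finset.Icc 1 (k - 1),
      ∫⁻ x, orbitSum (tuplesOfRank S d k r) F (s x : GL (Fin d) (QS S)).1 ∂m = ∑' q : NS S,
        ∑' D : DSet S k r q, ENNReal.ofReal ((NDq D.1 q : ℝ) ^ d / ((q : ℕ) : ℝ) ^ (d * r)) *
          ∫⁻ v, F (applyD D.1 q v) ∂(muVec S d r) := by
    intro r hr
    rw [Finset.mem_Icc] at hr
    have hFD : ∀ (q : NS S) (D : DSet S k r q), Measurable fun w : Fin r → Fin d → QS S =>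
        F (applyD D.1 q w) := fun q D => hF.comp (continuous_applyD _ _).measurable
    have : ∀ q : NS S, Countable (DSet S k r q) := fun q => by
      have : Countable (Matrix (Fin r) (Fin k) (SInt S)) :=
        inferInstanceAs (Countable (Fin r → Fin k → SInt S))
      exact Subtype.countable
    simp only [orbitSum_tuplesOfRank hr.1]
    rw [lintegral_tsum fun q => (Measurable.tsum fun D => hm _ (hFD q D)).aemeasurable]
    refine tsum_congr fun q => ?_
    rw [lintegral_tsum fun D => (hm _ (hFD q D)).aemeasurable]
    refine tsum_congr fun D => ?_
    rw [← lintegral_tupleMeasure hs _ (hFD q D),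
      tupleMeasure_independentTuples hUL hSL m hs (by omega) q.2.1, lintegral_smul_measure]
    rfl
  simp only [orbitSum_univ]
  rw [lintegral_finsetSum _ fun r _ => hm _ hF, Finset.sum_range_succ, hkk, Finset.range_eq_Ico,
    Finset.sum_eq_sum_Ico_succ_bot hk, h0, ← Finset.sum_congr rfl hr]
  have h1 : Finset.Ico (0 + 1) k = Finset.Icc 1 (k - 1) := by
    ext r
    simp only [Finset.mem_Ico, Finset.mem_Icc]
    omega
  rw [h1, add_assoc, add_assoc]
  congr 1
  exact add_comm _ _

end MeanValue

/-! ### Compactly supported functions and the transform -/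

section Support

variable {d k : ℕ}

/-- The coordinates of a bounded set become integral at the finite places after multiplication by
a power of the product of the primes in `S`. -/
theorem exists_pow_smul_mem_box {K : Set (Fin k → Fin d → QS S)} (hK : Bornology.IsBounded K) :
    ∃ (N : ℕ) (R : ℝ), ∀ w ∈ K, ∀ i, toQS S ((primesUnit S : SInt S) ^ N) • w i ∈ box S d R := by
  obtain ⟨B, hB⟩ := hK.exists_norm_le
  have h1 : ∀ w ∈ K, ∀ i j, ‖w i j‖ ≤ B := fun w hw i j =>
    (norm_le_pi_norm (w i) j).trans ((norm_le_pi_norm w i).trans (hB w hw))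
  have h2 : ∀ᶠ N : ℕ in Filter.atTop, ∀ p : S, ‖(toQS S (primesUnit S)).2 p‖ ^ N * B ≤ 1 := by
    rw [Filter.eventually_all]
    intro p
    have h3 := (tendsto_pow_atTop_nhds_zero_of_lt_one (norm_nonneg _)
      (norm_primesUnit_lt_one p)).mul_const B
    rw [zero_mul] at h3
    exact (h3.eventually_lt_const one_pos).mono fun _ h => h.le
  obtain ⟨N, hN⟩ := h2.exists
  refine ⟨N, |(toQS S ((primesUnit S : SInt S) ^ N)).1| * B, fun w hw i j => ⟨?_, fun p => ?_⟩⟩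
  · rw [Pi.smul_apply, smul_eq_mul, Prod.fst_mul, abs_mul]
    exact mul_le_mul_of_nonneg_left ((norm_fst_le _).trans (h1 w hw i j)) (abs_nonneg _)
  · rw [Pi.smul_apply, smul_eq_mul, Prod.snd_mul, Pi.mul_apply, norm_mul, map_pow, Prod.pow_snd,
      Pi.pow_apply, norm_pow]
    refine le_trans (mul_le_mul_of_nonneg_left ?_ (by positivity)) (hN p)
    exact (norm_le_pi_norm _ p).trans ((norm_snd_le _).trans (h1 w hw i j))

/-- The tuples of lattice vectors in a bounded set are counted by the powers of the number of
lattice vectors in a box: multiplication by a unit of `ℤ_S` makes them integral at the finite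
places. -/
theorem encard_lattice_tuples_le {g : Matrix (Fin d) (Fin d) (QS S)} (hg : IsUnit g.det)
    {K : Set (Fin k → Fin d → QS S)} {N : ℕ} {R : ℝ}
    (hK : ∀ w ∈ K, ∀ i, toQS S ((primesUnit S : SInt S) ^ N) • w i ∈ box S d R) :
    {X : Fin k → Fin d → SInt S | tupleMul g (intTuple X) ∈ K}.Finite ∧
    {X : Fin k → Fin d → SInt S | tupleMul g (intTuple X) ∈ K}.encard ≤ latticeCount g R ^ k := by
  set u : SInt S := (primesUnit S : SInt S) ^ N with hu
  have hinj : Function.Injective fun (X : Fin k → Fin d → SInt S) i => u • X i := by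
    intro X X' h
    funext i j
    have h1 : u * X i j = u * X' i j := congrFun (congrFun h i) j
    exact ((primesUnit S).isUnit.pow N).mul_left_cancel h1
  have hmaps : Set.MapsTo (fun (X : Fin k → Fin d → SInt S) i => u • X i)
      {X | tupleMul g (intTuple X) ∈ K} (Set.pi Set.univ fun _ =>
        {z : Fin d → SInt S | (g *ᵥ fun i => toQS S (z i)) ∈ box S d R}) := by
    intro X hX i _
    have h1 : (g *ᵥ fun j => toQS S ((u • X i) j)) = toQS S u • tupleMul g (intTuple X) i := by
      rw [tupleMul, ← Matrix.mulVec_smul]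
      congr 1
      funext j
      exact map_mul _ _ _
    change _ ∈ box S d R
    rw [h1]
    exact hK _ hX i
  have hfin := finite_latticePoints hg R
  have hpi : (Set.pi Set.univ fun _ : Fin k =>
      {z : Fin d → SInt S | (g *ᵥ fun i => toQS S (z i)) ∈ box S d R}).Finite :=
    Set.Finite.pi fun _ => hfin
  refine ⟨Set.Finite.of_finite_image (hpi.subset hmaps.image_subset) hinj.injOn, ?_⟩
  rw [latticeCount, ← encard_pi_const hfin]
  exact Set.encard_le_encard_of_injOn hmaps hinj.injOn

/-- The parametrization of a lattice by `S`-integral coordinates. -/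
noncomputable def latticeEquiv (g : GL (Fin d) (QS S)) : (Fin d → SInt S) ≃ gLattice g :=
  Equiv.ofBijective (fun z => ⟨g.1 *ᵥ fun i => toQS S (z i), _, fun i => toQS_mem_ZS (z i), rfl⟩) <| by
    constructor
    · intro z z' h
      have h1 := congrArg (fun v => (g⁻¹).1 *ᵥ v) (congrArg Subtype.val h)
      simp only [Matrix.mulVec_mulVec, ← Units.val_mul, inv_mul_cancel, Units.val_one,
        Matrix.one_mulVec] at h1
      exact funext fun i => toQS_injective (congrFun h1 i)
    · rintro ⟨w, v, hv, rfl⟩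
      choose z hz using fun i => mem_ZS_iff.1 (hv i)
      refine ⟨z, Subtype.ext ?_⟩
      change (g.1 *ᵥ fun i => toQS S (z i)) = _
      simp only [hz]

/-- The parametrization of tuples of lattice vectors by `S`-integral coordinates. -/
noncomputable def latticeTupleEquiv (k : ℕ) (g : GL (Fin d) (QS S)) :
    (Fin k → Fin d → SInt S) ≃ (Fin k → gLattice g) :=
  Equiv.piCongrRight fun _ => latticeEquiv g

theorem coe_latticeTupleEquiv (g : GL (Fin d) (QS S)) (X : Fin k → Fin d → SInt S) :
    (fun i => (latticeTupleEquiv k g X i : Fin d → QS S)) = tupleMul g.1 (intTuple X) := rfl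

variable {G : Subgroup (GL (Fin d) (QS S))}

theorem finite_support_of_gLattice {f : (Fin k → Fin d → QS S) → ℝ} (hfs : HasCompactSupport f)
    (g : GL (Fin d) (QS S)) : (Function.support fun v : Fin k → gLattice g =>
      f fun i => (v i : Fin d → QS S)).Finite := by
  obtain ⟨N, R, h⟩ := exists_pow_smul_mem_box hfs.isCompact.isBounded
  have h1 := (encard_lattice_tuples_le ((Matrix.isUnit_iff_isUnit_det _).1 g.isUnit) h).1
  refine (h1.image (latticeTupleEquiv k g)).subset fun v hv => ?_
  refine ⟨(latticeTupleEquiv k g).symm v, ?_, Equiv.apply_symm_apply _ _⟩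
  change tupleMul g.1 (intTuple ((latticeTupleEquiv k g).symm v)) ∈ tsupport f
  rw [← coe_latticeTupleEquiv, Equiv.apply_symm_apply]
  exact subset_tsupport f hv

theorem finite_support_transform {f : (Fin k → Fin d → QS S) → ℝ} (hfs : HasCompactSupport f)
    (x : Space G) : (Function.support fun v : Fin k → lattice x =>
      f fun i => (v i : Fin d → QS S)).Finite := by
  induction x using QuotientGroup.induction_on with
  | H g => exact finite_support_of_gLattice hfs g

theorem ofReal_tsum_gLattice {f : (Fin k → Fin d → QS S) → ℝ} (hf0 : ∀ v, 0 ≤ f v)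
    (hfs : HasCompactSupport f) (g : GL (Fin d) (QS S)) :
    ENNReal.ofReal (∑' v : Fin k → gLattice g, f fun i => (v i : Fin d → QS S)) =
      orbitSum Set.univ (fun w => ENNReal.ofReal (f w)) g.1 := by
  rw [ENNReal.ofReal_tsum_of_nonneg (fun v => hf0 _)
    (summable_of_hasFiniteSupport (finite_support_of_gLattice hfs g)), orbitSum,
    tsum_univ fun X => ENNReal.ofReal (f (tupleMul g.1 (intTuple X))),
    ← (latticeTupleEquiv k g).tsum_eq]
  rfl

theorem ofReal_siegel [MeasurableSpace (Space G)] {s : Space G → G} (hs : IsSection s)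
    {f : (Fin k → Fin d → QS S) → ℝ} (hf0 : ∀ v, 0 ≤ f v) (hfs : HasCompactSupport f)
    (x : Space G) : ENNReal.ofReal (siegel f x) =
      orbitSum Set.univ (fun w => ENNReal.ofReal (f w)) (s x : GL (Fin d) (QS S)).1 := by
  have h := ofReal_tsum_gLattice hf0 hfs (s x : GL (Fin d) (QS S))
  rw [← h]
  conv_lhs => rw [← hs.mk_eq x]
  rfl

theorem siegel_nonneg {f : (Fin k → Fin d → QS S) → ℝ} (hf0 : ∀ v, 0 ≤ f v) (x : Space G) :
    0 ≤ siegel f x := tsum_nonneg fun _ => hf0 _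

/-- A compactly supported function is bounded, so its transform is dominated by a moment of the
number of lattice vectors in a box. -/
theorem lintegral_orbitSum_ne_top [MeasurableSpace (Space G)] [BorelSpace (Space G)]
    (hUL : G ≤ ULQ d S) (hSL : SLQ d S ≤ G) (m : Measure (Space G)) [IsFiniteMeasure m]
    [SMulInvariantMeasure G (Space G) m] {s : Space G → G} (hs : IsSection s) (hkd : k < d)
    {f : (Fin k → Fin d → QS S) → ℝ} (hfc : Continuous f) (hfs : HasCompactSupport f) :
    ∫⁻ x, orbitSum Set.univ (fun w => ENNReal.ofReal (f w)) (s x : GL (Fin d) (QS S)).1 ∂m ≠ ⊤ := by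
  obtain ⟨B, hB⟩ := hfc.bounded_above_of_compact_support hfs
  obtain ⟨N, R, h⟩ := exists_pow_smul_mem_box hfs.isCompact.isBounded
  have h1 : ∀ x, orbitSum Set.univ (fun w => ENNReal.ofReal (f w)) (s x : GL (Fin d) (QS S)).1 ≤
      ENNReal.ofReal B * (latticeCount (s x : GL (Fin d) (QS S)).1 R : ENNReal) ^ k := by
    intro x
    have h2 := (encard_lattice_tuples_le ((Matrix.isUnit_iff_isUnit_det _).1
      (s x : GL (Fin d) (QS S)).isUnit) h).2
    have h3 : orbitSum Set.univ ((tsupport f).indicator 1) (s x : GL (Fin d) (QS S)).1 ≤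
        (latticeCount (s x : GL (Fin d) (QS S)).1 R : ENNReal) ^ k := by
      rw [orbitSum_indicator, ← ENat.toENNReal_pow]
      refine ENat.toENNReal_mono (le_trans (le_of_eq ?_) h2)
      congr 1
      ext X
      simp
    refine le_trans ?_ (mul_le_mul' le_rfl h3)
    rw [orbitSum, orbitSum, ← ENNReal.tsum_mul_left]
    refine ENNReal.tsum_le_tsum fun X => ?_
    by_cases hX : tupleMul (s x : GL (Fin d) (QS S)).1 (intTuple X.1) ∈ tsupport f
    · rw [Set.indicator_of_mem hX, Pi.one_apply, mul_one]
      exact ENNReal.ofReal_le_ofReal ((le_abs_self _).trans (hB _))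
    · rw [image_eq_zero_of_notMem_tsupport hX, ENNReal.ofReal_zero]
      exact zero_le
  refine ne_top_of_le_ne_top ?_ (lintegral_mono h1)
  rw [lintegral_const_mul' _ _ ENNReal.ofReal_ne_top]
  exact ENNReal.mul_ne_top ENNReal.ofReal_ne_top
    (lintegral_latticeCount_pow_ne_top hUL hSL m hs hkd R)

/-- The map `v ↦ (1/q) v D` is a closed embedding, since `v` consists of the pivot columns of its
image. -/
theorem isClosedEmbedding_applyD {r q : ℕ} (hq : 0 < q) {D : Matrix (Fin r) (Fin k) (SInt S)}
    (hD : D ∈ DSet S k r q) : Topology.IsClosedEmbedding (applyD (d := d) D q) := by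
  obtain ⟨-, j, -, h1, -⟩ := hD
  have hq' : (q : ℚ) ≠ 0 := by exact_mod_cast hq.ne'
  have h2 : Function.LeftInverse (fun (w : Fin k → Fin d → QS S) i => w (j i)) (applyD D q) := by
    intro v
    funext l
    simp only [applyD]
    rw [Finset.sum_eq_single l]
    · rw [h1, if_pos rfl, one_div_mul_cancel hq', map_one, one_smul]
    · intro i _ hi
      rw [h1, if_neg hi, mul_zero, map_zero, zero_smul]
    · simp
  exact h2.isClosedEmbedding (continuous_pi fun i => continuous_apply _) (continuous_applyD D q)

end Support

end SArith

theorem mainTheorem1 (S : Finset SArith.PrimeNum) (d k : ℕ) (hd : 2 ≤ d) (hk : 1 ≤ k) (hkd : k ≤ d - 1)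
    (G : Subgroup (GL (Fin d) (SArith.QS S)))
    (hG : G = SArith.ULQ d S ∨ G = SArith.SLQ d S)
    [MeasurableSpace (SArith.Space G)] [BorelSpace (SArith.Space G)]
    (m : Measure (SArith.Space G)) [IsProbabilityMeasure m] [SMulInvariantMeasure G (SArith.Space G) m]
    (f : (Fin k → Fin d → SArith.QS S) → ℝ) (hf0 : ∀ v, 0 ≤ f v) (hfc : Continuous f)
    (hfs : HasCompactSupport f) :
    -- every sum defining the transform is a finite sum, and the transform is integrable
    (∀ x : SArith.Space G,
      (Function.support fun v : Fin k → SArith.lattice x => f fun i => (v i : Fin d → SArith.QS S)).Finite) ∧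
    Integrable (SArith.siegel f : SArith.Space G → ℝ) m ∧
    -- all integrals and sums on the right-hand side converge
    Integrable f (SArith.muVec S d k) ∧
    (∀ r ∈ Finset.Icc 1 (k - 1), ∀ q ∈ SArith.NS S, ∀ D ∈ SArith.DSet S k r q,
      Integrable (fun v => f (SArith.applyD D q v)) (SArith.muVec S d r)) ∧
    (∀ r ∈ Finset.Icc 1 (k - 1),
      Summable fun x : (Σ q : SArith.NS S, SArith.DSet S k r q) =>
        SArith.rogersTerm f x.1 x.2.1) ∧
    -- the moment formula
    ∫ x, SArith.siegel f x ∂m =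
      f 0 + ∫ v, f v ∂(SArith.muVec S d k) +
        ∑ r ∈ Finset.Icc 1 (k - 1), ∑' q : SArith.NS S, ∑' D : SArith.DSet S k r q,
          SArith.rogersTerm f q D.1 := by
  open SArith in
  have hUL : G ≤ ULQ d S := by
    rcases hG with rfl | rfl
    · exact le_rfl
    · exact SLQ_le_ULQ d S
  have hSL : SLQ d S ≤ G := by
    rcases hG with rfl | rfl
    · exact SLQ_le_ULQ d S
    · exact le_rfl
  have hkd' : k < d := by omega
  obtain ⟨s, hs⟩ := exists_measurable_section G
  set F : (Fin k → Fin d → QS S) → ENNReal := fun w => ENNReal.ofReal (f w) with hF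
  have hFm : Measurable F := ENNReal.measurable_ofReal.comp hfc.measurable
  have hsiegel : ∀ x : Space G, ENNReal.ofReal (siegel f x) =
      orbitSum Set.univ F (s x : GL (Fin d) (QS S)).1 := fun x => ofReal_siegel hs hf0 hfs x
  have hfin : ∫⁻ x, ENNReal.ofReal (siegel f x) ∂m ≠ ⊤ := by
    simp only [hsiegel]
    exact lintegral_orbitSum_ne_top hUL hSL m hs hkd' hfc hfs
  have hmeas : Measurable (siegel f : Space G → ℝ) := by
    have h1 : (siegel f : Space G → ℝ) = fun x =>
        (orbitSum Set.univ F (s x : GL (Fin d) (QS S)).1).toReal := funext fun x => by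
      rw [← hsiegel, ENNReal.toReal_ofReal (siegel_nonneg hf0 x)]
    rw [h1]
    exact (measurable_orbitSum_section hs _ hFm).ennreal_toReal
  have hint : Integrable (siegel f : Space G → ℝ) m := by
    refine ⟨hmeas.aestronglyMeasurable, ?_⟩
    rw [hasFiniteIntegral_iff_ofReal (Filter.Eventually.of_forall (siegel_nonneg hf0))]
    exact hfin.lt_top
  have hfint : Integrable f (muVec S d k) := hfc.integrable_of_hasCompactSupport hfs
  have hfD : ∀ (r q : ℕ) (D : Matrix (Fin r) (Fin k) (SInt S)), 0 < q → D ∈ DSet S k r q →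
      Integrable (fun v => f (applyD D q v)) (muVec S d r) := fun r q D hq hD =>
    (hfc.comp (continuous_applyD D q)).integrable_of_hasCompactSupport
      (hfs.comp_isClosedEmbedding (isClosedEmbedding_applyD hq hD))
  have hterm0 : ∀ (r q : ℕ) (D : Matrix (Fin r) (Fin k) (SInt S)), 0 ≤ rogersTerm (d := d) f q D :=
    fun r q D => mul_nonneg (by positivity) (integral_nonneg fun v => hf0 _)
  have hterm : ∀ (r : ℕ) (q : NS S) (D : DSet S k r q),
      ENNReal.ofReal ((NDq D.1 q : ℝ) ^ d / ((q : ℕ) : ℝ) ^ (d * r)) *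
        ∫⁻ v, F (applyD D.1 q v) ∂(muVec S d r) = ENNReal.ofReal (rogersTerm (d := d) f q D.1) := by
    intro r q D
    rw [rogersTerm, ENNReal.ofReal_mul (by positivity), ofReal_integral_eq_lintegral_ofReal
      (hfD r q D.1 q.2.1 D.2) (Filter.Eventually.of_forall fun v => hf0 _)]
  have hmain := lintegral_orbitSum_univ hUL hSL m hs hk hkd' hFm
  simp only [← hsiegel, hterm] at hmain
  rw [← ofReal_integral_eq_lintegral_ofReal hfint (Filter.Eventually.of_forall hf0),
    ← ofReal_integral_eq_lintegral_ofReal hint (Filter.Eventually.of_forall (siegel_nonneg hf0))]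
    at hmain
  have hsum : ∀ r ∈ Finset.Icc 1 (k - 1), ∑' q : NS S, ∑' D : DSet S k r q,
      ENNReal.ofReal (rogersTerm (d := d) f q D.1) ≠ ⊤ := by
    intro r hr h
    refine ENNReal.ofReal_ne_top (hmain.trans (ENNReal.add_eq_top.2 (Or.inr ?_)))
    exact ENNReal.sum_eq_top.2 ⟨r, hr, h⟩
  have hsummable : ∀ r ∈ Finset.Icc 1 (k - 1),
      Summable fun x : (Σ q : NS S, DSet S k r q) => rogersTerm (d := d) f x.1 x.2.1 := by
    intro r hr
    have h1 := hsum r hr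
    rw [← ENNReal.tsum_sigma' fun x : (Σ q : NS S, DSet S k r q) =>
      ENNReal.ofReal (rogersTerm (d := d) f x.1 x.2.1)] at h1
    refine (ENNReal.summable_toReal h1).congr fun x => ?_
    exact ENNReal.toReal_ofReal (hterm0 _ _ _)
  refine ⟨fun x => finite_support_transform hfs x, hint, hfint,
    fun r _ q hq D hD => hfD r q D hq.1 hD, hsummable, ?_⟩
  have hreal : ∀ r ∈ Finset.Icc 1 (k - 1), ∑' q : NS S, ∑' D : DSet S k r q,
      ENNReal.ofReal (rogersTerm (d := d) f q D.1) =
      ENNReal.ofReal (∑' q : NS S, ∑' D : DSet S k r q, rogersTerm (d := d) f q D.1) := by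
    intro r hr
    have h1 := hsummable r hr
    rw [← h1.tsum_sigma, ENNReal.ofReal_tsum_of_nonneg (fun x => hterm0 _ _ _) h1,
      ENNReal.tsum_sigma']
  rw [Finset.sum_congr rfl hreal] at hmain
  have htsum0 : ∀ r ∈ Finset.Icc 1 (k - 1),
      0 ≤ ∑' q : NS S, ∑' D : DSet S k r q, rogersTerm (d := d) f q D.1 := fun r _ =>
    tsum_nonneg fun q => tsum_nonneg fun D => hterm0 _ _ _
  have hint0 : 0 ≤ ∫ v, f v ∂(muVec S d k) := integral_nonneg hf0
  rw [← ENNReal.ofReal_sum_of_nonneg htsum0, hF,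
    ← ENNReal.ofReal_add (hf0 0) hint0, ← ENNReal.ofReal_add (add_nonneg (hf0 0) hint0)
      (Finset.sum_nonneg htsum0)] at hmain
  exact (ENNReal.ofReal_eq_ofReal_iff (integral_nonneg (siegel_nonneg hf0))
    (add_nonneg (add_nonneg (hf0 0) hint0) (Finset.sum_nonneg htsum0))).1 hmain
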